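/- **Setting.** Let $L>0$, let $q:\mathbb R\to\mathbb C$ be $L$-periodic with $q|_{[0,L]}\in C^2$, and let $Y(x,z)$ be the $2\times2$ solution of $Y_x=(-iz\sigma_3+Q)Y$, $Y(0,z)=I$, where $Q=\begin{pmatrix}0&q\\-q^*&0\end{pmatrix}$. Put $\Delta(z)=\frac12\operatorname{tr}Y(L,z)$, $U=\frac1{\sqrt2}\begin{pmatrix}1&1\\-i&i\end{pmatrix}$ and $\tilde Y=UYU^{-1}$, with entries $\tilde y_{ij}$. The *main eigenvalues* are the zeros of $\Delta^2-1$, the *band edges* $E_k$ are its simple zeros, the *spectrum* is $\Sigma=\{z:\Delta(z)\in[-1,1]\}$, and $\Sigma^o$ is $\Sigma$ without the main eigenvalues. For $z\notin\Sigma$, $\rho(z)$ is the root of $\rho^2-2\Delta(z)\rho+1=0$ with $|\rho|<1$. The *Dirichlet eigenvalues* $\mu_j$, $j\in\mathbb Z$, are the zeros of $\tilde y_{12}(L,\cdot)$ with multiplicity, labelled so that $|\mu_j-j\pi/L|<\pi/(4L)$ for all but finitely many $j$. *Arcs.* $\Gamma_n$, with $n$ in an interval of $\mathbb Z$, are the analytic,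 Schwarz-symmetric curves from infinity to infinity in $\{\operatorname{Im}\Delta=0\}$, other than $\mathbb R$, that contain a spectral band (a nondegenerate arc in $\Sigma$). They are labelled from left to right by their intersections $\xi_n$ with $\mathbb R$ and oriented upwards; $\Gamma_n^\pm=\Gamma_n\cap\mathbb C^\pm$. The real axis is oriented from left to right. The $+$ side is the left side. *Assumptions.* (i) Each arc containing a band meets $\mathbb R$ (so the $\Gamma_n$ cover $\Sigma\setminus\mathbb R$). (ii) Nonreal main eigenvalues are simple zeros of $\Delta^2-1$. (iii) Dirichlet eigenvalues are simple zeros of $\tilde y_{12}(L,\cdot)$, except those at real main eigenvalues of multiplicity $m>2$, which have multiplicity $m/2$. *Signs.* If $\mu_j\notin\Sigma^o$, then $\nu_j=-\operatorname{sgn}\log|\tilde y_{22}(L,\mu_j)|$. If $\mu_j\in\Sigma^o$, then $\nu_j=1$ when $\tilde y_{22}(L,\mu_j)$ is the non-tangential boundary value of $\rho$ at $\mu_j$ from the $+$ side, and $\nu_j=-1$ otherwise. *The matrix $B$.* Let $\pi_j=j\pi/L$ for $j\ne0$ and $\pi_0=1/L$. Assume that the products $$f^0=-\prod_{\nu_j=0}\frac{\mu_j-z}{\pi_j},\qquad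 f^\pm=\prod_{\nu_j=\pm1}\frac{\mu_j-z}{\pi_j},$$ taken as limits of the partial products over $|j|\le N$, converge for all $z$. The contour $\tilde\Gamma$ is $\mathbb R$ together with the part of each $\Gamma_n$ between (and including) its uppermost and lowermost band edge. Let $b$ be any holomorphic branch of $(f^0)^{1/2}/(\Delta^2-1)^{1/4}$ on $\mathbb C\setminus\tilde\Gamma$, i.e. $b^4(\Delta^2-1)=(f^0)^2$. Put $B=ib\operatorname{diag}(f^-,f^+)$ in $\mathbb C^+$ and $B=b\operatorname{diag}(f^+,f^-)$ in $\mathbb C^-$. *The jump matrix.* For $z\in\Gamma_n^\pm$ let $k$ be the number of band edges, and $\mathcal M_n^\pm(z)$ the number of Dirichlet eigenvalues with $\nu=0$, on $\Gamma_n^\pm$ strictly between $z$ and infinity. For real $z$ not equal to any $\xi_n$, consider the arcs $\Gamma_n$ with $n\ge0$, $\xi_n<z$ or with $n<0$, $\xi_n>z$. Let $\mathcal M(z)$ be the number of Dirichlet eigenvalues with $\nu=0$ on the nonreal parts of these arcs, and let $\Omega$ be the set of $z$ for which an odd number of these arcs have an odd number of bands. With $e^{-izx\hat\sigma_3}A=e^{-izx\sigma_3}Ae^{izx\sigma_3}$,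 set $$V(x,z)=\begin{cases}(-1)^{\mathcal M(z)+1}\operatorname{diag}(f^- /f^+,f^+/f^-),&z\in\Omega,\\(-1)^{\mathcal M(z)}\operatorname{diag}(f^- /f^+,f^+/f^-),&z\in\mathbb R\setminus\Omega,\\(-1)^{\mathcal M_n^+(z)}(-i)^k e^{-izx\hat\sigma_3}\begin{pmatrix}0&f^+/f^-\\f^- /f^+&0\end{pmatrix},&z\in\Gamma_n^+,\ k\text{ odd},\\(-1)^{\mathcal M_n^+(z)}(-i)^kI,&z\in\Gamma_n^+,\ k\text{ even},\\(-1)^{\mathcal M_n^-(z)}i^k e^{-izx\hat\sigma_3}\begin{pmatrix}0&f^- /f^+\\f^+/f^-&0\end{pmatrix},&z\in\Gamma_n^-,\ k\text{ odd},\\(-1)^{\mathcal M_n^-(z)}i^kI,&z\in\Gamma_n^-,\ k\text{ even}.\end{cases}$$ **Riemann–Hilbert problem** (for fixed $x\in\mathbb R$ and fixed $0<\delta\le\pi/(4L)$). Find a $2\times2$ matrix function $\Phi(x,\cdot)$ on $\mathbb C\setminus\tilde\Gamma$ such that: 1. $\Phi$ is holomorphic on $\mathbb C\setminus\tilde\Gamma$.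 2. On $\tilde\Gamma$ without the $E_k$ and the $\xi_n$, the non-tangential limits $\Phi_\pm$ exist and are continuous, and $\Phi$ is bounded near every point of $\tilde\Gamma\setminus\{E_k\}$. As the only exception, at points of $\tilde\Gamma\setminus(\{E_k\}\cup\{\xi_n\})$ where $f^+f^-=0$ (there $V$ is singular), $\Phi_-$ need not exist, and $\Phi=O(|z-z_0|^{-1})$ near such a point $z_0$ replaces boundedness. Near each $E_k$, $\Phi=O(|z-E_k|^{-1/4})$. 3. $\Phi_+=\Phi_-V$ at all points of $\tilde\Gamma$ other than the $E_k$, the $\xi_n$ and the zeros of $f^+f^-$. 4. $\Phi=(I+O(1/z))B(z)$ as $z\to\infty$ in $\{|\operatorname{Im}z|\ge\varepsilon|z|\}\setminus\tilde\Gamma$, for every $\varepsilon>0$. 5. There are $c,M>0$ with $|\Phi_{ij}(x,z)|\le Me^{c|z|^2}$ for all $z\in\mathcal D=\{z\in\mathbb C\setminus\tilde\Gamma:|z-E_k|\ge\delta\text{ for all }k\}$. **Theorem 4.2.** For every fixed $x\in\mathbb R$, this Riemann–Hilbert problem has at most one solution: any two solutions coincide on $\mathbb C\setminus\tilde\Gamma$.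 -/

import Mathlib

open Filter Topology

noncomputable section

namespace ZSPeriodic

/-- 2 × 2 complex matrices. -/
abbrev Mat2 : Type := Matrix (Fin 2) (Fin 2) ℂ

/-- The coefficient matrix `-i z σ₃ + Q(x)` of the Zakharov-Shabat system. -/
def zsMatrix (q : ℝ → ℂ) (x : ℝ) (z : ℂ) : Mat2 :=
  !![-(Complex.I * z), q x; -(starRingEnd ℂ (q x)), Complex.I * z]

/-- `Y` is the principal matrix solution of `Y_x = (-i z σ₃ + Q) Y`, `Y(0, z) = I`. -/
structure IsPrincipalSolution (q : ℝ → ℂ) (Y : ℝ → ℂ → Mat2) : Prop where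
  initial : ∀ z, Y 0 z = 1
  ode : ∀ x z i j, HasDerivAt (fun s => Y s z i j) ((zsMatrix q x z * Y x z) i j) x

section Spectral

variable (L : ℝ) (Y : ℝ → ℂ → Mat2)

/-- The Floquet discriminant `Δ(z) = ½ tr Y(L, z)`. -/
def discriminant (z : ℂ) : ℂ := (Y L z).trace / 2

/-- The entire function `Δ² - 1`, whose zeros are the main eigenvalues. -/
def mainFunction (z : ℂ) : ℂ := discriminant L Y z ^ 2 - 1

/-- The unitary matrix `U` of the modified Zakharov-Shabat problem. -/
def matU : Mat2 := ((1 / Real.sqrt 2 : ℝ) : ℂ) • !![1, 1; -Complex.I, Complex.I]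

/-- The modified monodromy matrix `Ỹ(L, z) = U Y(L, z) U⁻¹`. -/
def modMonodromy (z : ℂ) : Mat2 := matU * Y L z * matU⁻¹

/-- `ỹ₁₂(L, z)`, whose zeros are the Dirichlet eigenvalues with base point `0`. -/
def y12 (z : ℂ) : ℂ := modMonodromy L Y z 0 1

/-- `ỹ₂₂(L, z)`. -/
def y22 (z : ℂ) : ℂ := modMonodromy L Y z 1 1

/-- The Lax spectrum `Σ = {z : Δ(z) ∈ [-1, 1]}`. -/
def laxSpectrum : Set ℂ :=
  {z | ∃ r : ℝ, r ∈ Set.Icc (-1 : ℝ) 1 ∧ discriminant L Y z = (r : ℂ)}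

/-- `Σᵒ`: the Lax spectrum without the main eigenvalues. -/
def laxInterior : Set ℂ := {z | z ∈ laxSpectrum L Y ∧ mainFunction L Y z ≠ 0}

/-- The (nondegenerate) band edges `E_k`: the simple zeros of `Δ² - 1`. -/
def bandEdges : Set ℂ := {z | analyticOrderAt (mainFunction L Y) z = 1}

/-- The Floquet multiplier `ρ(z)` for `z ∉ Σ`: the root of `ρ² - 2 Δ(z) ρ + 1 = 0`
with `|ρ| < 1`. -/
def multiplier (z : ℂ) : ℂ :=
  Classical.epsilon fun r : ℂ => r ^ 2 - 2 * discriminant L Y z * r + 1 = 0 ∧ ‖r‖ < 1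

/-- The standing assumptions on the multiplicities: nonreal main eigenvalues are simple, and
Dirichlet eigenvalues are simple, except those at real main eigenvalues of multiplicity
`m > 2`, which have multiplicity `m / 2`. -/
structure MultiplicityAssumptions : Prop where
  main_simple : ∀ z : ℂ, z.im ≠ 0 → mainFunction L Y z = 0 →
    analyticOrderAt (mainFunction L Y) z = 1
  dirichlet_simple : ∀ w : ℂ, y12 L Y w = 0 →
    ¬ (w.im = 0 ∧ 2 < analyticOrderAt (mainFunction L Y) w) →
    analyticOrderAt (y12 L Y) w = 1
  dirichlet_half : ∀ w : ℂ, y12 L Y w = 0 → w.im = 0 →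
    2 < analyticOrderAt (mainFunction L Y) w →
    2 * analyticOrderAt (y12 L Y) w = analyticOrderAt (mainFunction L Y) w

/-- `μ` lists the Dirichlet eigenvalues, each as often as its multiplicity as a zero of
`ỹ₁₂(L, ·)`, and labelled so that `μ_j` lies in the disc of radius `π / (4 L)` about `j π / L`
for all but finitely many `j`. -/
structure IsDirichletEnumeration (μ : ℤ → ℂ) : Prop where
  mult : ∀ w : ℂ, Set.encard {j | μ j = w} = analyticOrderAt (y12 L Y) w
  label : ∀ᶠ j : ℤ in cofinite, ‖μ j - ((j * Real.pi / L : ℝ) : ℂ)‖ < Real.pi / (4 * L)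

/-- The analytic arcs `Γ_n` of `{Im Δ = 0}` that contain at least one spectral band, together
with the assumption that each of them intersects the real axis. Every arc is parametrized so
that `t = 0` is the point on the real axis and `t > 0` is the part in the upper half plane
(that is, it is oriented upwards). -/
structure SpectralArcs where
  /-- the labels `n` in use, a set of consecutive integers (finite or infinite) -/
  index : Set ℤ
  index_ordConnected : index.OrdConnected
  /-- the parametrized arc `Γ_n` -/
  γ : ℤ → ℝ → ℂ
  analytic : ∀ n ∈ index, ∀ t, AnalyticAt ℝ (γ n) t
  regular : ∀ n ∈ index, ∀ t, deriv (γ n) t ≠ 0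
  injective : ∀ n ∈ index, Function.Injective (γ n)
  im_discriminant : ∀ n ∈ index, ∀ t, (discriminant L Y (γ n t)).im = 0
  schwarz : ∀ n ∈ index, ∀ t, γ n (-t) = starRingEnd ℂ (γ n t)
  upward : ∀ n ∈ index, ∀ t, 0 < t → 0 < (γ n t).im
  to_infinity : ∀ n ∈ index, Tendsto (γ n) atTop (Bornology.cobounded ℂ)
  has_band : ∀ n ∈ index, ∃ a b : ℝ, a < b ∧ ∀ t ∈ Set.Icc a b, γ n t ∈ laxSpectrum L Y
  /-- no arc is listed twice -/
  distinct : ∀ m ∈ index, ∀ n ∈ index, Set.range (γ m) = Set.range (γ n) → m = n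
  /-- the labels increase from left to right along the real axis -/
  ordered : ∀ m ∈ index, ∀ n ∈ index, m ≤ n → (γ m 0).re ≤ (γ n 0).re
  /-- every nonreal point of the spectrum lies on one of the arcs -/
  cover : ∀ z : ℂ, z.im ≠ 0 → z ∈ laxSpectrum L Y → ∃ n ∈ index, ∃ t, γ n t = z

end Spectral

/-- `A` is the non-tangential limit of `F` at `z₀` from the left side of the direction `τ`:
the limit within every cone `ε |z - z₀| < Im ((z - z₀) τ*)`, `ε > 0`. The limit from the
right side is obtained with `-τ`. -/
def HasNTLimit {X : Type*} [TopologicalSpace X] (F : ℂ → X) (z₀ τ : ℂ) (A : X) : Prop :=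
  ∀ ε : ℝ, 0 < ε →
    Tendsto F (𝓝[{z | ε * ‖z - z₀‖ < ((z - z₀) * starRingEnd ℂ τ).im}] z₀) (𝓝 A)

/-- The normalizing constants of the products: `j π / L` for `j ≠ 0`, and `1 / L` for `j = 0`. -/
def piConst (L : ℝ) (j : ℤ) : ℂ :=
  if j = 0 then ((1 / L : ℝ) : ℂ) else ((j * Real.pi / L : ℝ) : ℂ)

open Classical in
/-- `f(z) = ∏_{j ∈ s} (μ_j - z) / π_j` for all `z`, where the product is understood
as the limit of the products over `|j| ≤ N` as `N → ∞`, which is required to exist. -/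
def IsSymmetricProduct (L : ℝ) (μ : ℤ → ℂ) (s : Set ℤ) (f : ℂ → ℂ) : Prop :=
  ∀ z : ℂ, Tendsto
    (fun N : ℕ => ∏ j ∈ Finset.Icc (-(N : ℤ)) (N : ℤ),
      if j ∈ s then (μ j - z) / piConst L j else 1) atTop (𝓝 (f z))

namespace SpectralArcs

variable {L : ℝ} {Y : ℝ → ℂ → Mat2} (Γ : SpectralArcs L Y)

/-- The jump contour: the real axis together with the part of each `Γ_n` that does not lie
beyond its uppermost (and lowermost) band edge. -/
def contour : Set ℂ :=
  {z | z.im = 0} ∪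
    {z | ∃ n ∈ Γ.index, ∃ t s : ℝ, |t| ≤ |s| ∧ Γ.γ n s ∈ bandEdges L Y ∧ Γ.γ n t = z}

/-- The points where an arc `Γ_n` crosses the real axis. -/
def crossings : Set ℂ := {z | ∃ n ∈ Γ.index, Γ.γ n 0 = z}

/-- `w` is a point of the spectrum at which `r` is the boundary value of `ρ`, taken from above
on the real axis and from the left on the other bands. -/
def HasMultiplierValue (w r : ℂ) : Prop :=
  (w.im = 0 ∧ HasNTLimit (multiplier L Y) w 1 r) ∨
    ∃ n ∈ Γ.index, ∃ t : ℝ, t ≠ 0 ∧ Γ.γ n t = w ∧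
      HasNTLimit (multiplier L Y) w (deriv (Γ.γ n) t) r

/-- The parameters of the nonreal points of the contour on `Γ_n`, band edges excluded. -/
def arcParams (n : ℤ) : Set ℝ :=
  {t | t ≠ 0 ∧ Γ.γ n t ∈ Γ.contour ∧ Γ.γ n t ∉ bandEdges L Y}

open Classical in
/-- The sign `ν` of a Dirichlet eigenvalue `w`: on `Σᵒ` it is `1` if `ỹ₂₂(L, w) = ρ(w)` and
`-1` otherwise; elsewhere it is `-sgn log |ỹ₂₂(L, w)|`. -/
def nu (w : ℂ) : ℤ :=
  if w ∈ laxInterior L Y then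
    if Γ.HasMultiplierValue w (y22 L Y w) then 1 else -1
  else -((SignType.sign (Real.log ‖y22 L Y w‖) : SignType) : ℤ)

/-- `m_n`, the number of spectral bands on `Γ_n`. -/
def bandCount (n : ℤ) : ℕ :=
  Set.ncard {C : Set ℝ | C.Nontrivial ∧ ∃ t ∈ Γ.γ n ⁻¹' laxSpectrum L Y,
    C = connectedComponentIn (Γ.γ n ⁻¹' laxSpectrum L Y) t}

/-- The parameter `s` lies on the same half of an arc as `t`, farther out from the real axis. -/
def Beyond (t s : ℝ) : Prop := 0 < t * s ∧ |t| < |s|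

/-- The number `k` such that `γ_n(t)` lies on `Γ_{n,k}^±`: the number of band edges met on
`Γ_n^±` between infinity and `γ_n(t)`. The bands are odd, the gaps are even. -/
def level (n : ℤ) (t : ℝ) : ℕ :=
  Set.ncard {s : ℝ | Beyond t s ∧ Γ.γ n s ∈ bandEdges L Y}

/-- `M_n^±` at the point `γ_n(t)`, `t ≠ 0`: the number of Dirichlet eigenvalues with `ν = 0` on
`Γ_n^±` between infinity and `γ_n(t)`. -/
def armCount (μ : ℤ → ℂ) (n : ℤ) (t : ℝ) : ℕ :=
  Set.ncard {j : ℤ | Γ.nu (μ j) = 0 ∧ ∃ s : ℝ, Beyond t s ∧ Γ.γ n s = μ j}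

/-- The arc `Γ_n` crosses the real axis between the base gap (between `Γ_{-1}` and `Γ_0`) and
the real point `y`. -/
def Between (y : ℝ) (n : ℤ) : Prop :=
  n ∈ Γ.index ∧ ((0 ≤ n ∧ (Γ.γ n 0).re < y) ∨ (n < 0 ∧ y < (Γ.γ n 0).re))

/-- `M_n` at the real point `y`: the total number of Dirichlet eigenvalues with `ν = 0` on the
nonreal parts of the arcs between the base gap and `y`. -/
def realCount (μ : ℤ → ℂ) (y : ℝ) : ℕ :=
  Set.ncard {j : ℤ | Γ.nu (μ j) = 0 ∧ ∃ n, Γ.Between y n ∧ ∃ s : ℝ, s ≠ 0 ∧ Γ.γ n s = μ j}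

/-- `Ω`, the union of the real intervals `[ϖ_{2k}, ϖ_{2k+1}]`, where `ϖ_j` are the successive
crossing points of the arcs with an odd number of bands: an odd number of such arcs cross the
real axis between the base gap and `y`. -/
def omegaSet : Set ℝ :=
  {y | Odd (Set.ncard {n : ℤ | Γ.Between y n ∧ Odd (Γ.bandCount n)})}

end SpectralArcs

/-- `e^{-i z x σ̂₃} A = e^{-i z x σ₃} A e^{i z x σ₃}`. -/
def conjExp (x : ℝ) (z : ℂ) (A : Mat2) : Mat2 :=
  Matrix.diagonal ![Complex.exp (-(Complex.I * z * x)), Complex.exp (Complex.I * z * x)] * A *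
    Matrix.diagonal ![Complex.exp (Complex.I * z * x), Complex.exp (-(Complex.I * z * x))]

section RHP

variable {L : ℝ} {Y : ℝ → ℂ → Mat2} (Γ : SpectralArcs L Y) (μ : ℤ → ℂ)
  (fp fm : ℂ → ℂ)

open Classical in
/-- The jump matrix `V` at a point `y` of the real axis. -/
def jumpReal (y : ℝ) : Mat2 :=
  (if y ∈ Γ.omegaSet then (-1 : ℂ) ^ (Γ.realCount μ y + 1) else (-1 : ℂ) ^ Γ.realCount μ y) •
    Matrix.diagonal ![fm y / fp y, fp y / fm y]

open Classical in
/-- The jump matrix `V` at the nonreal point `γ_n(t)`, `t ≠ 0`. -/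
def jumpArc (x : ℝ) (n : ℤ) (t : ℝ) : Mat2 :=
  if 0 < t then
    ((-1 : ℂ) ^ Γ.armCount μ n t * (-Complex.I) ^ Γ.level n t) •
      (if Odd (Γ.level n t) then
        conjExp x (Γ.γ n t)
          !![0, fp (Γ.γ n t) / fm (Γ.γ n t); fm (Γ.γ n t) / fp (Γ.γ n t), 0]
      else 1)
  else
    ((-1 : ℂ) ^ Γ.armCount μ n t * Complex.I ^ Γ.level n t) •
      (if Odd (Γ.level n t) then
        conjExp x (Γ.γ n t)
          !![0, fm (Γ.γ n t) / fp (Γ.γ n t); fp (Γ.γ n t) / fm (Γ.γ n t), 0]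
      else 1)

/-- `b` is a branch of `(f⁰)^{1/2} / (Δ² - 1)^{1/4}`, holomorphic off the jump contour. -/
structure IsBranch (f0 : ℂ → ℂ) (b : ℂ → ℂ) : Prop where
  holomorphic : DifferentiableOn ℂ b Γ.contourᶜ
  fourth_power : ∀ z ∈ Γ.contourᶜ, b z ^ 4 * mainFunction L Y z = f0 z ^ 2

/-- The matrix `B(z)`. -/
def matB (b : ℂ → ℂ) (z : ℂ) : Mat2 :=
  if 0 < z.im then (Complex.I * b z) • Matrix.diagonal ![fm z, fp z]
  else b z • Matrix.diagonal ![fp z, fm z]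

/-- `Φ` solves the Riemann-Hilbert problem (for the given value of `x`). Only the values of `Φ`
off the contour matter. -/
structure IsRHPSolution (b : ℂ → ℂ) (δ x : ℝ) (Φ : ℂ → Mat2) : Prop where
  holomorphic : ∀ i j, DifferentiableOn ℂ (fun z => Φ z i j) Γ.contourᶜ
  /-- continuous boundary values and jump on the real axis, oriented from left to right; the
  lower boundary value may be infinite at the zeros of `f⁺ f⁻` -/
  real_boundary : ∃ Φp Φm : ℝ → Mat2,
    ContinuousOn Φp {y : ℝ | (y : ℂ) ∉ Γ.crossings} ∧
    ContinuousOn Φm {y : ℝ | (y : ℂ) ∉ Γ.crossings ∧ fp y * fm y ≠ 0} ∧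
    (∀ y : ℝ, (y : ℂ) ∉ Γ.crossings → HasNTLimit Φ (y : ℂ) 1 (Φp y)) ∧
    ∀ y : ℝ, (y : ℂ) ∉ Γ.crossings → fp y * fm y ≠ 0 →
      HasNTLimit Φ (y : ℂ) (-1) (Φm y) ∧ Φp y = Φm y * jumpReal Γ μ fp fm y
  /-- continuous boundary values and jump on the nonreal part of the contour, band edges
  excluded; the right boundary value may be infinite at the zeros of `f⁺ f⁻` -/
  arc_boundary : ∀ n ∈ Γ.index, ∃ Φp Φm : ℝ → Mat2,
    ContinuousOn Φp (Γ.arcParams n) ∧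
    ContinuousOn Φm {t ∈ Γ.arcParams n | fp (Γ.γ n t) * fm (Γ.γ n t) ≠ 0} ∧
    (∀ t ∈ Γ.arcParams n, HasNTLimit Φ (Γ.γ n t) (deriv (Γ.γ n) t) (Φp t)) ∧
    ∀ t ∈ Γ.arcParams n, fp (Γ.γ n t) * fm (Γ.γ n t) ≠ 0 →
      HasNTLimit Φ (Γ.γ n t) (-deriv (Γ.γ n) t) (Φm t) ∧
      Φp t = Φm t * jumpArc Γ μ fp fm x n t
  /-- `Φ` stays bounded near the points of the contour (its crossing points included) that are
  neither band edges nor zeros of `f⁺ f⁻` -/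
  locally_bounded : ∀ z₀ ∈ Γ.contour, z₀ ∉ bandEdges L Y →
    (z₀ ∈ Γ.crossings ∨ fp z₀ * fm z₀ ≠ 0) →
    ∃ C : ℝ, ∀ᶠ z in 𝓝[Γ.contourᶜ] z₀, ∀ i j, ‖Φ z i j‖ ≤ C
  /-- at the zeros of `f⁺ f⁻` on the contour, where the jump matrix is singular, `Φ` grows at
  most like a simple pole -/
  simple_pole : ∀ z₀ ∈ Γ.contour, z₀ ∉ bandEdges L Y → fp z₀ * fm z₀ = 0 →
    ∃ C : ℝ, ∀ᶠ z in 𝓝[Γ.contourᶜ] z₀, ∀ i j, ‖Φ z i j‖ ≤ C / ‖z - z₀‖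
  /-- at worst quartic root singularities at the band edges -/
  quartic_root : ∀ e ∈ bandEdges L Y,
    ∃ C : ℝ, ∀ᶠ z in 𝓝[Γ.contourᶜ] e, ∀ i j, ‖Φ z i j‖ ≤ C * ‖z - e‖ ^ (-(1 / 4) : ℝ)
  /-- `Φ = (I + O(1/z)) B(z)` as `z → ∞` non-tangentially to the real axis -/
  asymptotics : ∀ ε : ℝ, 0 < ε → ∃ C R : ℝ, ∀ z ∈ Γ.contourᶜ, R ≤ ‖z‖ → ε * ‖z‖ ≤ |z.im| →
    ∃ A : Mat2, (∀ i j, ‖A i j‖ ≤ C / ‖z‖) ∧ Φ z = (1 + A) * matB fp fm b z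
  /-- growth bound away from the band edges -/
  growth : ∃ c M : ℝ, 0 < c ∧ 0 < M ∧ ∀ z ∈ Γ.contourᶜ,
    (∀ e ∈ bandEdges L Y, δ ≤ ‖z - e‖) → ∀ i j, ‖Φ z i j‖ ≤ M * Real.exp (c * ‖z‖ ^ 2)

end RHP

end ZSPeriodic

end

/-!
For two solutions `Φ₁`, `Φ₂` the matrix `W = Φ₁ adj(Φ₂)` is considered. As
`(A V) adj(B V) = det V • A adj(B)` and all jump matrices have determinant one, `W` has no jump
across the contour. Wherever a boundary value is missing, the singularity of `W` is mild: two
quartic roots make less than a simple pole (`IsRHPSolution.tendsto_mul_zero_of_bandEdge`), and at a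
zero of `f⁺ f⁻` a double pole is excluded by the finite left boundary value. Hence the entries of
`W` extend to entire functions (`IsRHPSolution.exists_entire_extension`). Closedness or local
finiteness of the system of arcs is not needed for this. The contour is contained in the level set
`Im Δ = 0` of the entire function `Δ`, which near a point with `Δ' ≠ 0` is straightened to the real
axis by a local inverse of `Δ`; there Painlevé's theorem applies in a version with boundary values
along the normals only (`exists_extension_across_real`). The points with `Δ' = 0` are isolated, and
they include the crossings of the arcs with the real axis.

The growth condition holds on the circles of radius `(N + 1/2) π / L`, which stay away from the band
edges because `Δ² - 1 = -sin² (L z) + O(e^{2 L |Im z|} / z)`. With the maximum principle, `W` is of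
order at most two on the plane. In a sector about the imaginary axis `W` is
`det B • (1 + A₁) adj(1 + A₂)` with `A₁, A₂ = O(1/z)`, and `det B` is bounded there:
`(det B)² (Δ² - 1)` is the square of the product over all Dirichlet eigenvalues, which is compared
with Euler's product of the sine (`IsDirichletEnumeration.exists_product_bounds`). The remaining
sectors have opening `π / 3`, where order two is admissible in the Phragmén–Lindelöf principle, so
that `W` is constant by Liouville's theorem (`eq_of_circles_of_sector`).

The same applies to `Φ₂ adj(Φ₂) = det Φ₂ • 1`. The difference of the two constants tends to `0` in
the sector, so they agree, and `det Φ₂` is a constant which is not zero because `det B ≠ 0` far out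
in the sector. Hence `Φ₁ = Φ₂`.
-/

noncomputable section

namespace ZSPeriodic

/-! ### Painlevé's theorem on a line -/

open Complex MeasureTheory Set in
/-- The integral over the boundary of a rectangle splits along the real axis. -/
lemma isConservativeOn_of_rect_real_side {f : ℂ → ℂ} {r : ℝ}
    (hv : ∀ x : ℝ, |x| < r → ∀ a b : ℝ, |a| < r → |b| < r →
      IntervalIntegrable (fun s : ℝ => f (x + s * I)) volume a b)
    (h0 : ∀ x₁ x₂ y : ℝ, |x₁| < r → |x₂| < r → |y| < r →
      (∫ t : ℝ in x₁..x₂, f t) - (∫ t : ℝ in x₁..x₂, f (t + y * I)) +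
        I * (∫ s : ℝ in (0 : ℝ)..y, f (x₂ + s * I)) -
        I * (∫ s : ℝ in (0 : ℝ)..y, f (x₁ + s * I)) = 0) :
    IsConservativeOn f (Metric.ball 0 r) := by
  intro z w hzw
  have hz : z ∈ Metric.ball (0 : ℂ) r := hzw (by simp [Rectangle, mem_reProdIm])
  have hw : w ∈ Metric.ball (0 : ℂ) r := hzw (by simp [Rectangle, mem_reProdIm])
  rw [mem_ball_zero_iff] at hz hw
  have hr : 0 < r := (norm_nonneg _).trans_lt hz
  have h00 : |(0 : ℝ)| < r := by simpa using hr
  have h1 := (abs_re_le_norm z).trans_lt hz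
  have h2 := (abs_im_le_norm z).trans_lt hz
  have h3 := (abs_re_le_norm w).trans_lt hw
  have h4 := (abs_im_le_norm w).trans_lt hw
  rw [← add_eq_zero_iff_eq_neg, wedgeIntegral_add_wedgeIntegral_eq]
  have e1 := h0 z.re w.re z.im h1 h3 h2
  have e2 := h0 z.re w.re w.im h1 h3 h4
  have a1 := intervalIntegral.integral_interval_sub_left (hv w.re h3 0 w.im h00 h4)
    (hv w.re h3 0 z.im h00 h2)
  have a2 := intervalIntegral.integral_interval_sub_left (hv z.re h1 0 w.im h00 h4)
    (hv z.re h1 0 z.im h00 h2)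
  simp only [smul_eq_mul]
  rw [← a1, ← a2]
  linear_combination e2 - e1

open Complex MeasureTheory Set in
/-- **Painlevé's theorem on a line**, for bounded functions with boundary values along the
normals: such a function, holomorphic off the real axis, extends across it. -/
theorem exists_extension_across_real {g : ℂ → ℂ} {r C : ℝ}
    (hd : ∀ z : ℂ, |z.re| < r → |z.im| < r → z.im ≠ 0 → DifferentiableAt ℂ g z)
    (hC : ∀ z : ℂ, |z.re| < r → |z.im| < r → z.im ≠ 0 → ‖g z‖ ≤ C)
    (hlim : ∀ x : ℝ, |x| < r →
      Tendsto (fun y : ℝ => g (x + y * I)) (𝓝[≠] 0) (𝓝 (g x))) :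
    ∃ G : ℂ → ℂ, DifferentiableOn ℂ G (Metric.ball 0 r) ∧
      ∀ z ∈ Metric.ball (0 : ℂ) r, z.im ≠ 0 → G z = g z := by
  rcases le_or_gt r 0 with hr | hr
  · exact ⟨0, by simp [Metric.ball_eq_empty.2 hr], by simp [Metric.ball_eq_empty.2 hr]⟩
  -- the bound holds on the real axis as well
  have hCall : ∀ x y : ℝ, |x| < r → |y| < r → ‖g (x + y * I)‖ ≤ C := by
    intro x y hx hy
    by_cases hy0 : y = 0
    · subst hy0
      have h := (hlim x hx).norm
      simp only [ofReal_zero, zero_mul, add_zero]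
      refine le_of_tendsto h ?_
      have : ∀ᶠ y : ℝ in 𝓝[≠] 0, |y| < r := by
        apply nhdsWithin_le_nhds
        have : Tendsto (fun y : ℝ => |y|) (𝓝 0) (𝓝 |(0:ℝ)|) := continuous_abs.tendsto 0
        rw [abs_zero] at this
        exact this.eventually (gt_mem_nhds hr)
      filter_upwards [this, self_mem_nhdsWithin] with y h1 h2
      exact hC _ (by simpa using hx) (by simpa using h1) (by simpa using h2)
    · exact hC _ (by simpa using hx) (by simpa using hy) (by simpa using hy0)
  have hC0 : 0 ≤ C := (norm_nonneg _).trans (hCall 0 0 (by simpa) (by simpa))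
  -- continuity along horizontals off the axis and along verticals
  have hhc : ∀ y : ℝ, |y| < r → y ≠ 0 →
      ContinuousOn (fun t : ℝ => g (t + y * I)) (Ioo (-r) r) := by
    intro y hy hy0 t ht
    have : DifferentiableAt ℂ g (t + y * I) :=
      hd _ (by simpa using abs_lt.2 ht) (by simpa using hy) (by simpa using hy0)
    have hg := this.continuousAt
    exact (ContinuousAt.comp (f := fun t : ℝ => (t + y * I : ℂ)) hg
      (by fun_prop)).continuousWithinAt
  have hvc : ∀ x : ℝ, |x| < r →
      ContinuousOn (fun s : ℝ => g (x + s * I)) (Ioo (-r) r) := by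
    intro x hx s hs
    by_cases hs0 : s = 0
    · subst hs0
      refine ContinuousAt.continuousWithinAt ?_
      rw [continuousAt_iff_punctured_nhds]
      simpa using hlim x hx
    · have : DifferentiableAt ℂ g (x + s * I) :=
        hd _ (by simpa using hx) (by simpa using abs_lt.2 hs) (by simpa using hs0)
      have hg := this.continuousAt
      exact (ContinuousAt.comp (f := fun s : ℝ => (x + s * I : ℂ)) hg
        (by fun_prop)).continuousWithinAt
  have huI : ∀ a b : ℝ, |a| < r → |b| < r → uIcc a b ⊆ Ioo (-r) r := by
    intro a b ha hb
    exact (ordConnected_Ioo).uIcc_subset (abs_lt.1 ha) (abs_lt.1 hb)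
  have hvi : ∀ x : ℝ, |x| < r → ∀ a b : ℝ, |a| < r → |b| < r →
      IntervalIntegrable (fun s : ℝ => g (x + s * I)) volume a b := fun x hx a b ha hb =>
    ((hvc x hx).mono (huI a b ha hb)).intervalIntegrable
  -- a sequence of heights tending to the axis
  have hseq : ∀ y : ℝ, Tendsto (fun n : ℕ => y / ((n : ℝ) + 1)) atTop (𝓝 0) := fun y => by
    have := (tendsto_one_div_add_atTop_nhds_zero_nat (𝕜 := ℝ)).const_mul y
    simpa [mul_one_div, div_eq_mul_inv] using this
  have hseqr : ∀ (y : ℝ) (n : ℕ), |y| < r → |y / ((n : ℝ) + 1)| < r := fun y n hy => by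
    rw [abs_div]
    refine lt_of_le_of_lt (div_le_self (abs_nonneg _) ?_) hy
    rw [abs_of_nonneg (by positivity)]
    linarith [(Nat.cast_nonneg n : (0 : ℝ) ≤ n)]
  have hseq0 : ∀ (y : ℝ) (n : ℕ), y ≠ 0 → y / ((n : ℝ) + 1) ≠ 0 := fun y n hy =>
    div_ne_zero hy (by positivity)
  have hseqlim : ∀ y : ℝ, y ≠ 0 → ∀ x : ℝ, |x| < r →
      Tendsto (fun n : ℕ => g (x + ((y / ((n : ℝ) + 1) : ℝ) : ℂ) * I)) atTop (𝓝 (g x)) := by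
    intro y hy x hx
    exact (hlim x hx).comp (tendsto_nhdsWithin_iff.2
      ⟨hseq y, Eventually.of_forall fun n => hseq0 y n hy⟩)
  have hmeas : ∀ y : ℝ, |y| < r → y ≠ 0 → ∀ a b : ℝ, |a| < r → |b| < r →
      AEStronglyMeasurable (fun t : ℝ => g (t + y * I)) (volume.restrict (uIoc a b)) := by
    intro y hy hy0 a b ha hb
    exact ((hhc y hy hy0).mono (uIoc_subset_uIcc.trans (huI a b ha hb))).aestronglyMeasurable
      measurableSet_uIoc
  have hmeas0 : ∀ a b : ℝ, |a| < r → |b| < r →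
      AEStronglyMeasurable (fun t : ℝ => g t) (volume.restrict (uIoc a b)) := by
    intro a b ha hb
    have hr2 : |r / 2| < r := by rw [abs_of_pos (by positivity)]; linarith
    have hr20 : r / 2 ≠ 0 := by positivity
    refine aestronglyMeasurable_of_tendsto_ae atTop
      (f := fun (n : ℕ) (t : ℝ) => g (t + (((r / 2) / ((n : ℝ) + 1) : ℝ) : ℂ) * I))
      (fun n => hmeas _ (hseqr _ n hr2) (hseq0 _ n hr20) a b ha hb) ?_
    rw [ae_restrict_iff' measurableSet_uIoc]
    refine Eventually.of_forall fun t ht => ?_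
    exact hseqlim _ hr20 t (abs_lt.2 (huI a b ha hb (uIoc_subset_uIcc ht)))
  have hhi : ∀ y : ℝ, |y| < r → ∀ a b : ℝ, |a| < r → |b| < r →
      IntervalIntegrable (fun t : ℝ => g (t + y * I)) volume a b := by
    intro y hy a b ha hb
    refine (intervalIntegrable_const (c := C)).mono_fun ?_ ?_
    · by_cases hy0 : y = 0
      · subst hy0; simpa using hmeas0 a b ha hb
      · exact hmeas y hy hy0 a b ha hb
    · refine (ae_restrict_iff' measurableSet_uIoc).2 (Eventually.of_forall fun t ht => ?_)
      simpa [abs_of_nonneg hC0] using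
        hCall t y (abs_lt.2 (huI a b ha hb (uIoc_subset_uIcc ht))) hy
  -- the Cauchy integral theorem on rectangles with one side on the real axis
  have hrect : ∀ x₁ x₂ y : ℝ, |x₁| < r → |x₂| < r → |y| < r →
      (∫ t : ℝ in x₁..x₂, g t) - (∫ t : ℝ in x₁..x₂, g (t + y * I)) +
        I * (∫ s : ℝ in (0 : ℝ)..y, g (x₂ + s * I)) -
        I * (∫ s : ℝ in (0 : ℝ)..y, g (x₁ + s * I)) = 0 := by
    intro x₁ x₂ y h1 h2 hy
    by_cases hy0 : y = 0
    · subst hy0; simp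
    have hn : ∀ n : ℕ, (∫ t : ℝ in x₁..x₂, g (t + ((y / ((n : ℝ) + 1) : ℝ) : ℂ) * I)) -
        (∫ t : ℝ in x₁..x₂, g (t + y * I)) +
        I * (∫ s : ℝ in (y / ((n : ℝ) + 1))..y, g (x₂ + s * I)) -
        I * (∫ s : ℝ in (y / ((n : ℝ) + 1))..y, g (x₁ + s * I)) = 0 := by
      intro n
      have := integral_boundary_rect_eq_zero_of_differentiableOn g
        ⟨x₁, y / ((n : ℝ) + 1)⟩ ⟨x₂, y⟩ (fun z hz => by
          rw [mem_reProdIm] at hz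
          have hre := huI _ _ h1 h2 hz.1
          have him := huI _ _ (hseqr y n hy) hy hz.2
          refine (hd z (abs_lt.2 hre) (abs_lt.2 him) ?_).differentiableWithinAt
          intro h0
          have hz2 := hz.2
          rw [h0] at hz2
          rcases lt_or_gt_of_ne hy0 with hneg | hpos
          · have : y / ((n : ℝ) + 1) < 0 := div_neg_of_neg_of_pos hneg (by positivity)
            have := hz2.2
            simp only at this
            rcases le_sup_iff.1 this with h | h <;> linarith
          · have : 0 < y / ((n : ℝ) + 1) := by positivity
            have := hz2.1
            simp only at this
            rcases inf_le_iff.1 this with h | h <;> linarith)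
      simpa using this
    have l1 : Tendsto (fun n : ℕ => ∫ t : ℝ in x₁..x₂, g (t + ((y / ((n : ℝ) + 1) : ℝ) : ℂ) * I))
        atTop (𝓝 (∫ t : ℝ in x₁..x₂, g t)) := by
      refine intervalIntegral.tendsto_integral_filter_of_dominated_convergence (fun _ => C)
        (Eventually.of_forall fun n => hmeas _ (hseqr y n hy) (hseq0 y n hy0) _ _ h1 h2)
        (Eventually.of_forall fun n => Eventually.of_forall fun t ht => ?_)
        intervalIntegrable_const (Eventually.of_forall fun t ht => ?_)
      · exact hCall t _ (abs_lt.2 (huI _ _ h1 h2 (uIoc_subset_uIcc ht))) (hseqr y n hy)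
      · exact hseqlim y hy0 t (abs_lt.2 (huI _ _ h1 h2 (uIoc_subset_uIcc ht)))
    have l2 : ∀ x : ℝ, |x| < r → Tendsto (fun n : ℕ => ∫ s : ℝ in (y / ((n : ℝ) + 1))..y,
        g (x + s * I)) atTop (𝓝 (∫ s : ℝ in (0 : ℝ)..y, g (x + s * I))) := by
      intro x hx
      have h00 : |(0 : ℝ)| < r := by simpa using hr
      have hz : Tendsto (fun n : ℕ => ∫ s : ℝ in (0 : ℝ)..(y / ((n : ℝ) + 1)), g (x + s * I))
          atTop (𝓝 0) := by
        have hb : ∀ n : ℕ, ‖∫ s : ℝ in (0 : ℝ)..(y / ((n : ℝ) + 1)), g (x + s * I)‖ ≤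
            C * |y / ((n : ℝ) + 1) - 0| := fun n =>
          intervalIntegral.norm_integral_le_of_norm_le_const fun s hs =>
            hCall x s hx (abs_lt.2 (huI _ _ h00 (hseqr y n hy) (uIoc_subset_uIcc hs)))
        refine squeeze_zero_norm hb ?_
        have := ((hseq y).abs).const_mul C
        simpa using this
      have := hz.const_sub (∫ s : ℝ in (0 : ℝ)..y, g (x + s * I))
      rw [sub_zero] at this
      refine this.congr fun n => ?_
      rw [intervalIntegral.integral_interval_sub_left (hvi x hx _ _ h00 hy)
        (hvi x hx _ _ h00 (hseqr y n hy))]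
    have := (((l1.sub_const (∫ t : ℝ in x₁..x₂, g (t + y * I))).add ((l2 x₂ h2).const_mul I)).sub
      ((l2 x₁ h1).const_mul I))
    exact tendsto_nhds_unique this (tendsto_const_nhds.congr fun n => (hn n).symm)
  have hcons : IsConservativeOn g (Metric.ball 0 r) :=
    isConservativeOn_of_rect_real_side hvi hrect
  -- the primitive
  set F : ℂ → ℂ := fun w => wedgeIntegral 0 w g with hF
  have hFsub : ∀ x₁ y₁ x₂ y₂ : ℝ, |x₁| < r → |y₁| < r → |x₂| < r → |y₂| < r →
      F ⟨x₂, y₂⟩ - F ⟨x₁, y₁⟩ = wedgeIntegral ⟨x₁, y₁⟩ ⟨x₂, y₂⟩ g := by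
    intro x₁ y₁ x₂ y₂ h1 k1 h2 k2
    have h00 : |(0 : ℝ)| < r := by simpa using hr
    have e := hrect x₁ x₂ y₁ h1 h2 k1
    have a1 := intervalIntegral.integral_interval_sub_left (hvi x₂ h2 0 y₂ h00 k2)
      (hvi x₂ h2 0 y₁ h00 k1)
    have hh : ∀ b : ℝ, |b| < r → IntervalIntegrable (fun t : ℝ => g t) volume 0 b := fun b hb => by
      simpa using hhi 0 h00 0 b h00 hb
    have a2 := intervalIntegral.integral_interval_sub_left (hh x₂ h2) (hh x₁ h1)
    simp only [hF, wedgeIntegral, zero_re, zero_im, ofReal_zero, zero_mul, add_zero, smul_eq_mul]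
    rw [← a1]
    rw [← a2] at e
    linear_combination e
  have hFlip : ∀ z w : ℂ, |z.re| < r → |z.im| < r → |w.re| < r → |w.im| < r →
      ‖F w - F z‖ ≤ 2 * C * ‖w - z‖ := by
    intro z w h1 h2 h3 h4
    have := hFsub z.re z.im w.re w.im h1 h2 h3 h4
    simp only [eta] at this
    rw [this, wedgeIntegral]
    have i1 : ‖∫ x : ℝ in z.re..w.re, g (x + z.im * I)‖ ≤ C * |w.re - z.re| :=
      intervalIntegral.norm_integral_le_of_norm_le_const fun t ht =>
        hCall t _ (abs_lt.2 (huI _ _ h1 h3 (uIoc_subset_uIcc ht))) h2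
    have i2 : ‖∫ y : ℝ in z.im..w.im, g (w.re + y * I)‖ ≤ C * |w.im - z.im| :=
      intervalIntegral.norm_integral_le_of_norm_le_const fun t ht =>
        hCall _ t h3 (abs_lt.2 (huI _ _ h2 h4 (uIoc_subset_uIcc ht)))
    have j1 := abs_re_le_norm (w - z)
    have j2 := abs_im_le_norm (w - z)
    rw [sub_re] at j1
    rw [sub_im] at j2
    refine (norm_add_le _ _).trans ?_
    rw [norm_smul, norm_I, one_mul]
    nlinarith
  have hFd : ∀ z : ℂ, |z.re| < r → |z.im| < r → z.im ≠ 0 → HasDerivAt F (g z) z := by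
    intro z h1 h2 h3
    obtain ⟨ρ, hρ, hsub⟩ : ∃ ρ > 0, Metric.ball z ρ ⊆
        {w : ℂ | |w.re| < r ∧ |w.im| < r ∧ w.im ≠ 0} := by
      apply Metric.isOpen_iff.1
      · exact (isOpen_lt (continuous_re.abs) continuous_const).inter
          ((isOpen_lt (continuous_im.abs) continuous_const).inter
            (isOpen_ne_fun continuous_im continuous_const))
      · exact ⟨h1, h2, h3⟩
    have hdz : DifferentiableOn ℂ g (Metric.ball z ρ) := fun w hw =>
      (hd w (hsub hw).1 (hsub hw).2.1 (hsub hw).2.2).differentiableWithinAt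
    have := (hdz.isConservativeOn.hasDerivAt_wedgeIntegral hdz.continuousOn
      (Metric.mem_ball_self hρ)).const_add (F z)
    refine this.congr_of_eventuallyEq ?_
    filter_upwards [Metric.ball_mem_nhds z hρ] with w hw
    have := hFsub z.re z.im w.re w.im h1 h2 (hsub hw).1 (hsub hw).2.1
    simp only [eta] at this
    rw [← this]; ring
  have hKopen : IsOpen {w : ℂ | |w.re| < r ∧ |w.im| < r} :=
    (isOpen_lt continuous_re.abs continuous_const).inter (isOpen_lt continuous_im.abs continuous_const)
  have hFc : ∀ z : ℂ, |z.re| < r → |z.im| < r → ContinuousAt F z := by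
    intro z h1 h2
    rw [ContinuousAt, tendsto_iff_norm_sub_tendsto_zero]
    have hev : ∀ᶠ w in 𝓝 z, ‖F w - F z‖ ≤ 2 * C * ‖w - z‖ := by
      filter_upwards [hKopen.mem_nhds ⟨h1, h2⟩] with w hw
      exact hFlip z w h1 h2 hw.1 hw.2
    refine squeeze_zero' (Eventually.of_forall fun _ => norm_nonneg _) hev ?_
    have : Tendsto (fun w => 2 * C * ‖w - z‖) (𝓝 z) (𝓝 (2 * C * ‖z - z‖)) := by
      apply Continuous.tendsto; fun_prop
    simpa using this
  have hFcons : IsConservativeOn F (Metric.ball 0 r) := by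
    refine isConservativeOn_of_rect_real_side ?_ ?_
    · intro x hx a b ha hb
      refine ContinuousOn.intervalIntegrable fun s hs => ?_
      have hs' := abs_lt.2 (huI a b ha hb hs)
      exact (ContinuousAt.comp (f := fun s : ℝ => (x + s * I : ℂ))
        (hFc _ (by simpa using hx) (by simpa using hs')) (by fun_prop)).continuousWithinAt
    · intro x₁ x₂ y h1 h2 hy
      have h00 : |(0 : ℝ)| < r := by simpa using hr
      have := integral_boundary_rect_eq_zero_of_continuousOn_of_differentiableOn F
        ⟨x₁, 0⟩ ⟨x₂, y⟩ (fun z hz => by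
          rw [mem_reProdIm] at hz
          exact (hFc z (abs_lt.2 (huI _ _ h1 h2 hz.1))
            (abs_lt.2 (huI _ _ h00 hy hz.2))).continuousWithinAt) (fun z hz => by
          rw [mem_reProdIm] at hz
          refine (hFd z (abs_lt.2 (huI _ _ h1 h2 (Ioo_subset_Icc_self hz.1)))
            (abs_lt.2 (huI _ _ h00 hy (Ioo_subset_Icc_self hz.2)))
              ?_).differentiableAt.differentiableWithinAt
          intro h0
          have hz2 := hz.2
          simp only [h0, mem_Ioo] at hz2
          rcases le_total 0 y with h | h <;> simp [h] at hz2)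
      simpa using this
  have hball : ∀ z ∈ Metric.ball (0 : ℂ) r, |z.re| < r ∧ |z.im| < r := fun z hz => by
    rw [mem_ball_zero_iff] at hz
    exact ⟨(abs_re_le_norm z).trans_lt hz, (abs_im_le_norm z).trans_lt hz⟩
  have hFcont : ContinuousOn F (Metric.ball 0 r) := fun z hz =>
    (hFc z (hball z hz).1 (hball z hz).2).continuousWithinAt
  have hFdiff := (isConservativeOn_and_continuousOn_iff_isDifferentiableOn Metric.isOpen_ball).1
    ⟨hFcons, hFcont⟩
  refine ⟨deriv F, hFdiff.deriv Metric.isOpen_ball, fun z hz hz0 => ?_⟩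
  exact (hFd z (hball z hz).1 (hball z hz).2 hz0).deriv

/-! ### Removal of a regular arc of the contour -/

/-- `w` has the limit `A` at `z` along the cones about the normal of the level curve of `Im D`
through `z`, both sides of that curve included. -/
def HasNormalLimit (D w : ℂ → ℂ) (z A : ℂ) : Prop :=
  Tendsto w (𝓝[{z' | ‖deriv D z‖ / 2 * ‖z' - z‖ < |((z' - z) * deriv D z).im| ∧
    (D z').im ≠ 0}] z) (𝓝 A)

open Complex in
/-- Extension across a regular point of the level curve `Im D = 0`: the local inverse of `D`
straightens the curve. -/
theorem exists_analyticAt_of_hasNormalLimit {D w : ℂ → ℂ} {z₀ : ℂ} (hD : Differentiable ℂ D)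
    (him : (D z₀).im = 0) (hD' : deriv D z₀ ≠ 0)
    (hd : ∀ z, (D z).im ≠ 0 → DifferentiableAt ℂ w z)
    (hb : ∃ C : ℝ, ∀ᶠ z in 𝓝 z₀, (D z).im ≠ 0 → ‖w z‖ ≤ C)
    (hl : ∀ᶠ z in 𝓝 z₀, (D z).im = 0 → ∃ A, HasNormalLimit D w z A) :
    ∃ H : ℂ → ℂ, AnalyticAt ℂ H z₀ ∧ ∀ᶠ z in 𝓝 z₀, (D z).im ≠ 0 → w z = H z := by
  obtain ⟨C, hC⟩ := hb
  have hDa : ∀ z, AnalyticAt ℂ D z := fun z => hD.analyticAt z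
  have hst : HasStrictDerivAt D (deriv D z₀) z₀ := (hDa z₀).hasStrictDerivAt
  set ψ : ℂ → ℂ := hst.localInverse D (deriv D z₀) z₀ hD' with hψ
  have hψa : AnalyticAt ℂ ψ (D z₀) := (hDa z₀).analyticAt_localInverse hD'
  have hψ0 : ψ (D z₀) = z₀ := HasStrictFDerivAt.localInverse_apply_image ..
  have hleft : ∀ᶠ z in 𝓝 z₀, ψ (D z) = z := hst.eventually_left_inverse hD'
  have hright : ∀ᶠ u in 𝓝 (D z₀), D (ψ u) = u := hst.eventually_right_inverse hD'
  have hψc : Tendsto ψ (𝓝 (D z₀)) (𝓝 z₀) := by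
    have := hψa.continuousAt.tendsto
    rwa [hψ0] at this
  have hne : ∀ᶠ z in 𝓝 z₀, deriv D z ≠ 0 :=
    (hDa z₀).deriv.continuousAt.eventually_ne hD'
  have hall : ∀ᶠ u in 𝓝 (D z₀), D (ψ u) = u ∧ (∀ᶠ v in 𝓝 u, D (ψ v) = v) ∧
      DifferentiableAt ℂ ψ u ∧
      ((D (ψ u)).im ≠ 0 → ‖w (ψ u)‖ ≤ C) ∧
      ((D (ψ u)).im = 0 → ∃ A, HasNormalLimit D w (ψ u) A) ∧ deriv D (ψ u) ≠ 0 := by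
    filter_upwards [hright, hright.eventually_nhds, hψa.eventually_analyticAt,
      hψc.eventually hC, hψc.eventually hl, hψc.eventually hne] with u h1 h2 h3 h4 h5 h6
    exact ⟨h1, h2, h3.differentiableAt, h4, h5, h6⟩
  obtain ⟨R, hR, hball⟩ := Metric.eventually_nhds_iff_ball.1 hall
  set u₀ : ℂ := D z₀ with hu₀
  have hmem : ∀ v : ℂ, |v.re| < R / 2 → |v.im| < R / 2 → u₀ + v ∈ Metric.ball u₀ R := by
    intro v h1 h2
    rw [mem_ball_iff_norm, add_sub_cancel_left]
    linarith [norm_le_abs_re_add_abs_im v]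
  have him' : ∀ v : ℂ, (u₀ + v).im = v.im := fun v => by rw [add_im, him, zero_add]
  choose! A hA using fun z (h : ∃ A, HasNormalLimit D w z A) => h
  set g : ℂ → ℂ := fun v => if v.im = 0 then A (ψ (u₀ + v)) else w (ψ (u₀ + v)) with hg
  suffices hext : ∃ G : ℂ → ℂ, DifferentiableOn ℂ G (Metric.ball 0 (R / 2)) ∧
      ∀ v ∈ Metric.ball (0 : ℂ) (R / 2), v.im ≠ 0 → G v = g v by
    obtain ⟨G, hG, hGg⟩ := hext
    refine ⟨fun z => G (D z - u₀), ?_, ?_⟩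
    · have : AnalyticAt ℂ G (D z₀ - u₀) := by
        rw [hu₀, sub_self]
        exact hG.analyticAt (Metric.ball_mem_nhds 0 (by positivity))
      exact AnalyticAt.fun_comp (f := fun z => D z - u₀) this ((hDa z₀).sub analyticAt_const)
    · have hc : ∀ᶠ z in 𝓝 z₀, D z - u₀ ∈ Metric.ball (0 : ℂ) (R / 2) := by
        have : Tendsto (fun z => D z - u₀) (𝓝 z₀) (𝓝 (D z₀ - u₀)) :=
          ((hDa z₀).continuousAt.tendsto).sub_const _
        rw [hu₀, sub_self] at this
        exact this.eventually (Metric.ball_mem_nhds 0 (by positivity))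
      filter_upwards [hc, hleft] with z h1 h2 h3
      have h4 : (D z - u₀).im ≠ 0 := by rw [sub_im, him, sub_zero]; exact h3
      rw [hGg _ h1 h4, hg]
      simp only [h4, if_false, add_sub_cancel, h2]
  refine exists_extension_across_real (g := g) (r := R / 2) (C := C) ?_ ?_ ?_
  · intro v h1 h2 h3
    obtain ⟨k1, -, k3, -, -, -⟩ := hball _ (hmem v h1 h2)
    have hwd : DifferentiableAt ℂ w (ψ (u₀ + v)) := hd _ (by rw [k1, him']; exact h3)
    have : DifferentiableAt ℂ (fun v => w (ψ (u₀ + v))) v :=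
      DifferentiableAt.comp (f := fun v => ψ (u₀ + v)) v hwd
        (DifferentiableAt.comp (f := fun v => u₀ + v) v k3 (by fun_prop))
    refine this.congr_of_eventuallyEq ?_
    filter_upwards [(isOpen_ne_fun continuous_im continuous_const).mem_nhds h3] with v' hv'
    exact if_neg hv'
  · intro v h1 h2 h3
    obtain ⟨k1, -, -, k4, -, -⟩ := hball _ (hmem v h1 h2)
    rw [hg]
    simp only [h3, if_false]
    exact k4 (by rw [k1, him']; exact h3)
  · intro x hx
    obtain ⟨k1, k2, k3, -, k5, k6⟩ := hball _ (hmem x (by simpa using hx) (by simpa using hR))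
    set z : ℂ := ψ (u₀ + x) with hz
    have hlimz := hA z (k5 (by rw [k1, him']; simp))
    have hgx : g x = A z := by simp [hg, hz]
    rw [hgx]
    -- the curve `y ↦ ψ (u₀ + x + i y)` leaves `z` in the normal direction
    have hderiv : deriv D z * deriv ψ (u₀ + x) = 1 := by
      have e1 : HasDerivAt (fun u => D (ψ u)) (deriv D z * deriv ψ (u₀ + x)) (u₀ + x) :=
        HasDerivAt.comp _ (hD z).hasDerivAt k3.hasDerivAt
      have e2 : HasDerivAt (fun u => D (ψ u)) 1 (u₀ + x) :=
        (hasDerivAt_id _).congr_of_eventuallyEq k2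
      exact e1.unique e2
    have hcurve : HasDerivAt (fun y : ℝ => ψ (u₀ + (x + y * I))) (deriv ψ (u₀ + x) * I) 0 := by
      have e0 : HasDerivAt ψ (deriv ψ (u₀ + x)) (u₀ + (x + ((0 : ℝ) : ℂ) * I)) := by
        simpa using k3.hasDerivAt
      have e1 : HasDerivAt (fun y : ℝ => u₀ + (x + (y : ℂ) * I)) I 0 := by
        have := (((hasDerivAt_id (0 : ℝ)).ofReal_comp.mul_const I).const_add (x : ℂ)).const_add u₀
        simpa using this
      exact HasDerivAt.comp (0 : ℝ) e0 e1
    have hnorm := hcurve.isLittleO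
    have hDz : 0 < ‖deriv D z‖ := norm_pos_iff.2 k6
    have hsmall := hnorm.def (show 0 < 1 / (8 * ‖deriv D z‖) by positivity)
    have htend : Tendsto (fun y : ℝ => ψ (u₀ + (x + y * I))) (𝓝[≠] 0)
        (𝓝[{z' | ‖deriv D z‖ / 2 * ‖z' - z‖ < |((z' - z) * deriv D z).im| ∧
          (D z').im ≠ 0}] z) := by
      refine tendsto_nhdsWithin_iff.2 ⟨?_, ?_⟩
      · have := hcurve.continuousAt.tendsto
        simp only [ofReal_zero, zero_mul, add_zero, ← hz] at this
        exact this.mono_left nhdsWithin_le_nhds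
      · have hDψ : ∀ᶠ y : ℝ in 𝓝 0, D (ψ (u₀ + (x + y * I))) = u₀ + (x + y * I) := by
          have e1 : ContinuousAt (fun y : ℝ => u₀ + (x + (y : ℂ) * I)) 0 := by fun_prop
          have e2 := e1.tendsto
          simp only [ofReal_zero, zero_mul, add_zero] at e2
          exact e2.eventually k2
        filter_upwards [nhdsWithin_le_nhds hsmall, nhdsWithin_le_nhds hDψ, self_mem_nhdsWithin]
          with y h1 h2 h3
        have hy0 : y ≠ 0 := h3
        refine ⟨?_, ?_⟩
        · simp only [ofReal_zero, zero_mul, add_zero, sub_zero, ← hz, real_smul] at h1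
          set p := ψ (u₀ + (x + y * I)) - z with hp
          have e1 : ‖p * deriv D z - y * I‖ ≤ |y| / 8 := by
            have : p * deriv D z - y * I =
                (p - y * (deriv ψ (u₀ + x) * I)) * deriv D z := by
              linear_combination (y * I : ℂ) * hderiv
            rw [this, norm_mul]
            calc _ ≤ 1 / (8 * ‖deriv D z‖) * ‖y‖ * ‖deriv D z‖ := by gcongr
              _ = |y| / 8 := by rw [Real.norm_eq_abs]; field_simp
          have hypos : 0 < |y| := abs_pos.2 hy0
          have e2 : ‖deriv D z‖ * ‖p‖ ≤ |y| + |y| / 8 := by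
            rw [mul_comm, ← norm_mul]
            calc ‖p * deriv D z‖ = ‖(y * I : ℂ) + (p * deriv D z - y * I)‖ := by ring_nf
              _ ≤ ‖(y * I : ℂ)‖ + ‖p * deriv D z - y * I‖ := norm_add_le _ _
              _ ≤ _ := by
                rw [norm_mul, norm_I, mul_one, norm_real, Real.norm_eq_abs]
                linarith
          have e3 : |y| - |y| / 8 ≤ |(p * deriv D z).im| := by
            have := (abs_im_le_norm _).trans e1
            simp only [sub_im, mul_im, ofReal_re, I_im, mul_one, ofReal_im, I_re, mul_zero,
              add_zero] at this
            have h4 := abs_sub_abs_le_abs_sub y (p * deriv D z).im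
            rw [abs_sub_comm] at h4
            simp only [mul_im] at h4 ⊢
            linarith
          linarith
        · rw [h2, him']
          simpa using hy0
    refine (hlimz.comp htend).congr' ?_
    filter_upwards [self_mem_nhdsWithin] with y hy
    have : ((x : ℂ) + y * I).im ≠ 0 := by simpa using hy
    simp only [Function.comp, hg, if_neg this]

/-! ### Isolated singularities and entire extension -/

/-- **Removable singularities**, in the form: an isolated singularity with `(z - z₀) G(z) → 0`
is removable. -/
lemma exists_analyticAt_of_tendsto_mul {G : ℂ → ℂ} {z₀ : ℂ}
    (hd : ∀ᶠ z in 𝓝[≠] z₀, DifferentiableAt ℂ G z)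
    (h0 : Tendsto (fun z => (z - z₀) * G z) (𝓝[≠] z₀) (𝓝 0)) :
    ∃ H : ℂ → ℂ, AnalyticAt ℂ H z₀ ∧ ∀ᶠ z in 𝓝[≠] z₀, G z = H z := by
  have ho : (fun z => G z - G z₀) =o[𝓝[≠] z₀] fun z => (z - z₀)⁻¹ := by
    rw [Asymptotics.isLittleO_iff_tendsto' (by
      filter_upwards [self_mem_nhdsWithin] with z hz h
      exact absurd (inv_eq_zero.1 h) (sub_ne_zero.2 hz))]
    have h1 : Tendsto (fun z => (z - z₀) * G z₀) (𝓝[≠] z₀) (𝓝 ((z₀ - z₀) * G z₀)) :=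
      (Continuous.tendsto (by fun_prop) z₀).mono_left nhdsWithin_le_nhds
    rw [sub_self, zero_mul] at h1
    have h2 := h0.sub h1
    rw [sub_zero] at h2
    refine h2.congr fun z => ?_
    rw [div_inv_eq_mul]; ring
  have := Complex.differentiableOn_update_limUnder_insert_of_isLittleO (E := ℂ)
    (s := {z | DifferentiableAt ℂ G z}) hd
    (fun z hz => DifferentiableAt.differentiableWithinAt hz) ho
  refine ⟨_, this.analyticAt (insert_mem_nhds_iff.2 hd), ?_⟩
  filter_upwards [self_mem_nhdsWithin] with z hz
  rw [Function.update_of_ne hz]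

/-- An isolated singularity which is at most a double pole is removable if `G` has a finite limit
along some nontrivial filter. -/
lemma tendsto_mul_zero_of_pole_of_tendsto {G : ℂ → ℂ} {z₀ A : ℂ} {C : ℝ} {l : Filter ℂ} [l.NeBot]
    (hl : l ≤ 𝓝[≠] z₀)
    (hd : ∀ᶠ z in 𝓝[≠] z₀, DifferentiableAt ℂ G z)
    (hb : ∀ᶠ z in 𝓝[≠] z₀, ‖G z‖ ≤ C / ‖z - z₀‖ ^ 2)
    (hA : Tendsto G l (𝓝 A)) :
    Tendsto (fun z => (z - z₀) * G z) (𝓝[≠] z₀) (𝓝 0) := by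
  have hsub : Tendsto (fun z => z - z₀) (𝓝[≠] z₀) (𝓝 0) := by
    have : Tendsto (fun z => z - z₀) (𝓝[≠] z₀) (𝓝 (z₀ - z₀)) :=
      (Continuous.tendsto (by fun_prop) z₀).mono_left nhdsWithin_le_nhds
    rwa [sub_self] at this
  obtain ⟨K, hK, hKG⟩ := exists_analyticAt_of_tendsto_mul (G := fun z => (z - z₀) ^ 2 * G z)
    (z₀ := z₀) (by filter_upwards [hd] with z hz; fun_prop) (by
      have : Tendsto (fun z => C * ‖z - z₀‖) (𝓝[≠] z₀) (𝓝 0) := by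
        simpa using hsub.norm.const_mul C
      refine squeeze_zero_norm' ?_ this
      filter_upwards [hb, self_mem_nhdsWithin] with z h1 h2
      have hp : 0 < ‖z - z₀‖ := norm_pos_iff.2 (sub_ne_zero.2 h2)
      rw [norm_mul, norm_mul, norm_pow]
      calc ‖z - z₀‖ * (‖z - z₀‖ ^ 2 * ‖G z‖)
          ≤ ‖z - z₀‖ * (‖z - z₀‖ ^ 2 * (C / ‖z - z₀‖ ^ 2)) := by gcongr
        _ = C * ‖z - z₀‖ := by field_simp)
  have hmer : MeromorphicAt G z₀ := by
    have h1 : MeromorphicAt (fun z => ((z - z₀) ^ 2)⁻¹ * K z) z₀ := by fun_prop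
    refine h1.congr ?_
    filter_upwards [hKG, self_mem_nhdsWithin] with z h2 h3
    have : z - z₀ ≠ 0 := sub_ne_zero.2 h3
    rw [← h2]; field_simp
  rcases lt_or_ge (meromorphicOrderAt G z₀) 0 with h | h
  · have h1 := tendsto_cobounded_of_meromorphicOrderAt_neg h
    have h2 := tendsto_norm_cobounded_atTop.comp (h1.mono_left hl)
    exact absurd hA.norm (not_tendsto_nhds_of_tendsto_atTop h2 _)
  · obtain ⟨c, hc⟩ := tendsto_nhds_of_meromorphicOrderAt_nonneg hmer h
    simpa using hsub.mul hc

open Complex in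
/-- Off the level set `Im D = 0` of a nonconstant entire function there are points everywhere. -/
lemma dense_im_ne_zero {D : ℂ → ℂ} (hD : Differentiable ℂ D) (hnc : ∃ a b, D a ≠ D b) :
    Dense {z | (D z).im ≠ 0} := by
  intro z
  rw [mem_closure_iff_frequently]
  rcases (hD.analyticAt z).eventually_constant_or_nhds_le_map_nhds with h | h
  · obtain ⟨a, b, hab⟩ := hnc
    have : D = fun _ => D z := AnalyticOnNhd.eq_of_eventuallyEq
      (fun w _ => hD.analyticAt w) (fun w _ => analyticAt_const) h
    exact absurd (by rw [this]) hab
  · have hf : ∃ᶠ u in 𝓝 (D z), u.im ≠ 0 := by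
      change ∃ᶠ u in 𝓝 (D z), u ∈ {u : ℂ | u.im ≠ 0}
      rw [← mem_closure_iff_frequently]
      refine Metric.mem_closure_iff.2 fun ε hε => ?_
      by_cases h0 : (D z).im = 0
      · refine ⟨D z + (ε / 2 : ℝ) * I, ?_, ?_⟩
        · simp [h0, hε.ne']
        · rw [dist_eq_norm]
          simp [abs_of_pos hε]
          linarith
      · exact ⟨D z, h0, by simpa using hε⟩
    exact (hf.filter_mono h)

open Complex in
/-- The cone of `HasNTLimit` of aperture parameter `ε < ‖τ‖` meets every dense open set. -/
lemma cone_inter_neBot {U : Set ℂ} (hU : Dense U) (z τ : ℂ) (hτ : τ ≠ 0) :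
    (𝓝[{z' | ‖τ‖ / 2 * ‖z' - z‖ < ((z' - z) * starRingEnd ℂ τ).im} ∩ U] z).NeBot := by
  rw [← mem_closure_iff_nhdsWithin_neBot]
  have hopen : IsOpen {z' : ℂ | ‖τ‖ / 2 * ‖z' - z‖ < ((z' - z) * starRingEnd ℂ τ).im} :=
    isOpen_lt (by fun_prop) (continuous_im.comp (by fun_prop))
  have hcl := closure_mono (hU.open_subset_closure_inter hopen)
  rw [closure_closure] at hcl
  refine hcl (Metric.mem_closure_iff.2 fun ε hε => ?_)
  have hτ' : 0 < ‖τ‖ := norm_pos_iff.2 hτ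
  refine ⟨z + ((ε / (2 * ‖τ‖) : ℝ) : ℂ) * (I * τ), ?_, ?_⟩
  · have e : (z + ((ε / (2 * ‖τ‖) : ℝ) : ℂ) * (I * τ) - z) * starRingEnd ℂ τ =
        ((ε / (2 * ‖τ‖) * ‖τ‖ ^ 2 : ℝ) : ℂ) * I := by
      have := Complex.mul_conj' τ
      push_cast at this ⊢
      linear_combination (ε / (2 * ‖τ‖) : ℂ) * I * this
    rw [Set.mem_ofPred_eq, e, add_sub_cancel_left, im_ofReal_mul, I_im, mul_one, norm_mul, norm_mul,
      norm_I, one_mul, norm_real, Real.norm_eq_abs, abs_of_pos (by positivity)]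
    have : 0 < ε / (2 * ‖τ‖) * ‖τ‖ ^ 2 := by positivity
    linarith
  · rw [dist_eq_norm, sub_add_cancel_left, norm_neg, norm_mul, norm_mul, norm_I, one_mul, norm_real,
      Real.norm_eq_abs, abs_of_pos (by positivity)]
    have : ε / (2 * ‖τ‖) * ‖τ‖ = ε / 2 := by field_simp
    linarith

open Complex in
/-- Equal non-tangential limits from both sides of a tangent `τ` of the curve `Im D = 0` give a
limit along the normal. -/
lemma HasNTLimit.hasNormalLimit {D w : ℂ → ℂ} {z τ A : ℂ} (hτ : τ ≠ 0) (hD' : deriv D z ≠ 0)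
    (him : (deriv D z * τ).im = 0) (hp : HasNTLimit w z τ A) (hm : HasNTLimit w z (-τ) A) :
    HasNormalLimit D w z A := by
  set r : ℝ := (deriv D z * τ).re with hr
  have hrτ : deriv D z * τ = r := by
    apply Complex.ext <;> simp [hr, him]
  have hr0 : r ≠ 0 := by
    intro h
    rw [h, ofReal_zero] at hrτ
    exact (mul_ne_zero hD' hτ) hrτ
  have hDp : 0 < ‖deriv D z‖ := norm_pos_iff.2 hD'
  have hτp : 0 < ‖τ‖ := norm_pos_iff.2 hτ
  -- `conj τ` is a real multiple of `D' z`
  have hconj : starRingEnd ℂ τ = ((‖τ‖ ^ 2 / r : ℝ) : ℂ) * deriv D z := by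
    have h1 := Complex.conj_mul' τ
    have h2 : (r : ℂ) ≠ 0 := by exact_mod_cast hr0
    have : τ * (starRingEnd ℂ τ * r) = τ * (‖τ‖ ^ 2 * deriv D z) := by
      linear_combination (r : ℂ) * h1 - ((‖τ‖ : ℂ)) ^ 2 * hrτ
    have := mul_left_cancel₀ hτ this
    push_cast
    field_simp
    linear_combination this
  set ε : ℝ := ‖τ‖ ^ 2 / |r| * (‖deriv D z‖ / 2) with hε
  have hε0 : 0 < ε := by have := abs_pos.2 hr0; positivity
  have hunion := (hp ε hε0).sup (hm ε hε0)
  rw [← nhdsWithin_union] at hunion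
  refine hunion.mono_left (nhdsWithin_mono _ ?_)
  rintro z' ⟨h1, -⟩
  have key : |((z' - z) * starRingEnd ℂ τ).im| =
      ‖τ‖ ^ 2 / |r| * |((z' - z) * deriv D z).im| := by
    rw [hconj, ← mul_assoc, mul_comm (z' - z), mul_assoc, im_ofReal_mul, abs_mul, abs_div,
      abs_of_nonneg (sq_nonneg ‖τ‖)]
  have h2 : ε * ‖z' - z‖ < |((z' - z) * starRingEnd ℂ τ).im| := by
    rw [key, hε, mul_assoc]
    have := abs_pos.2 hr0
    exact mul_lt_mul_of_pos_left h1 (by positivity)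
  rcases lt_abs.1 h2 with h | h
  · exact Or.inl h
  · refine Or.inr ?_
    rw [Set.mem_ofPred_eq, map_neg, mul_neg, neg_im]
    exact h

/-- **Extension across the contour.** `D` is a nonconstant entire function, real on the contour
`T`, and `w` is holomorphic off `T`. If, off a discrete set, `w` has equal non-tangential limits
from both sides of `T`, and if the remaining singularities are mild, then `w` is entire. It is not
required that `T` be closed: at points off `T` the continuity of `w` relative to the complement
of `T` takes the place of the limits. -/
theorem exists_entire_extension {D w : ℂ → ℂ} {T S : Set ℂ} (hD : Differentiable ℂ D)
    (hnc : ∃ a b, D a ≠ D b) (hT : ∀ z ∈ T, (D z).im = 0)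
    (hS : ∀ z, ∀ᶠ z' in 𝓝[≠] z, z' ∉ S) (hDS : ∀ z, z ∉ S → deriv D z ≠ 0)
    (hw : DifferentiableOn ℂ w Tᶜ)
    (hreg : ∀ z ∈ T, z ∉ S →
      (∃ τ A, τ ≠ 0 ∧ (deriv D z * τ).im = 0 ∧ HasNTLimit w z τ A ∧ HasNTLimit w z (-τ) A) ∧
      ∃ C : ℝ, ∀ᶠ z' in 𝓝[Tᶜ] z, ‖w z'‖ ≤ C)
    (hsing : ∀ z ∈ T, z ∈ S →
      Tendsto (fun z' => (z' - z) * w z') (𝓝[Tᶜ] z) (𝓝 0) ∨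
      (∃ C : ℝ, ∀ᶠ z' in 𝓝[Tᶜ] z, ‖w z'‖ ≤ C / ‖z' - z‖ ^ 2) ∧
        ∃ τ A, τ ≠ 0 ∧ HasNTLimit w z τ A) :
    ∃ G : ℂ → ℂ, Differentiable ℂ G ∧ ∀ z ∉ T, w z = G z := by
  set U : Set ℂ := {z | (D z).im ≠ 0} with hU
  have hUd : Dense U := dense_im_ne_zero hD hnc
  have hUo : IsOpen U := isOpen_ne_fun (Complex.continuous_im.comp hD.continuous) continuous_const
  have hUT : U ⊆ Tᶜ := fun z hz hzT => hz (hT z hzT)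
  have hne : ∀ z, (𝓝[U] z).NeBot := fun z => mem_closure_iff_nhdsWithin_neBot.1 (hUd z)
  have hwU : ∀ z ∈ U, DifferentiableAt ℂ w z := fun z hz =>
    (hw.mono hUT).differentiableAt (hUo.mem_nhds hz)
  have hwc : ∀ z ∉ T, Tendsto w (𝓝[U] z) (𝓝 (w z)) := fun z hz =>
    ((hw z hz).continuousWithinAt).mono_left (nhdsWithin_mono _ hUT)
  set G : ℂ → ℂ := fun z => limUnder (𝓝[U] z) w with hG
  -- a local holomorphic extension of `w` coincides with `G`
  have hglue : ∀ (z : ℂ) (H : ℂ → ℂ), AnalyticAt ℂ H z → (∀ᶠ z' in 𝓝 z, z' ∈ U → w z' = H z') →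
      ∀ᶠ z' in 𝓝 z, G z' = H z' := by
    intro z H hH he
    filter_upwards [hH.eventually_analyticAt, he.eventually_nhds] with z' h1 h2
    have h3 : Tendsto H (𝓝[U] z') (𝓝 (H z')) := h1.continuousAt.continuousWithinAt
    have h4 : Tendsto w (𝓝[U] z') (𝓝 (H z')) := by
      refine h3.congr' ?_
      rw [EventuallyEq, eventually_nhdsWithin_iff]
      filter_upwards [h2] with a ha hb using (ha hb).symm
    have := hne z'
    exact h4.limUnder_eq
  -- regular points
  have hregE : ∀ z, z ∉ S → ∃ H : ℂ → ℂ, AnalyticAt ℂ H z ∧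
      ∀ᶠ z' in 𝓝 z, z' ∈ U → w z' = H z' := by
    intro z hzS
    by_cases hzU : (D z).im ≠ 0
    · exact ⟨w, (hw.mono hUT).analyticAt (hUo.mem_nhds hzU), Eventually.of_forall fun _ _ => rfl⟩
    rw [not_not] at hzU
    refine exists_analyticAt_of_hasNormalLimit hD hzU (hDS z hzS) hwU ?_ ?_
    · by_cases hzT : z ∈ T
      · obtain ⟨C, hC⟩ := (hreg z hzT hzS).2
        rw [eventually_nhdsWithin_iff] at hC
        exact ⟨C, by filter_upwards [hC] with a ha hb using ha (hUT hb)⟩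
      · refine ⟨‖w z‖ + 1, ?_⟩
        have := (hwc z hzT).norm.eventually (gt_mem_nhds (lt_add_one ‖w z‖))
        rw [eventually_nhdsWithin_iff] at this
        filter_upwards [this] with a ha hb using (ha hb).le
    · have hSz : ∀ᶠ z' in 𝓝 z, z' ∉ S := by
        have := hS z
        rw [eventually_nhdsWithin_iff] at this
        filter_upwards [this] with a ha
        by_cases h : a = z
        · rwa [h]
        · exact ha h
      filter_upwards [hSz] with z' h1 _
      by_cases hzT : z' ∈ T
      · obtain ⟨τ, A, hτ, him, hp, hm⟩ := (hreg z' hzT h1).1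
        exact ⟨A, hp.hasNormalLimit hτ (hDS z' h1) him hm⟩
      · exact ⟨w z', (hwc z' hzT).mono_left (nhdsWithin_mono _ fun a ha => ha.2)⟩
  -- singular points
  have hsingE : ∀ z, ∃ H : ℂ → ℂ, AnalyticAt ℂ H z ∧ ∀ᶠ z' in 𝓝 z, z' ∈ U → w z' = H z' := by
    intro z
    by_cases hzU : z ∈ U
    · exact ⟨w, (hw.mono hUT).analyticAt (hUo.mem_nhds hzU), Eventually.of_forall fun _ _ => rfl⟩
    by_cases hzS : z ∉ S
    · exact hregE z hzS
    rw [not_not] at hzS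
    have hGd : ∀ᶠ z' in 𝓝[≠] z, DifferentiableAt ℂ G z' := by
      filter_upwards [hS z] with z' h1
      obtain ⟨H, hH, he⟩ := hregE z' h1
      exact (hH.congr ((hglue z' H hH he).mono fun _ h => h.symm)).differentiableAt
    have hGU : ∀ z' ∈ U, G z' = w z' := fun z' hz' => by
      have := hne z'
      exact (hwc z' (hUT hz')).limUnder_eq
    -- bounds on `U` pass to `G`
    have hbd : ∀ φ : ℂ → ℝ, (∀ᶠ z' in 𝓝[≠] z, ContinuousAt φ z') →
        (∀ᶠ z' in 𝓝[Tᶜ] z, ‖w z'‖ ≤ φ z') → ∀ᶠ z' in 𝓝[≠] z, ‖G z'‖ ≤ φ z' := by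
      intro φ hφ hwφ
      rw [eventually_nhdsWithin_iff] at hwφ
      have := hwφ.eventually_nhds
      filter_upwards [hφ, nhdsWithin_le_nhds this, hGd] with z' h1 h2 h3
      have := hne z'
      refine le_of_tendsto_of_tendsto (b := 𝓝[U] z') (h3.continuousAt.continuousWithinAt.norm)
        h1.continuousWithinAt ?_
      rw [EventuallyLE, eventually_nhdsWithin_iff]
      filter_upwards [h2] with a ha hb
      rw [hGU a hb]
      exact ha (hUT hb)
    have hlo : Tendsto (fun z' => (z' - z) * G z') (𝓝[≠] z) (𝓝 0) := by
      by_cases hzT : z ∈ T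
      swap
      · have h1 : ∀ᶠ z' in 𝓝[Tᶜ] z, ‖w z'‖ ≤ ‖w z‖ + 1 := by
          have := ((hw z hzT).continuousWithinAt).tendsto.norm.eventually
            (gt_mem_nhds (lt_add_one ‖w z‖))
          filter_upwards [this] with a ha using ha.le
        have h2 := hbd _ (Eventually.of_forall fun _ => continuousAt_const) h1
        have h3 : Tendsto (fun z' => ‖z' - z‖ * (‖w z‖ + 1)) (𝓝[≠] z) (𝓝 0) := by
          have : Tendsto (fun z' => ‖z' - z‖ * (‖w z‖ + 1)) (𝓝[≠] z)
            (𝓝 (‖z - z‖ * (‖w z‖ + 1))) :=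
            (Continuous.tendsto (by fun_prop) z).mono_left nhdsWithin_le_nhds
          simpa using this
        refine squeeze_zero_norm' ?_ h3
        filter_upwards [h2] with a ha
        rw [norm_mul]
        gcongr
      rcases hsing z hzT hzS with h | ⟨⟨C, hC⟩, τ, A, hτ, hA⟩
      · rw [Metric.tendsto_nhds] at h ⊢
        intro ε hε
        have h1 : ∀ᶠ z' in 𝓝[Tᶜ] z, ‖w z'‖ ≤ ε / 2 / ‖z' - z‖ := by
          have hzU' : ∀ᶠ z' in 𝓝[Tᶜ] z, z' ≠ z := by
            filter_upwards [self_mem_nhdsWithin] with a ha hb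
            exact ha (hb ▸ hzT)
          filter_upwards [h (ε / 2) (by positivity), hzU'] with a ha hb
          have hp : 0 < ‖a - z‖ := norm_pos_iff.2 (sub_ne_zero.2 hb)
          rw [dist_zero_right, norm_mul] at ha
          rw [le_div_iff₀ hp]
          linarith
        have h2 := hbd _ (by
          filter_upwards [self_mem_nhdsWithin] with a ha
          have : ‖a - z‖ ≠ 0 := norm_ne_zero_iff.2 (sub_ne_zero.2 ha)
          fun_prop (disch := assumption)) h1
        filter_upwards [h2, self_mem_nhdsWithin] with a ha hb
        have hp : 0 < ‖a - z‖ := norm_pos_iff.2 (sub_ne_zero.2 hb)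
        rw [le_div_iff₀ hp] at ha
        rw [dist_zero_right, norm_mul]
        linarith
      · have h2 := hbd (fun z' => C / ‖z' - z‖ ^ 2) (by
          filter_upwards [self_mem_nhdsWithin] with a ha
          have : ‖a - z‖ ^ 2 ≠ 0 := pow_ne_zero _ (norm_ne_zero_iff.2 (sub_ne_zero.2 ha))
          fun_prop (disch := assumption)) hC
        have := cone_inter_neBot hUd z τ hτ
        have hsub : {z' | ‖τ‖ / 2 * ‖z' - z‖ < ((z' - z) * starRingEnd ℂ τ).im} ∩ U ⊆ {z}ᶜ := by
          rintro a ⟨ha, -⟩ hb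
          rw [Set.mem_singleton_iff] at hb
          subst hb
          simp at ha
        refine tendsto_mul_zero_of_pole_of_tendsto
          (nhdsWithin_mono z hsub) hGd h2 (A := A) ?_
        have hcone := (hA (‖τ‖ / 2) (by have := norm_pos_iff.2 hτ; positivity)).mono_left
          (nhdsWithin_mono z (Set.inter_subset_left (t := U)))
        refine hcone.congr' ?_
        filter_upwards [self_mem_nhdsWithin] with a ha
        exact (hGU a ha.2).symm
    obtain ⟨H, hH, he⟩ := exists_analyticAt_of_tendsto_mul hGd hlo
    refine ⟨H, hH, ?_⟩
    rw [eventually_nhdsWithin_iff] at he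
    filter_upwards [he] with a ha hb
    rw [← hGU a hb]
    refine ha fun h => hzU ?_
    rw [Set.mem_singleton_iff] at h
    rwa [← h]
  refine ⟨G, fun z => ?_, fun z hz => ?_⟩
  · obtain ⟨H, hH, he⟩ := hsingE z
    exact (hH.congr ((hglue z H hH he).mono fun _ h => h.symm)).differentiableAt
  · have := hne z
    exact (hwc z hz).limUnder_eq.symm

/-! ### A Phragmén–Lindelöf principle -/

/-- A growth bound of order two on a sequence of circles with bounded gaps holds everywhere, by the
maximum principle. -/
lemma exists_growth_of_circles {G : ℂ → ℂ} (hG : Differentiable ℂ G) {ℓ c M : ℝ} {N₀ : ℕ}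
    (hℓ : 0 < ℓ) (hc : 0 ≤ c) (hM : 0 ≤ M)
    (hcirc : ∀ N : ℕ, N₀ ≤ N → ∀ z : ℂ, ‖z‖ = (N + 1 / 2) * ℓ → ‖G z‖ ≤
        M * Real.exp (c * ‖z‖ ^ 2)) :
    ∃ M' : ℝ, 0 ≤ M' ∧ ∀ z, ‖G z‖ ≤ M' * Real.exp (2 * c * ‖z‖ ^ 2) := by
  set k : ℝ := (N₀ + 2) * ℓ with hk
  refine ⟨M * Real.exp (2 * c * k ^ 2), by positivity, fun z => ?_⟩
  set N : ℕ := N₀ + ⌈‖z‖ / ℓ⌉₊ with hN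
  set r : ℝ := (N + 1 / 2) * ℓ with hr
  have hceil := Nat.le_ceil (‖z‖ / ℓ)
  have hceil' := Nat.ceil_lt_add_one (show 0 ≤ ‖z‖ / ℓ by positivity)
  have hNr : (N : ℝ) = N₀ + ⌈‖z‖ / ℓ⌉₊ := by rw [hN]; push_cast; ring
  have h1 : ‖z‖ ≤ r := by
    rw [div_le_iff₀ hℓ] at hceil
    have : (0 : ℝ) ≤ N₀ := Nat.cast_nonneg _
    rw [hr, hNr]
    nlinarith
  have h2 : r ≤ ‖z‖ + k := by
    have : (⌈‖z‖ / ℓ⌉₊ : ℝ) * ℓ ≤ ‖z‖ + ℓ := by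
      calc _ ≤ (‖z‖ / ℓ + 1) * ℓ := by gcongr
        _ = _ := by field_simp
    rw [hr, hNr, hk]
    nlinarith
  have hr0 : 0 < r := by positivity
  have hmax : ‖G z‖ ≤ M * Real.exp (c * r ^ 2) := by
    refine Complex.norm_le_of_forall_mem_frontier_norm_le (U := Metric.ball 0 r)
      Metric.isBounded_ball hG.diffContOnCl (fun w hw => ?_) ?_
    · rw [frontier_ball _ hr0.ne', mem_sphere_zero_iff_norm] at hw
      have := hcirc N (Nat.le_add_right _ _) w hw
      rwa [hw] at this
    · rw [closure_ball _ hr0.ne', mem_closedBall_zero_iff]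
      exact h1
  refine hmax.trans ?_
  rw [mul_assoc, ← Real.exp_add]
  have h3 : c * r ^ 2 ≤ 2 * c * k ^ 2 + 2 * c * ‖z‖ ^ 2 := by
    have : r ^ 2 ≤ 2 * k ^ 2 + 2 * ‖z‖ ^ 2 := by
      nlinarith [sq_nonneg (‖z‖ - k), norm_nonneg z]
    nlinarith
  gcongr

open Complex in
/-- **Phragmén-Lindelöf** in the sector `|arg z| ≤ π / 6`, where order two is admissible. -/
lemma norm_le_of_sector {G : ℂ → ℂ} (hG : Differentiable ℂ G) {c M C : ℝ} (hc : 0 ≤ c) (hM : 0 ≤ M)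
    (hgr : ∀ z, ‖G z‖ ≤ M * Real.exp (c * ‖z‖ ^ 2))
    (hsec : ∀ z : ℂ, ‖z‖ / 2 ≤ |z.im| → ‖G z‖ ≤ C) {z : ℂ} (hz : 0 < z.re) : ‖G z‖ ≤ C := by
  by_cases h : ‖z‖ / 2 ≤ |z.im|
  · exact hsec z h
  rw [not_le] at h
  have hz0 : z ≠ 0 := by rintro rfl; simp at hz
  have hzn : 0 < ‖z‖ := norm_pos_iff.2 hz0
  have hpi := Real.pi_pos
  have hargs : |Real.arcsin (z.im / ‖z‖)| ≤ Real.pi / 6 := by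
    have h1 : |z.im / ‖z‖| ≤ 1 / 2 := by
      rw [abs_div, abs_of_pos hzn, div_le_iff₀ hzn]; linarith
    rw [abs_le] at h1 ⊢
    constructor
    · rw [Real.le_arcsin_iff_sin_le' ⟨by linarith, by linarith⟩, Real.sin_neg, Real.sin_pi_div_six]
      linarith
    · rw [Real.arcsin_le_iff_le_sin' ⟨by linarith, by linarith⟩, Real.sin_pi_div_six]
      linarith
  have hexp : exp (log z) = z := exp_log hz0
  have hedge : ∀ ζ : ℂ, |ζ.im| = Real.pi / 6 → ‖G (exp ζ)‖ ≤ C := by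
    intro ζ hζ
    refine hsec _ ?_
    rw [norm_exp, exp_im, abs_mul, abs_of_pos (Real.exp_pos _)]
    have : |Real.sin ζ.im| = 1 / 2 := by
      rcases abs_eq (by positivity) |>.1 hζ with h | h <;> rw [h]
      · rw [Real.sin_pi_div_six, abs_of_pos (by norm_num)]
      · rw [Real.sin_neg, Real.sin_pi_div_six, abs_neg, abs_of_pos (by norm_num)]
    rw [this]; linarith [Real.exp_pos ζ.re]
  have := PhragmenLindelof.horizontal_strip (f := fun ζ => G (exp ζ)) (a := -(Real.pi / 6))
    (b := Real.pi / 6) (C := C) (z := log z)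
    ((hG.comp differentiable_exp).diffContOnCl)
    ⟨2, by rw [lt_div_iff₀ (by linarith)]; linarith, c, ?_⟩
    (fun ζ hζ => hedge ζ (by rw [hζ, abs_neg, abs_of_pos (by positivity)]))
    (fun ζ hζ => hedge ζ (by rw [hζ, abs_of_pos (by positivity)]))
    (by rw [log_im, arg_of_re_nonneg hz.le]; exact (abs_le.1 hargs).1)
    (by rw [log_im, arg_of_re_nonneg hz.le]; exact (abs_le.1 hargs).2)
  · rwa [hexp] at this
  · refine Asymptotics.IsBigO.of_bound M (Eventually.of_forall fun ζ => ?_)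
    refine (hgr _).trans ?_
    rw [norm_exp, ← Real.exp_nat_mul, Real.norm_eq_abs, abs_of_pos (Real.exp_pos _)]
    have : ((2 : ℕ) : ℝ) * ζ.re ≤ 2 * |ζ.re| := by
      push_cast; linarith [le_abs_self ζ.re]
    gcongr

/-- An entire function of order at most two on a sequence of circles which is bounded outside a
small double sector about the real axis is constant. -/
theorem eq_of_circles_of_sector {G : ℂ → ℂ} (hG : Differentiable ℂ G) {ℓ c M C R : ℝ} {N₀ : ℕ}
    (hℓ : 0 < ℓ) (hc : 0 ≤ c) (hM : 0 ≤ M)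
    (hcirc : ∀ N : ℕ, N₀ ≤ N → ∀ z : ℂ, ‖z‖ = (N + 1 / 2) * ℓ → ‖G z‖ ≤ M * Real.exp (c * ‖z‖ ^ 2))
    (hsec : ∀ z : ℂ, R ≤ ‖z‖ → ‖z‖ / 2 ≤ |z.im| → ‖G z‖ ≤ C) (z w : ℂ) : G z = G w := by
  obtain ⟨M', hM', hgr⟩ := exists_growth_of_circles hG hℓ hc hM hcirc
  set C' : ℝ := max C (M' * Real.exp (2 * c * R ^ 2)) with hC'
  have hsec' : ∀ z : ℂ, ‖z‖ / 2 ≤ |z.im| → ‖G z‖ ≤ C' := by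
    intro z hz
    rcases le_total R ‖z‖ with h | h
    · exact (hsec z h hz).trans (le_max_left _ _)
    · refine ((hgr z).trans ?_).trans (le_max_right _ _)
      gcongr
  refine hG.apply_eq_apply_of_bounded ?_ z w
  rw [isBounded_iff_forall_norm_le]
  refine ⟨C', ?_⟩
  rintro _ ⟨z, rfl⟩
  rcases lt_trichotomy z.re 0 with h | h | h
  · have := norm_le_of_sector (G := fun z => G (-z)) (hG.comp differentiable_neg) (c := 2 * c)
      (M := M') (C := C') (by positivity) hM' (fun z => by simpa using hgr (-z))
      (fun z hz => hsec' _ (by simpa using hz)) (z := -z) (by simpa using h)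
    simpa using this
  · refine hsec' z ?_
    have := Complex.norm_le_abs_re_add_abs_im z
    rw [h, abs_zero, zero_add] at this
    linarith [abs_nonneg z.im]
  · exact norm_le_of_sector hG (by positivity) hM' hgr hsec' h

/-! ### The Zakharov-Shabat system -/

/-- `(u, v)` is a solution of the Zakharov-Shabat system with spectral parameter `z`. -/
structure IsZSSolution (q : ℝ → ℂ) (z : ℂ) (u v : ℝ → ℂ) : Prop where
  fst : ∀ x, HasDerivAt u (-(Complex.I * z) * u x + q x * v x) x
  snd : ∀ x, HasDerivAt v (-(starRingEnd ℂ (q x)) * u x + Complex.I * z * v x) x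

lemma IsPrincipalSolution.column {q : ℝ → ℂ} {Y : ℝ → ℂ → Mat2} (hY : IsPrincipalSolution q Y)
    (z : ℂ) (j : Fin 2) : IsZSSolution q z (fun x => Y x z 0 j) (fun x => Y x z 1 j) := by
  constructor
  · intro x
    simpa [Matrix.mul_apply, Fin.sum_univ_two, zsMatrix] using hY.ode x z 0 j
  · intro x
    simpa [Matrix.mul_apply, Fin.sum_univ_two, zsMatrix] using hY.ode x z 1 j

namespace IsZSSolution

variable {q : ℝ → ℂ} {z : ℂ} {u v : ℝ → ℂ}

open Complex in
/-- The energy estimate: `Q` is skew-Hermitian, so that only `Im z` drives the growth. -/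
lemma energy (h : IsZSSolution q z u v) {x : ℝ} (hx : 0 ≤ x) :
    ‖u x‖ ^ 2 + ‖v x‖ ^ 2 ≤ (‖u 0‖ ^ 2 + ‖v 0‖ ^ 2) * Real.exp (2 * |z.im| * x) := by
  set k := |z.im| with hk
  set f : ℝ → ℝ := fun x => Real.exp (-(2 * k) * x) * (‖u x‖ ^ 2 + ‖v x‖ ^ 2) with hf
  have hder : ∀ x, HasDerivAt f (Real.exp (-(2 * k) * x) *
      (2 * z.im * (‖u x‖ ^ 2 - ‖v x‖ ^ 2) - 2 * k * (‖u x‖ ^ 2 + ‖v x‖ ^ 2))) x := by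
    intro x
    have h1 := (h.fst x).norm_sq
    have h2 := (h.snd x).norm_sq
    have h3 : HasDerivAt (fun x : ℝ => Real.exp (-(2 * k) * x))
        (Real.exp (-(2 * k) * x) * (-(2 * k))) x := by
      have := ((hasDerivAt_id x).const_mul (-(2 * k))).exp
      simpa using this
    refine (h3.mul (h1.add h2)).congr_deriv ?_
    have e : 2 * inner ℝ (u x) (-(I * z) * u x + q x * v x) +
        2 * inner ℝ (v x) (-(starRingEnd ℂ (q x)) * u x + I * z * v x) =
        2 * z.im * (‖u x‖ ^ 2 - ‖v x‖ ^ 2) := by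
      rw [Complex.inner, Complex.inner, ← normSq_eq_norm_sq, ← normSq_eq_norm_sq, normSq_apply,
        normSq_apply]
      simp only [mul_re, add_re, neg_re, conj_re, conj_im, I_re, I_im, mul_im, add_im, neg_im]
      ring
    simp only [Pi.add_apply]
    rw [e]; ring
  have hanti : Antitone f := by
    refine antitone_of_deriv_nonpos (fun x => (hder x).differentiableAt) fun x => ?_
    rw [(hder x).deriv]
    refine mul_nonpos_of_nonneg_of_nonpos (Real.exp_pos _).le ?_
    have h1 : z.im ≤ k := le_abs_self _
    have h2 : -z.im ≤ k := neg_le_abs _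
    nlinarith [sq_nonneg ‖u x‖, sq_nonneg ‖v x‖]
  have := hanti hx
  simp only [hf, mul_zero, Real.exp_zero, one_mul] at this
  calc _ = Real.exp (-(2 * k) * x) * (‖u x‖ ^ 2 + ‖v x‖ ^ 2) * Real.exp (2 * k * x) := by
        rw [mul_comm (Real.exp _), mul_assoc, ← Real.exp_add]
        simp
    _ ≤ _ := by gcongr

lemma norm_le (h : IsZSSolution q z u v) (h0 : ‖u 0‖ ^ 2 + ‖v 0‖ ^ 2 ≤ 1) {x : ℝ} (hx : 0 ≤ x) :
    ‖u x‖ ≤ Real.exp (|z.im| * x) ∧ ‖v x‖ ≤ Real.exp (|z.im| * x) := by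
  have h1 := h.energy hx
  have h2 : Real.exp (2 * |z.im| * x) = Real.exp (|z.im| * x) ^ 2 := by
    rw [← Real.exp_nat_mul]; push_cast; ring_nf
  have hp := Real.exp_pos (|z.im| * x)
  rw [h2] at h1
  have h3 : ‖u x‖ ^ 2 + ‖v x‖ ^ 2 ≤ Real.exp (|z.im| * x) ^ 2 := by
      nlinarith [sq_nonneg (Real.exp (|z.im| * x))]
  constructor
  · exact le_of_sq_le_sq (by nlinarith [sq_nonneg ‖v x‖]) hp.le
  · exact le_of_sq_le_sq (by nlinarith [sq_nonneg ‖u x‖]) hp.le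

lemma sub {u' v' : ℝ → ℂ} (h : IsZSSolution q z u v) (h' : IsZSSolution q z u' v') :
    IsZSSolution q z (fun x => u x - u' x) (fun x => v x - v' x) :=
  ⟨fun x => ((h.fst x).sub (h'.fst x)).congr_deriv (by ring),
    fun x => ((h.snd x).sub (h'.snd x)).congr_deriv (by ring)⟩

lemma unique {u' v' : ℝ → ℂ} (h : IsZSSolution q z u v) (h' : IsZSSolution q z u' v')
    (hu : u 0 = u' 0) (hv : v 0 = v' 0) {x : ℝ} (hx : 0 ≤ x) : u x = u' x ∧ v x = v' x := by
  have := (h.sub h').energy hx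
  simp only [hu, hv, sub_self, norm_zero] at this
  have h1 : ‖u x - u' x‖ ^ 2 = 0 := by nlinarith [sq_nonneg ‖u x - u' x‖, sq_nonneg ‖v x - v' x‖]
  have h2 : ‖v x - v' x‖ ^ 2 = 0 := by nlinarith [sq_nonneg ‖u x - u' x‖, sq_nonneg ‖v x - v' x‖]
  exact ⟨by simpa [sub_eq_zero] using h1, by simpa [sub_eq_zero] using h2⟩

/-- The Schwarz symmetry of the system. -/
lemma conj (h : IsZSSolution q z u v) :
    IsZSSolution q (starRingEnd ℂ z) (fun x => -(starRingEnd ℂ (v x)))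
      (fun x => starRingEnd ℂ (u x)) := by
  constructor
  · intro x
    have := ((h.snd x).star).neg
    refine this.congr_deriv ?_
    simp only [star_add, star_mul', star_neg, RCLike.star_def, Complex.conj_conj, Complex.conj_I]
    ring
  · intro x
    have := (h.fst x).star
    refine this.congr_deriv ?_
    simp only [star_add, star_mul', star_neg, RCLike.star_def, Complex.conj_I]
    ring

/-- The derivative of the Wronskian of two solutions with different spectral parameters. -/
lemma wronskian {z' : ℂ} {a c : ℝ → ℂ} (h : IsZSSolution q z a c) (h' : IsZSSolution q z' u v)
    (x : ℝ) : HasDerivAt (fun x => a x * v x - c x * u x)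
      (Complex.I * (z' - z) * (a x * v x + c x * u x)) x :=
  (((h.fst x).mul (h'.snd x)).sub ((h.snd x).mul (h'.fst x))).congr_deriv (by ring)

lemma continuous_fst (h : IsZSSolution q z u v) : Continuous u :=
  continuous_iff_continuousAt.2 fun x => (h.fst x).continuousAt

lemma continuous_snd (h : IsZSSolution q z u v) : Continuous v :=
  continuous_iff_continuousAt.2 fun x => (h.snd x).continuousAt

end IsZSSolution

namespace IsPrincipalSolution

variable {q : ℝ → ℂ} {Y : ℝ → ℂ → Mat2}

lemma norm_le (hY : IsPrincipalSolution q Y) (z : ℂ) (i j : Fin 2) {x : ℝ} (hx : 0 ≤ x) :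
    ‖Y x z i j‖ ≤ Real.exp (|z.im| * x) := by
  have h0 : ‖Y 0 z 0 j‖ ^ 2 + ‖Y 0 z 1 j‖ ^ 2 ≤ 1 := by
    rw [hY.initial]
    obtain rfl | rfl : j = 0 ∨ j = 1 := by omega
    all_goals simp
  have := (hY.column z j).norm_le h0 hx
  fin_cases i
  · exact this.1
  · exact this.2

lemma det_eq_one (hY : IsPrincipalSolution q Y) (x : ℝ) (z : ℂ) :
    Y x z 0 0 * Y x z 1 1 - Y x z 1 0 * Y x z 0 1 = 1 := by
  have h : ∀ x, HasDerivAt (fun x => Y x z 0 0 * Y x z 1 1 - Y x z 1 0 * Y x z 0 1) 0 x := by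
    intro x
    simpa using (hY.column z 0).wronskian (hY.column z 1) x
  have := is_const_of_deriv_eq_zero (fun x => (h x).differentiableAt) (fun x => (h x).deriv) x 0
  rw [this]
  simp [hY.initial]

lemma conj_symm (hY : IsPrincipalSolution q Y) (z : ℂ) {x : ℝ} (hx : 0 ≤ x) :
    Y x z 0 1 = -(starRingEnd ℂ (Y x (starRingEnd ℂ z) 1 0)) ∧
      Y x z 1 1 = starRingEnd ℂ (Y x (starRingEnd ℂ z) 0 0) := by
  have h1 := (hY.column (starRingEnd ℂ z) 0).conj
  rw [Complex.conj_conj] at h1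
  refine (hY.column z 1).unique h1 ?_ ?_ hx <;> simp [hY.initial]

/-- The monodromy matrix is entire. The difference quotient is expressed by variation of constants,
i.e. by the Wronskians with the solutions at the centre. -/
lemma differentiable (hY : IsPrincipalSolution q Y) {L : ℝ} (hL : 0 ≤ L) (i j : Fin 2) :
    Differentiable ℂ (fun z => Y L z i j) := by
  intro z
  set W : Fin 2 → ℂ → ℝ → ℂ := fun k z' s => Y s z 0 k * Y s z' 1 j - Y s z 1 k * Y s z' 0 j with hW
  set J : Fin 2 → ℂ → ℝ → ℂ := fun k z' s => Y s z 0 k * Y s z' 1 j + Y s z 1 k * Y s z' 0 j with hJ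
  have hJc : ∀ k z', Continuous (J k z') := fun k z' =>
    ((hY.column z k).continuous_fst.mul (hY.column z' j).continuous_snd).add
      ((hY.column z k).continuous_snd.mul (hY.column z' j).continuous_fst)
  have hWint : ∀ k z' x, W k z' x = W k z 0 + Complex.I * (z' - z) * ∫ s in (0 : ℝ)..x,
      J k z' s := by
    intro k z' x
    have h1 := intervalIntegral.integral_eq_sub_of_hasDerivAt (a := 0) (b := x)
      (fun s _ => (hY.column z k).wronskian (hY.column z' j) s)
      ((continuous_const.mul (hJc k z')).intervalIntegrable _ _)
    rw [intervalIntegral.integral_const_mul] at h1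
    rw [h1]
    simp [hW, hY.initial]
  set E := Real.exp ((|z.im| + 1) * L) with hE
  have hE1 : 1 ≤ E := Real.one_le_exp (by positivity)
  have hbd : ∀ z' : ℂ, ‖z' - z‖ ≤ 1 → ∀ s : ℝ, 0 ≤ s → s ≤ L → ∀ a b, ‖Y s z' a b‖ ≤ E := by
    intro z' hz' s hs hsL a b
    refine (hY.norm_le z' a b hs).trans (Real.exp_le_exp.2 ?_)
    have h1 : |z'.im| ≤ |z.im| + 1 := by
      have h2 := (Complex.abs_im_le_norm (z' - z)).trans hz'
      rw [Complex.sub_im] at h2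
      have := abs_sub_abs_le_abs_sub z'.im z.im
      linarith
    calc |z'.im| * s ≤ (|z.im| + 1) * s := by gcongr
      _ ≤ _ := by gcongr
  have hbz : ∀ s : ℝ, 0 ≤ s → s ≤ L → ∀ a b, ‖Y s z a b‖ ≤ E := hbd z (by simp)
  -- Lipschitz dependence on the spectral parameter
  have hlip : ∀ z' : ℂ, ‖z' - z‖ ≤ 1 → ∀ s : ℝ, 0 ≤ s → s ≤ L → ∀ a,
      ‖Y s z' a j - Y s z a j‖ ≤ 4 * E ^ 3 * L * ‖z' - z‖ := by
    intro z' hz' s hs hsL a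
    have hWb : ∀ k, ‖W k z' s - W k z s‖ ≤ 2 * E ^ 2 * L * ‖z' - z‖ := by
      intro k
      rw [hWint k z' s, hWint k z s, sub_self, mul_zero, zero_mul, add_zero, add_sub_cancel_left,
        norm_mul, norm_mul, Complex.norm_I, one_mul, mul_comm]
      have : ‖∫ t in (0 : ℝ)..s, J k z' t‖ ≤ 2 * E ^ 2 * |s - 0| := by
        refine intervalIntegral.norm_integral_le_of_norm_le_const fun t ht => ?_
        rw [Set.uIoc_of_le hs] at ht
        refine (norm_add_le _ _).trans ?_
        rw [norm_mul, norm_mul]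
        have ht1 := ht.2.trans hsL
        calc _ ≤ E * E + E * E := by
              gcongr <;> first | exact hbz t ht.1.le ht1 _ _ | exact hbd z' hz' t ht.1.le ht1 _ _
          _ = _ := by ring
      rw [sub_zero, abs_of_nonneg hs] at this
      have h2 : 2 * E ^ 2 * s ≤ 2 * E ^ 2 * L := by gcongr
      gcongr
      exact this.trans h2
    have hdet := hY.det_eq_one s z
    have hrep : Y s z' a j - Y s z a j = Y s z a 1 * (W 0 z' s - W 0 z s) -
        Y s z a 0 * (W 1 z' s - W 1 z s) := by
      simp only [hW]
      fin_cases a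
      · simp only [Fin.zero_eta]
        linear_combination (-(Y s z' 0 j - Y s z 0 j)) * hdet
      · simp only [Fin.mk_one]
        linear_combination (-(Y s z' 1 j - Y s z 1 j)) * hdet
    rw [hrep]
    refine (norm_sub_le _ _).trans ?_
    rw [norm_mul, norm_mul]
    calc _ ≤ E * (2 * E ^ 2 * L * ‖z' - z‖) + E * (2 * E ^ 2 * L * ‖z' - z‖) := by
          gcongr <;> first | exact hbz s hs hsL _ _ | exact hWb _
      _ = _ := by ring
  have hWd : ∀ k, DifferentiableAt ℂ (fun z' => W k z' L) z := by
    intro k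
    refine HasDerivAt.differentiableAt (f' := Complex.I * ∫ s in (0 : ℝ)..L, J k z s) ?_
    rw [hasDerivAt_iff_isLittleO]
    refine Asymptotics.IsBigO.trans_isLittleO (g := fun z' => ‖z' - z‖ ^ 2) ?_ ?_
    · refine Asymptotics.IsBigO.of_bound (8 * E ^ 4 * L ^ 2) ?_
      filter_upwards [Metric.closedBall_mem_nhds z one_pos] with z' hz'
      rw [mem_closedBall_iff_norm] at hz'
      rw [hWint k z' L, hWint k z L]
      have h1 : W k z 0 + Complex.I * (z' - z) * (∫ s in (0 : ℝ)..L, J k z' s) -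
          (W k z 0 + Complex.I * (z - z) * ∫ s in (0 : ℝ)..L, J k z s) -
          (z' - z) • (Complex.I * ∫ s in (0 : ℝ)..L, J k z s) =
          Complex.I * (z' - z) * ∫ s in (0 : ℝ)..L, (J k z' s - J k z s) := by
        rw [intervalIntegral.integral_sub ((hJc k z').intervalIntegrable _ _)
          ((hJc k z).intervalIntegrable _ _), smul_eq_mul]
        ring
      rw [h1, norm_mul, norm_mul, Complex.norm_I, one_mul]
      have h2 : ‖∫ s in (0 : ℝ)..L, (J k z' s - J k z s)‖ ≤
          8 * E ^ 4 * L * ‖z' - z‖ * |L - 0| := by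
        refine intervalIntegral.norm_integral_le_of_norm_le_const fun t ht => ?_
        rw [Set.uIoc_of_le hL] at ht
        have : J k z' t - J k z t = Y t z 0 k * (Y t z' 1 j - Y t z 1 j) +
            Y t z 1 k * (Y t z' 0 j - Y t z 0 j) := by
          simp only [hJ]; ring
        rw [this]
        refine (norm_add_le _ _).trans ?_
        rw [norm_mul, norm_mul]
        calc _ ≤ E * (4 * E ^ 3 * L * ‖z' - z‖) + E * (4 * E ^ 3 * L * ‖z' - z‖) := by
              gcongr <;> first | exact hbz t ht.1.le ht.2 _ _ | exact hlip z' hz' t ht.1.le ht.2 _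
          _ = _ := by ring
      rw [sub_zero, abs_of_nonneg hL] at h2
      calc ‖z' - z‖ * ‖∫ s in (0 : ℝ)..L, (J k z' s - J k z s)‖
          ≤ ‖z' - z‖ * (8 * E ^ 4 * L * ‖z' - z‖ * L) := by gcongr
        _ = _ := by rw [norm_pow, norm_norm]; ring
    · have h1 : (fun z' => ‖z' - z‖ ^ 2) =o[𝓝 z] fun z' => ‖z' - z‖ ^ 1 := by
        have : Tendsto (fun z' => ‖z' - z‖) (𝓝 z) (𝓝 0) := by
          have := (Continuous.tendsto (f := fun z' : ℂ => ‖z' - z‖) (by fun_prop) z)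
          simpa using this
        exact (Asymptotics.isLittleO_pow_pow one_lt_two).comp_tendsto this
      simpa using h1
  have hrep : (fun z' => Y L z' i j) = fun z' => Y L z i 1 * W 0 z' L - Y L z i 0 * W 1 z' L := by
    funext z'
    have hdet := hY.det_eq_one L z
    simp only [hW]
    fin_cases i
    · simp only [Fin.zero_eta]
      linear_combination (-(Y L z' 0 j)) * hdet
    · simp only [Fin.mk_one]
      linear_combination (-(Y L z' 1 j)) * hdet
  rw [hrep]
  exact ((hWd 0).const_mul _).sub ((hWd 1).const_mul _)

end IsPrincipalSolution

/-! ### Asymptotics of the monodromy matrix -/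

/-- Duhamel's estimate for a scalar linear equation. -/
lemma norm_sub_exp_mul_le {f g : ℝ → ℂ} {lam : ℂ} {L B k : ℝ} (hL : 0 ≤ L) (hB : 0 ≤ B)
    (hk : |lam.re| ≤ k)
    (hf : ∀ x ∈ Set.Icc 0 L, HasDerivWithinAt f (lam * f x + g x) (Set.Icc 0 L) x)
    (hg : ∀ x ∈ Set.Icc 0 L, ‖g x‖ ≤ B * Real.exp (k * x)) :
    ‖f L - Complex.exp (lam * L) * f 0‖ ≤ B * L * Real.exp (k * L) := by
  have hle := (abs_le.1 hk).2
  set h : ℝ → ℂ := fun s => Complex.exp (-lam * s) * f s with hh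
  have hd : ∀ x ∈ Set.Icc 0 L, HasDerivWithinAt h (Complex.exp (-lam * x) * g x)
      (Set.Icc 0 L) x := by
    intro x hx
    have h1 : HasDerivAt (fun s : ℝ => Complex.exp (-lam * s)) (Complex.exp (-lam * x) * (-lam)) x := by
      have := ((Complex.ofRealCLM.hasDerivAt (x := x)).const_mul (-lam)).cexp
      simpa using this
    exact (h1.hasDerivWithinAt.mul (hf x hx)).congr_deriv (by ring)
  have hb : ∀ x ∈ Set.Icc 0 L, ‖Complex.exp (-lam * x) * g x‖ ≤
      B * Real.exp ((k - lam.re) * L) := by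
    intro x hx
    rw [norm_mul, Complex.norm_exp]
    have e1 : (-lam * x).re = -lam.re * x := by simp
    rw [e1]
    calc _ ≤ Real.exp (-lam.re * x) * (B * Real.exp (k * x)) := by gcongr; exact hg x hx
      _ = B * Real.exp ((k - lam.re) * x) := by
        rw [mul_left_comm, ← Real.exp_add]; ring_nf
      _ ≤ _ := by
        have h1 : (k - lam.re) * x ≤ (k - lam.re) * L :=
          mul_le_mul_of_nonneg_left hx.2 (by linarith)
        gcongr
  have hmv := (convex_Icc 0 L).norm_image_sub_le_of_norm_hasDerivWithin_le hd hb
    (Set.left_mem_Icc.2 hL) (Set.right_mem_Icc.2 hL)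
  rw [sub_zero, Real.norm_of_nonneg hL] at hmv
  have e2 : f L - Complex.exp (lam * L) * f 0 = Complex.exp (lam * L) * (h L - h 0) := by
    simp only [hh, Complex.ofReal_zero, mul_zero, Complex.exp_zero, one_mul]
    rw [mul_sub, ← mul_assoc, ← Complex.exp_add]
    simp
  rw [e2, norm_mul, Complex.norm_exp]
  have e3 : (lam * L).re = lam.re * L := by simp
  rw [e3]
  calc _ ≤ Real.exp (lam.re * L) * (B * Real.exp ((k - lam.re) * L) * L) := by gcongr
    _ = B * L * (Real.exp (lam.re * L) * Real.exp ((k - lam.re) * L)) := by ring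
    _ = _ := by rw [← Real.exp_add]; ring_nf

open Complex in
/-- Asymptotics of the first column of the monodromy matrix. The terms of order zero of the system
are removed by the substitution `u + (i q / 2 z) v`, `v + (i q* / 2 z) u`. -/
lemma IsPrincipalSolution.first_column_asymptotics {q qd : ℝ → ℂ} {Y : ℝ → ℂ → Mat2}
    (hY : IsPrincipalSolution q Y) {L K₀ K₁ : ℝ} (hL : 0 ≤ L)
    (hq : ∀ x ∈ Set.Icc 0 L, HasDerivWithinAt q (qd x) (Set.Icc 0 L) x)
    (hK₀ : ∀ x ∈ Set.Icc 0 L, ‖q x‖ ≤ K₀) (hK₁ : ∀ x ∈ Set.Icc 0 L, ‖qd x‖ ≤ K₁)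
    {z : ℂ} (hz : z ≠ 0) :
    ‖Y L z 0 0 - exp (-(I * z * L))‖ ≤
        ((K₁ + K₀ ^ 2) * L + K₀) * Real.exp (|z.im| * L) / ‖z‖ ∧
      ‖Y L z 1 0‖ ≤ ((K₁ + K₀ ^ 2) * L + K₀) * Real.exp (|z.im| * L) / ‖z‖ := by
  have hzn : 0 < ‖z‖ := norm_pos_iff.2 hz
  have h0L : (0 : ℝ) ∈ Set.Icc 0 L := Set.left_mem_Icc.2 hL
  have hLL : L ∈ Set.Icc 0 L := Set.right_mem_Icc.2 hL
  have hK₀0 : 0 ≤ K₀ := (norm_nonneg _).trans (hK₀ 0 h0L)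
  have hK₁0 : 0 ≤ K₁ := (norm_nonneg _).trans (hK₁ 0 h0L)
  set u : ℝ → ℂ := fun x => Y x z 0 0 with hu
  set v : ℝ → ℂ := fun x => Y x z 1 0 with hv
  have hsol : IsZSSolution q z u v := hY.column z 0
  have hub : ∀ x, 0 ≤ x → ‖u x‖ ≤ Real.exp (|z.im| * x) := fun x hx => hY.norm_le z 0 0 hx
  have hvb : ∀ x, 0 ≤ x → ‖v x‖ ≤ Real.exp (|z.im| * x) := fun x hx => hY.norm_le z 1 0 hx
  have hu0 : u 0 = 1 := by simp [hu, hY.initial]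
  have hv0 : v 0 = 0 := by simp [hv, hY.initial]
  have hqc : ∀ x ∈ Set.Icc 0 L, HasDerivWithinAt (fun x => starRingEnd ℂ (q x))
      (starRingEnd ℂ (qd x)) (Set.Icc 0 L) x := fun x hx => (hq x hx).star
  have hstep : ∀ (p pd a b : ℝ → ℂ), (∀ x ∈ Set.Icc 0 L, ‖p x‖ ≤ K₀) →
      (∀ x ∈ Set.Icc 0 L, ‖pd x‖ ≤ K₁) → (∀ x, 0 ≤ x → ‖a x‖ ≤ Real.exp (|z.im| * x)) →
      (∀ x, 0 ≤ x → ‖b x‖ ≤ Real.exp (|z.im| * x)) → ∀ x ∈ Set.Icc 0 L,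
      ‖I * (pd x * a x + q x * starRingEnd ℂ (q x) * b x) / (2 * z)‖ ≤
        (K₁ + K₀ ^ 2) / (2 * ‖z‖) * Real.exp (|z.im| * x) := by
    intro p pd a b hp hpd ha hb x hx
    rw [norm_div, norm_mul, norm_I, one_mul, norm_mul, Complex.norm_ofNat]
    have : ‖pd x * a x + q x * starRingEnd ℂ (q x) * b x‖ ≤
        (K₁ + K₀ ^ 2) * Real.exp (|z.im| * x) := by
      refine (norm_add_le _ _).trans ?_
      rw [norm_mul, norm_mul, norm_mul, RCLike.norm_conj]
      calc _ ≤ K₁ * Real.exp (|z.im| * x) + K₀ * K₀ * Real.exp (|z.im| * x) := by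
            gcongr <;> first | exact hpd x hx | exact ha x hx.1 | exact hK₀ x hx | exact hb x hx.1
        _ = _ := by ring
    calc _ ≤ (K₁ + K₀ ^ 2) * Real.exp (|z.im| * x) / (2 * ‖z‖) := by gcongr
      _ = _ := by ring
  have hB : 0 ≤ (K₁ + K₀ ^ 2) / (2 * ‖z‖) := by positivity
  -- the correction terms
  have hcorr : ∀ p w : ℂ, ‖p‖ ≤ K₀ → ‖w‖ ≤ Real.exp (|z.im| * L) →
      ‖I * p / (2 * z) * w‖ ≤ K₀ * Real.exp (|z.im| * L) / (2 * ‖z‖) := by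
    intro p w hp hw
    rw [norm_mul, norm_div, norm_mul, norm_mul, norm_I, one_mul, Complex.norm_ofNat]
    calc _ ≤ K₀ / (2 * ‖z‖) * Real.exp (|z.im| * L) := by gcongr
      _ = _ := by ring
  have hfin : (K₁ + K₀ ^ 2) / (2 * ‖z‖) * L * Real.exp (|z.im| * L) +
      2 * (K₀ * Real.exp (|z.im| * L) / (2 * ‖z‖)) ≤
      ((K₁ + K₀ ^ 2) * L + K₀) * Real.exp (|z.im| * L) / ‖z‖ := by
    have e : ((K₁ + K₀ ^ 2) * L + K₀) * Real.exp (|z.im| * L) / ‖z‖ -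
        ((K₁ + K₀ ^ 2) / (2 * ‖z‖) * L * Real.exp (|z.im| * L) +
          2 * (K₀ * Real.exp (|z.im| * L) / (2 * ‖z‖))) =
        (K₁ + K₀ ^ 2) / (2 * ‖z‖) * L * Real.exp (|z.im| * L) := by field_simp; ring
    have : 0 ≤ (K₁ + K₀ ^ 2) / (2 * ‖z‖) * L * Real.exp (|z.im| * L) := by positivity
    linarith
  constructor
  · have h1 := norm_sub_exp_mul_le (f := fun x => u x + I * q x / (2 * z) * v x)
      (g := fun x => I * (qd x * v x + q x * starRingEnd ℂ (q x) * (-u x)) / (2 * z))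
      (lam := -(I * z)) hL hB (k := |z.im|) (by simp)
      (fun x hx => ((hsol.fst x).hasDerivWithinAt.add
        ((((hq x hx).const_mul I).div_const (2 * z)).mul
          (hsol.snd x).hasDerivWithinAt)).congr_deriv (by
            field_simp
            linear_combination (2 * z * q x * v x : ℂ) * I_sq))
      (hstep q qd v (fun x => -u x) hK₀ hK₁ hvb (fun x hx => by rw [norm_neg]; exact hub x hx))
    simp only [hu0, hv0, mul_zero, add_zero, mul_one] at h1
    have h2 := hcorr (q L) (v L) (hK₀ L hLL) (hvb L hL)
    have h3 : u L - exp (-(I * z * L)) = (u L + I * q L / (2 * z) * v L - exp (-(I * z) * L)) -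
        I * q L / (2 * z) * v L := by
      rw [neg_mul]; ring
    rw [h3]
    refine (norm_sub_le _ _).trans ?_
    have h4 := norm_nonneg (I * q L / (2 * z) * v L)
    linarith
  · have h1 := norm_sub_exp_mul_le (f := fun x => v x + I * starRingEnd ℂ (q x) / (2 * z) * u x)
      (g := fun x => I * (starRingEnd ℂ (qd x) * u x + q x * starRingEnd ℂ (q x) * v x) / (2 * z))
      (lam := I * z) hL hB (k := |z.im|) (by simp)
      (fun x hx => ((hsol.snd x).hasDerivWithinAt.add
        ((((hqc x hx).const_mul I).div_const (2 * z)).mul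
          (hsol.fst x).hasDerivWithinAt)).congr_deriv (by
            field_simp
            linear_combination (-(2 * z * starRingEnd ℂ (q x) * u x) : ℂ) * I_sq))
      (hstep (fun x => starRingEnd ℂ (q x)) (fun x => starRingEnd ℂ (qd x)) u v
        (fun x hx => by rw [RCLike.norm_conj]; exact hK₀ x hx)
        (fun x hx => by rw [RCLike.norm_conj]; exact hK₁ x hx) hub hvb)
    simp only [hu0, hv0, zero_add, mul_one] at h1
    have h2 :=
        hcorr (starRingEnd ℂ (q L)) (u L) (by rw [RCLike.norm_conj]; exact hK₀ L hLL) (hub L hL)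
    have h5 :=
        hcorr (starRingEnd ℂ (q 0)) (exp (I * z * L)) (by rw [RCLike.norm_conj]; exact hK₀ 0 h0L) (by
      rw [norm_exp]
      refine Real.exp_le_exp.2 ?_
      have : (I * z * L).re = -z.im * L := by simp
      rw [this]
      gcongr
      exact neg_le_abs _)
    have h3 : v L = (v L + I * starRingEnd ℂ (q L) / (2 * z) * u L -
        exp (I * z * L) * (I * starRingEnd ℂ (q 0) / (2 * z))) -
        I * starRingEnd ℂ (q L) / (2 * z) * u L +
        I * starRingEnd ℂ (q 0) / (2 * z) * exp (I * z * L) := by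
      ring
    change ‖v L‖ ≤ _
    rw [h3]
    refine (norm_add_le _ _).trans ?_
    have h4 := norm_sub_le (v L + I * starRingEnd ℂ (q L) / (2 * z) * u L -
        exp (I * z * L) * (I * starRingEnd ℂ (q 0) / (2 * z)))
        (I * starRingEnd ℂ (q L) / (2 * z) * u L)
    linarith

/-- The monodromy matrix is asymptotic to that of the potential `0`. -/
theorem IsPrincipalSolution.exists_asymptotics {q : ℝ → ℂ} {Y : ℝ → ℂ → Mat2}
    (hY : IsPrincipalSolution q Y) {L : ℝ} (hL : 0 < L)
    (hq : ContDiffOn ℝ 1 q (Set.Icc 0 L)) :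
    ∃ C : ℝ, 0 ≤ C ∧ ∀ z : ℂ, z ≠ 0 →
      ‖Y L z 0 0 - Complex.exp (-(Complex.I * z * L))‖ ≤ C * Real.exp (|z.im| * L) / ‖z‖ ∧
      ‖Y L z 1 0‖ ≤ C * Real.exp (|z.im| * L) / ‖z‖ ∧
      ‖Y L z 0 1‖ ≤ C * Real.exp (|z.im| * L) / ‖z‖ ∧
      ‖Y L z 1 1 - Complex.exp (Complex.I * z * L)‖ ≤ C * Real.exp (|z.im| * L) / ‖z‖ := by
  obtain ⟨K₀, hK₀⟩ := isCompact_Icc.exists_bound_of_continuousOn hq.continuousOn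
  obtain ⟨K₁, hK₁⟩ := isCompact_Icc.exists_bound_of_continuousOn
    (hq.continuousOn_derivWithin (uniqueDiffOn_Icc hL) le_rfl)
  have hd : ∀ x ∈ Set.Icc 0 L, HasDerivWithinAt q (derivWithin q (Set.Icc 0 L) x)
      (Set.Icc 0 L) x := fun x hx => ((hq.differentiableOn one_ne_zero) x hx).hasDerivWithinAt
  have h0L : (0 : ℝ) ∈ Set.Icc 0 L := Set.left_mem_Icc.2 hL.le
  have hK₀0 : 0 ≤ K₀ := (norm_nonneg _).trans (hK₀ 0 h0L)
  have hK₁0 : 0 ≤ K₁ := (norm_nonneg _).trans (hK₁ 0 h0L)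
  refine ⟨(K₁ + K₀ ^ 2) * L + K₀, by positivity, fun z hz => ?_⟩
  have h1 := hY.first_column_asymptotics hL.le hd hK₀ hK₁ hz
  have h2 := hY.first_column_asymptotics hL.le hd hK₀ hK₁ (z := starRingEnd ℂ z) (by simpa using hz)
  have h3 := hY.conj_symm z hL.le
  rw [RCLike.norm_conj, Complex.conj_im, abs_neg] at h2
  refine ⟨h1.1, h1.2, ?_, ?_⟩
  · rw [h3.1, norm_neg, RCLike.norm_conj]; exact h2.2
  · rw [h3.2, ← RCLike.norm_conj, map_sub, Complex.conj_conj, ← Complex.exp_conj]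
    have : starRingEnd ℂ (Complex.I * z * L) = -(Complex.I * starRingEnd ℂ z * L) := by simp
    rw [this]
    exact h2.1

/-! ### The spectral functions -/

section Sine

open Complex

lemma norm_sin_le_exp (w : ℂ) : ‖sin w‖ ≤ Real.exp |w.im| := by
  rw [Complex.sin, norm_div, norm_mul, norm_I, mul_one, Complex.norm_ofNat]
  have h1 : ‖exp (-w * I)‖ ≤ Real.exp |w.im| := by
    rw [norm_exp]; gcongr; simpa using le_abs_self w.im
  have h2 : ‖exp (w * I)‖ ≤ Real.exp |w.im| := by
    rw [norm_exp]; gcongr; simpa using neg_le_abs w.im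
  linarith [norm_sub_le (exp (-w * I)) (exp (w * I))]

lemma norm_cos_le_exp (w : ℂ) : ‖cos w‖ ≤ Real.exp |w.im| := by
  rw [Complex.cos, norm_div, Complex.norm_ofNat]
  have h1 : ‖exp (-w * I)‖ ≤ Real.exp |w.im| := by
    rw [norm_exp]; gcongr; simpa using le_abs_self w.im
  have h2 : ‖exp (w * I)‖ ≤ Real.exp |w.im| := by
    rw [norm_exp]; gcongr; simpa using neg_le_abs w.im
  linarith [norm_add_le (exp (w * I)) (exp (-w * I))]

/-- Away from its zeros the sine is as large as `exp |Im w|`. -/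
lemma exp_le_norm_sin {w : ℂ} (hw : ∀ j : ℤ, Real.pi / 8 ≤ ‖w - (j * Real.pi : ℝ)‖) :
    Real.exp |w.im| ≤ 16 * ‖sin w‖ := by
  have hpi := Real.pi_pos
  have hpi3 := Real.pi_gt_three
  have hsin : sin w = ((Real.sin w.re * Real.cosh w.im : ℝ) : ℂ) +
      ((Real.cos w.re * Real.sinh w.im : ℝ) : ℂ) * I := by
    rw [Complex.sin_eq]; push_cast; ring
  have hre : (sin w).re = Real.sin w.re * Real.cosh w.im := by
    rw [hsin]; simp only [add_re, re_ofReal_mul, I_re, mul_zero, add_zero, ofReal_re]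
  have him : (sin w).im = Real.cos w.re * Real.sinh w.im := by
    rw [hsin]; simp only [add_im, im_ofReal_mul, I_im, mul_one, zero_add, ofReal_im]
  have hn : ‖sin w‖ ^ 2 = Real.sin w.re ^ 2 + Real.sinh w.im ^ 2 := by
    rw [← normSq_eq_norm_sq, normSq_apply, hre, him]
    have h1 := Real.cosh_sq w.im
    have h2 := Real.sin_sq_add_cos_sq w.re
    linear_combination (Real.sin w.re ^ 2) * h1 + Real.sinh w.im ^ 2 * h2
  have hmul : Real.exp |w.im| * Real.exp (-|w.im|) = 1 := by rw [← Real.exp_add]; simp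
  have hEp := Real.exp_pos |w.im|
  have hEn := Real.exp_pos (-|w.im|)
  set j : ℤ := round (w.re / Real.pi) with hj
  set s : ℝ := w.re - j * Real.pi with hs
  have hspi : |s| ≤ Real.pi / 2 := by
    have h1 := abs_sub_round (w.re / Real.pi)
    have h2 : s = (w.re / Real.pi - j) * Real.pi := by rw [hs]; field_simp
    rw [h2, abs_mul, abs_of_pos hpi]
    nlinarith
  have hdist : Real.pi / 8 ≤ |s| + |w.im| := by
    refine (hw j).trans ((norm_le_abs_re_add_abs_im _).trans ?_)
    rw [sub_re, sub_im, ofReal_re, ofReal_im, sub_zero]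
  by_cases hc : Real.pi / 16 ≤ |s|
  · have h1 := Real.mul_abs_le_abs_sin hspi
    have h2 : |Real.sin s| = |Real.sin w.re| := by
      rw [hs, Real.sin_sub_int_mul_pi, abs_mul, abs_zpow, abs_neg, abs_one, one_zpow, one_mul]
    have h3 : 1 / 8 ≤ |Real.sin w.re| := by
      rw [← h2]
      refine le_trans ?_ h1
      calc (1 / 8 : ℝ) = 2 / Real.pi * (Real.pi / 16) := by field_simp; norm_num
        _ ≤ _ := by gcongr
    have h4 : |Real.sin w.re| * Real.cosh w.im ≤ ‖sin w‖ := by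
      have := abs_re_le_norm (sin w)
      rwa [hre, abs_mul, abs_of_pos (Real.cosh_pos _)] at this
    have h5 : Real.exp |w.im| / 2 ≤ Real.cosh w.im := by
      rw [← Real.cosh_abs, Real.cosh_eq]; linarith
    nlinarith
  · have hy : 3 / 16 ≤ |w.im| := by linarith
    have h1 : |Real.sinh w.im| ≤ ‖sin w‖ := by
      refine abs_le_of_sq_le_sq ?_ (norm_nonneg _)
      rw [hn]; nlinarith [sq_nonneg (Real.sin w.re)]
    have h2 : |Real.sinh w.im| = (Real.exp |w.im| - Real.exp (-|w.im|)) / 2 := by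
      rw [Real.abs_sinh, Real.sinh_eq]
    have h3 : |w.im| + 1 ≤ Real.exp |w.im| := Real.add_one_le_exp _
    have h4 : Real.exp (-|w.im|) ≤ 7 / 8 * Real.exp |w.im| := by
      have : 1 ≤ 7 / 8 * (Real.exp |w.im| * Real.exp |w.im|) := by nlinarith
      nlinarith
    linarith

lemma half_norm_le_norm_sin {w : ℂ} (hw : ‖w‖ ≤ 1) : ‖w‖ / 2 ≤ ‖sin w‖ := by
  have h1 := sin_bound hw
  have h2 : ‖w ^ 3 / 6‖ ≤ ‖w‖ / 6 := by
    rw [norm_div, norm_pow, Complex.norm_ofNat]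
    gcongr
    calc ‖w‖ ^ 3 ≤ ‖w‖ ^ 1 := pow_le_pow_of_le_one (norm_nonneg _) hw (by norm_num)
      _ = ‖w‖ := pow_one _
  have h3 : ‖w‖ ^ 5 ≤ ‖w‖ := by
    calc ‖w‖ ^ 5 ≤ ‖w‖ ^ 1 := pow_le_pow_of_le_one (norm_nonneg _) hw (by norm_num)
      _ = ‖w‖ := pow_one _
  have h4 : ‖w‖ ≤ ‖sin w‖ + ‖sin w - (w - w ^ 3 / 6)‖ + ‖w ^ 3 / 6‖ := by
    calc ‖w‖ = ‖sin w - (sin w - (w - w ^ 3 / 6)) + w ^ 3 / 6‖ := by congr 1; ring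
      _ ≤ _ := (norm_add_le _ _).trans (by gcongr; exact norm_sub_le _ _)
  linarith [norm_nonneg w]

end Sine

section Monodromy

variable {L : ℝ} {Y : ℝ → ℂ → Mat2}

lemma discriminant_eq (z : ℂ) : discriminant L Y z = (Y L z 0 0 + Y L z 1 1) / 2 := by
  rw [discriminant, Matrix.trace_fin_two]

lemma matU_inv :
    matU⁻¹ = ((1 / Real.sqrt 2 : ℝ) : ℂ) • !![1, Complex.I; 1, -Complex.I] := by
  refine Matrix.inv_eq_right_inv ?_
  have h2 : ((1 / Real.sqrt 2 : ℝ) : ℂ) * ((1 / Real.sqrt 2 : ℝ) : ℂ) = 1 / 2 := by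
    rw [← Complex.ofReal_mul]
    have : (1 / Real.sqrt 2) * (1 / Real.sqrt 2) = 1 / 2 := by
      rw [div_mul_div_comm, one_mul, Real.mul_self_sqrt (by norm_num)]
    rw [this]; norm_num
  rw [matU, Matrix.smul_mul, Matrix.mul_smul, smul_smul, h2]
  ext i j
  fin_cases i <;> fin_cases j <;> simp <;> norm_num

lemma y12_eq (z : ℂ) : y12 L Y z =
    Complex.I / 2 * (Y L z 0 0 + Y L z 1 0 - Y L z 0 1 - Y L z 1 1) := by
  have h2 : ((1 / Real.sqrt 2 : ℝ) : ℂ) * ((1 / Real.sqrt 2 : ℝ) : ℂ) = 1 / 2 := by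
    rw [← Complex.ofReal_mul]
    have : (1 / Real.sqrt 2) * (1 / Real.sqrt 2) = 1 / 2 := by
      rw [div_mul_div_comm, one_mul, Real.mul_self_sqrt (by norm_num)]
    rw [this]; norm_num
  rw [y12, modMonodromy, matU_inv, matU, Matrix.smul_mul, Matrix.smul_mul, Matrix.mul_smul,
      smul_smul,
    h2, Matrix.smul_apply, Matrix.mul_apply, Fin.sum_univ_two, Matrix.mul_apply, Matrix.mul_apply,
    Fin.sum_univ_two, Fin.sum_univ_two]
  simp only [Matrix.of_apply, Matrix.cons_val_zero, Matrix.cons_val_one, Matrix.cons_val',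
    Matrix.cons_val_fin_one, smul_eq_mul]
  ring

end Monodromy

namespace IsPrincipalSolution

variable {L : ℝ} {q : ℝ → ℂ} {Y : ℝ → ℂ → Mat2}

lemma differentiable_discriminant (hY : IsPrincipalSolution q Y) (hL : 0 ≤ L) :
    Differentiable ℂ (discriminant L Y) := by
  have : discriminant L Y = fun z => (Y L z 0 0 + Y L z 1 1) / 2 := funext discriminant_eq
  rw [this]
  exact ((hY.differentiable hL 0 0).add (hY.differentiable hL 1 1)).div_const _

lemma differentiable_mainFunction (hY : IsPrincipalSolution q Y) (hL : 0 ≤ L) :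
    Differentiable ℂ (mainFunction L Y) :=
  ((hY.differentiable_discriminant hL).pow 2).sub_const 1

lemma differentiable_y12 (hY : IsPrincipalSolution q Y) (hL : 0 ≤ L) :
    Differentiable ℂ (y12 L Y) := by
  have : y12 L Y = fun z => Complex.I / 2 * (Y L z 0 0 + Y L z 1 0 - Y L z 0 1 - Y L z 1 1) :=
    funext y12_eq
  rw [this]
  exact ((((hY.differentiable hL 0 0).add (hY.differentiable hL 1 0)).sub
    (hY.differentiable hL 0 1)).sub (hY.differentiable hL 1 1)).const_mul _

lemma discriminant_im_of_real (hY : IsPrincipalSolution q Y) (hL : 0 ≤ L) {z : ℂ}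
    (hz : z.im = 0) : (discriminant L Y z).im = 0 := by
  have hc : starRingEnd ℂ z = z := Complex.conj_eq_iff_im.2 hz
  have := (hY.conj_symm z hL).2
  rw [hc] at this
  rw [discriminant_eq, this, Complex.add_conj]
  have : (((2 * (Y L z 0 0).re : ℝ) : ℂ) / 2).im = 0 := by
    rw [show (2 : ℂ) = ((2 : ℝ) : ℂ) by norm_num, ← Complex.ofReal_div, Complex.ofReal_im]
  exact this

/-- Asymptotics of the two spectral functions `ỹ₁₂(L, ·)` and `Δ² - 1`. -/
lemma exists_spectral_asymptotics (hY : IsPrincipalSolution q Y) (hL : 0 < L)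
    (hq : ContDiffOn ℝ 1 q (Set.Icc 0 L)) :
    ∃ C : ℝ, 0 ≤ C ∧ ∀ z : ℂ, z ≠ 0 →
      ‖y12 L Y z - Complex.sin (z * L)‖ ≤ C * Real.exp |(z * L).im| / ‖z‖ ∧
      ‖mainFunction L Y z + Complex.sin (z * L) ^ 2‖ ≤ C * Real.exp |(z * L).im| ^ 2 / ‖z‖ := by
  obtain ⟨C, hC, h⟩ := hY.exists_asymptotics hL hq
  refine ⟨2 * C, by positivity, fun z hz => ?_⟩
  obtain ⟨h1, h2, h3, h4⟩ := h z hz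
  have him : |(z * L).im| = |z.im| * L := by
    rw [Complex.mul_im]; simp [abs_mul, abs_of_pos hL]
  rw [him]
  set E := Real.exp (|z.im| * L) with hE
  set δ := C * E / ‖z‖ with hδ
  have e1 : Complex.exp (-(Complex.I * z * L)) = Complex.exp (-(z * L) * Complex.I) := by
    congr 1; ring
  have e2 : Complex.exp (Complex.I * z * L) = Complex.exp (z * L * Complex.I) := by
    congr 1; ring
  rw [e1] at h1
  rw [e2] at h4
  have h2C : 2 * C * E / ‖z‖ = 2 * δ := by rw [hδ]; ring
  constructor
  · have e3 : y12 L Y z - Complex.sin (z * L) = Complex.I / 2 *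
        ((Y L z 0 0 - Complex.exp (-(z * L) * Complex.I)) + Y L z 1 0 - Y L z 0 1 -
          (Y L z 1 1 - Complex.exp (z * L * Complex.I))) := by
      rw [y12_eq, Complex.sin]; ring
    rw [e3, norm_mul, norm_div, Complex.norm_I, Complex.norm_ofNat, h2C]
    have := norm_sub_le ((Y L z 0 0 - Complex.exp (-(z * L) * Complex.I)) + Y L z 1 0 - Y L z 0 1)
      (Y L z 1 1 - Complex.exp (z * L * Complex.I))
    have := norm_sub_le ((Y L z 0 0 - Complex.exp (-(z * L) * Complex.I)) + Y L z 1 0) (Y L z 0 1)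
    have := norm_add_le (Y L z 0 0 - Complex.exp (-(z * L) * Complex.I)) (Y L z 1 0)
    linarith
  · have e3 : discriminant L Y z - Complex.cos (z * L) = 1 / 2 *
        ((Y L z 0 0 - Complex.exp (-(z * L) * Complex.I)) +
          (Y L z 1 1 - Complex.exp (z * L * Complex.I))) := by
      rw [discriminant_eq, Complex.cos]; ring
    have h5 : ‖discriminant L Y z - Complex.cos (z * L)‖ ≤ δ := by
      rw [e3, norm_mul, norm_div, norm_one, Complex.norm_ofNat]
      have := norm_add_le (Y L z 0 0 - Complex.exp (-(z * L) * Complex.I))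
        (Y L z 1 1 - Complex.exp (z * L * Complex.I))
      linarith
    have h6 : ‖discriminant L Y z + Complex.cos (z * L)‖ ≤ 2 * E := by
      have k1 := hY.norm_le z 0 0 hL.le
      have k2 := hY.norm_le z 1 1 hL.le
      have k3 : ‖discriminant L Y z‖ ≤ E := by
        rw [discriminant_eq, norm_div, Complex.norm_ofNat]
        have := norm_add_le (Y L z 0 0) (Y L z 1 1)
        linarith
      have k4 := norm_cos_le_exp (z * L)
      rw [him] at k4
      have := norm_add_le (discriminant L Y z) (Complex.cos (z * L))
      linarith
    have e4 : mainFunction L Y z + Complex.sin (z * L) ^ 2 =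
        (discriminant L Y z - Complex.cos (z * L)) * (discriminant L Y z + Complex.cos (z * L)) := by
      rw [mainFunction]
      linear_combination Complex.sin_sq_add_cos_sq (z * L)
    rw [e4, norm_mul]
    calc _ ≤ δ * (2 * E) := by gcongr
      _ = _ := by rw [hδ]; ring

/-- Lower bounds of the spectral functions away from the points `j π / L`. -/
lemma exists_spectral_lower_bound (hY : IsPrincipalSolution q Y) (hL : 0 < L)
    (hq : ContDiffOn ℝ 1 q (Set.Icc 0 L)) :
    ∃ R : ℝ, 0 < R ∧ ∀ z : ℂ, R ≤ ‖z‖ → (∀ j : ℤ, Real.pi / 8 ≤ ‖z * L - (j * Real.pi : ℝ)‖) →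
      0 < ‖y12 L Y z‖ ∧ Real.exp |(z * L).im| ^ 2 ≤ 512 * ‖mainFunction L Y z‖ := by
  obtain ⟨C, hC, h⟩ := hY.exists_spectral_asymptotics hL hq
  refine ⟨512 * C + 1, by positivity, fun z hz hj => ?_⟩
  have hzp : 0 < ‖z‖ := by linarith
  obtain ⟨h1, h2⟩ := h z (norm_pos_iff.1 hzp)
  have h3 := exp_le_norm_sin hj
  set E := Real.exp |(z * L).im| with hE
  have hEp : 0 < E := Real.exp_pos _
  have hCz : C / ‖z‖ ≤ 1 / 512 := by rw [div_le_iff₀ hzp]; linarith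
  constructor
  · have h4 : C * E / ‖z‖ ≤ E / 512 := by
      calc _ = C / ‖z‖ * E := by ring
        _ ≤ 1 / 512 * E := by gcongr
        _ = _ := by ring
    have := norm_sub_norm_le (Complex.sin (z * L)) (y12 L Y z)
    rw [norm_sub_rev] at this
    linarith
  · have h4 : C * E ^ 2 / ‖z‖ ≤ E ^ 2 / 512 := by
      calc _ = C / ‖z‖ * E ^ 2 := by ring
        _ ≤ 1 / 512 * E ^ 2 := by gcongr
        _ = _ := by ring
    have h5 := norm_sub_norm_le (Complex.sin (z * L) ^ 2) (-mainFunction L Y z)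
    rw [sub_neg_eq_add, norm_neg, norm_pow, add_comm (Complex.sin (z * L) ^ 2)] at h5
    have h6 : E ^ 2 ≤ 256 * ‖Complex.sin (z * L)‖ ^ 2 := by nlinarith
    linarith

/-- In a double sector about the imaginary axis, points far from the origin keep away from the
`j π / L`. -/
lemma dist_int_pi_of_sector (hL : 0 < L) {z : ℂ} (hR : 2 / L ≤ ‖z‖)
    (hz : ‖z‖ / 4 ≤ |z.im|) (j : ℤ) :
    Real.pi / 8 ≤ ‖z * L - (j * Real.pi : ℝ)‖ := by
  have h1 := Complex.abs_im_le_norm (z * L - (j * Real.pi : ℝ))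
  rw [Complex.sub_im, Complex.ofReal_im, sub_zero, Complex.im_mul_ofReal, abs_mul,
      abs_of_pos hL] at h1
  have h2 : 2 ≤ ‖z‖ * L := by rwa [div_le_iff₀ hL] at hR
  have h3 := Real.pi_lt_four
  nlinarith

end IsPrincipalSolution

/-- The zeros of a nontrivial entire function are isolated. -/
lemma eventually_ne_zero_of_entire {f : ℂ → ℂ} (hf : Differentiable ℂ f) {a : ℂ} (ha : f a ≠ 0)
    (z : ℂ) : ∀ᶠ z' in 𝓝[≠] z, f z' ≠ 0 := by
  rcases (hf.analyticAt z).eventually_eq_zero_or_eventually_ne_zero with h | h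
  · have : f = fun _ => 0 := AnalyticOnNhd.eq_of_eventuallyEq
      (fun w _ => hf.analyticAt w) (fun w _ => analyticAt_const) h
    exact absurd (congrFun this a) ha
  · exact h

/-! ### The product over the Dirichlet eigenvalues -/

lemma exists_forall_le_of_eventually_cofinite {f : ℤ → ℝ} {C : ℝ} (h : ∀ᶠ j in cofinite, f j ≤ C) :
    ∃ C' : ℝ, 0 ≤ C' ∧ ∀ j, f j ≤ C' := by
  obtain ⟨B, hB⟩ := ((Filter.eventually_cofinite.1 h).image f).bddAbove
  refine ⟨max (max B C) 0, le_max_right _ _, fun j => ?_⟩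
  by_cases hj : f j ≤ C
  · exact hj.trans ((le_max_right _ _).trans (le_max_left _ _))
  · exact (hB ⟨j, hj, rfl⟩).trans ((le_max_left _ _).trans (le_max_left _ _))

lemma IsDirichletEnumeration.y12_eq_zero {L : ℝ} {Y : ℝ → ℂ → Mat2} {μ : ℤ → ℂ}
    (hμ : IsDirichletEnumeration L Y μ) (j : ℤ) : y12 L Y (μ j) = 0 := by
  refine apply_eq_zero_of_analyticOrderAt_ne_zero ?_
  rw [← hμ.mult (μ j), Set.encard_ne_zero]
  exact ⟨j, rfl⟩

/-- The Dirichlet eigenvalues approach the points `j π / L` at the rate `1 / j`. -/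
lemma IsDirichletEnumeration.exists_decay {L : ℝ} {q : ℝ → ℂ} {Y : ℝ → ℂ → Mat2} {μ : ℤ → ℂ}
    (hμ : IsDirichletEnumeration L Y μ) (hY : IsPrincipalSolution q Y) (hL : 0 < L)
    (hq : ContDiffOn ℝ 1 q (Set.Icc 0 L)) :
    ∃ C : ℝ, 0 ≤ C ∧ ∀ j : ℤ, ‖μ j - ((j * Real.pi / L : ℝ) : ℂ)‖ * (|(j : ℝ)| + 1) ≤ C := by
  obtain ⟨C, hC, h⟩ := hY.exists_spectral_asymptotics hL hq
  have hpi := Real.pi_pos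
  have hpi4 := Real.pi_lt_four
  set K : ℝ := 8 * C * Real.exp 1 / Real.pi with hK
  refine exists_forall_le_of_eventually_cofinite (C := K) ?_
  have hne : ∀ᶠ j : ℤ in cofinite, j ≠ 0 :=
      (Set.finite_singleton (0 : ℤ)).eventually_cofinite_notMem
  filter_upwards [hμ.label, hne] with j hj hj0
  set p : ℝ := j * Real.pi / L with hp
  set d : ℂ := μ j - (p : ℂ) with hd
  have hj1 : 1 ≤ |(j : ℝ)| := by exact_mod_cast Int.one_le_abs hj0
  have hpabs : |p| = |(j : ℝ)| * Real.pi / L := by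
    rw [hp, abs_div, abs_mul, abs_of_pos hpi, abs_of_pos hL]
  have hμn : |(j : ℝ)| * Real.pi / (2 * L) ≤ ‖μ j‖ := by
    have h1 : |p| ≤ ‖μ j‖ + ‖d‖ := by
      rw [← Real.norm_eq_abs, ← Complex.norm_real]
      calc ‖(p : ℂ)‖ = ‖μ j - d‖ := by rw [hd, sub_sub_cancel]
        _ ≤ _ := norm_sub_le _ _
    have h2 : Real.pi / (4 * L) ≤ |(j : ℝ)| * Real.pi / (4 * L) := by
      gcongr; nlinarith
    have h3 : |(j : ℝ)| * Real.pi / L =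
        |(j : ℝ)| * Real.pi / (2 * L) + 2 * (|(j : ℝ)| * Real.pi / (4 * L)) := by
      field_simp; norm_num
    have h4 : 0 ≤ |(j : ℝ)| * Real.pi / (4 * L) := by positivity
    linarith
  have hμp : 0 < ‖μ j‖ := lt_of_lt_of_le (by positivity) hμn
  have hdL : ‖d * L‖ ≤ 1 := by
    rw [norm_mul, Complex.norm_real, Real.norm_of_nonneg hL.le]
    have : ‖d‖ * L ≤ Real.pi / (4 * L) * L := by gcongr
    have e : Real.pi / (4 * L) * L = Real.pi / 4 := by field_simp
    linarith
  have hshift : μ j * L = d * L + j * Real.pi := by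
    have hLc : (L : ℂ) ≠ 0 := by exact_mod_cast hL.ne'
    rw [hd, hp]; push_cast; field_simp; ring
  have hsin : ‖Complex.sin (μ j * L)‖ = ‖Complex.sin (d * L)‖ := by
    rw [hshift, Complex.sin_antiperiodic.add_int_mul_eq]
    simp
  have him : |(μ j * L).im| ≤ 1 := by
    rw [hshift]
    have : (d * L + j * Real.pi).im = (d * L).im := by simp
    rw [this]
    exact (Complex.abs_im_le_norm _).trans hdL
  have h1 := (h (μ j) (norm_pos_iff.1 hμp)).1
  rw [hμ.y12_eq_zero, zero_sub, norm_neg, hsin] at h1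
  have h2 := half_norm_le_norm_sin hdL
  rw [norm_mul, Complex.norm_real, Real.norm_of_nonneg hL.le] at h2
  have h3 : C * Real.exp |(μ j * L).im| / ‖μ j‖ ≤
      C * Real.exp 1 / (|(j : ℝ)| * Real.pi / (2 * L)) := by
    gcongr
  have h4 : C * Real.exp 1 / (|(j : ℝ)| * Real.pi / (2 * L)) * (4 / L * |(j : ℝ)|) = K := by
    rw [hK]; field_simp; ring
  calc ‖d‖ * (|(j : ℝ)| + 1) ≤ ‖d‖ * (2 * |(j : ℝ)|) := by gcongr ‖d‖ * ?_; linarith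
    _ = ‖d‖ * L / 2 * (4 / L * |(j : ℝ)|) := by field_simp; norm_num
    _ ≤ C * Real.exp 1 / (|(j : ℝ)| * Real.pi / (2 * L)) * (4 / L * |(j : ℝ)|) := by
      gcongr ?_ * _; linarith
    _ = K := h4

lemma sin_real_multiple_pi {L : ℝ} (hL : L ≠ 0) (j : ℤ) :
    Complex.sin (((j * Real.pi / L : ℝ) : ℂ) * L) = 0 := by
  rw [← Complex.ofReal_mul, div_mul_cancel₀ _ hL]
  push_cast
  exact Complex.sin_int_mul_pi j

lemma piConst_ne_zero {L : ℝ} (hL : L ≠ 0) (j : ℤ) : piConst L j ≠ 0 := by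
  rw [piConst]
  split_ifs with h
  · simpa using hL
  · have : (j : ℝ) * Real.pi / L ≠ 0 :=
      div_ne_zero (mul_ne_zero (by exact_mod_cast h) Real.pi_ne_zero) hL
    exact_mod_cast this

/-- Euler's product for the sine in the normalization of `IsSymmetricProduct`. -/
lemma tendsto_sine_product {L : ℝ} (hL : 0 < L) (z : ℂ) :
    Tendsto (fun N : ℕ => ∏ j ∈ Finset.Icc (-(N : ℤ)) (N : ℤ),
      (((j * Real.pi / L : ℝ) : ℂ) - z) / piConst L j) atTop (𝓝 (-Complex.sin (z * L))) := by
  have hpi : (Real.pi : ℂ) ≠ 0 := by exact_mod_cast Real.pi_ne_zero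
  have hLc : (L : ℂ) ≠ 0 := by exact_mod_cast hL.ne'
  have hN : ∀ N : ℕ, ∏ j ∈ Finset.Icc (-(N : ℤ)) (N : ℤ),
      (((j * Real.pi / L : ℝ) : ℂ) - z) / piConst L j =
      -(Real.pi * (z * L / Real.pi) *
        ∏ k ∈ Finset.range N, ((1 : ℂ) - (z * L / Real.pi) ^ 2 / ((k : ℂ) + 1) ^ 2)) := by
    intro N
    induction N with
    | zero =>
      simp [piConst]
      field_simp
    | succ n ih =>
      have hset : Finset.Icc (-((n + 1 : ℕ) : ℤ)) ((n + 1 : ℕ) : ℤ) =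
          insert ((n : ℤ) + 1) (insert (-((n : ℤ) + 1)) (Finset.Icc (-(n : ℤ)) (n : ℤ))) := by
        ext j
        simp only [Finset.mem_Icc, Finset.mem_insert]
        push_cast
        omega
      rw [hset, Finset.prod_insert (by simp only [Finset.mem_insert, Finset.mem_Icc]; omega),
        Finset.prod_insert (by simp only [Finset.mem_Icc]; omega), ih, Finset.prod_range_succ]
      have h1 : piConst L ((n : ℤ) + 1) = ((n : ℂ) + 1) * Real.pi / L := by
        rw [piConst, if_neg (by omega)]; push_cast; ring
      have h2 : piConst L (-((n : ℤ) + 1)) = -(((n : ℂ) + 1) * Real.pi / L) := by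
        rw [piConst, if_neg (by omega)]; push_cast; ring
      have hn : (n : ℂ) + 1 ≠ 0 := by exact_mod_cast Nat.succ_ne_zero n
      rw [h1, h2]
      have e : ((((((n : ℤ) + 1 : ℤ) : ℝ) * Real.pi / L : ℝ) : ℂ) - z) / (((n : ℂ) + 1) * Real.pi / L) *
          ((((((-((n : ℤ) + 1) : ℤ) : ℝ) * Real.pi / L : ℝ) : ℂ) - z) / (-(((n : ℂ) + 1) * Real.pi / L))) =
          1 - (z * L / Real.pi) ^ 2 / ((n : ℂ) + 1) ^ 2 := by
        push_cast
        field_simp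
        ring
      rw [← mul_assoc, e]
      ring
  simp only [hN]
  have h := (Complex.tendsto_euler_sin_prod (z * L / Real.pi)).neg
  rwa [show Complex.sin (Real.pi * (z * L / Real.pi)) = Complex.sin (z * L) by
    rw [mul_div_cancel₀ _ hpi]] at h

/-- `∑ 1 / (1 + |j|)²` over the integers converges. -/
lemma summable_inv_abs_add_one_sq : Summable fun j : ℤ => (1 : ℝ) / (|(j : ℝ)| + 1) ^ 2 := by
  have h : Summable fun n : ℕ => (1 : ℝ) / ((n : ℝ) + 1) ^ 2 := by
    have := (summable_nat_add_iff 1).2 (Real.summable_one_div_nat_pow.2 one_lt_two)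
    simpa using this
  refine Summable.of_nat_of_neg ?_ ?_
  · simpa using h
  · simpa using h

/-- The product over all Dirichlet eigenvalues has no other zeros than the obvious ones and the
`j π / L`, and in double sectors about the imaginary axis it is at most of the size of the sine. It
is compared factor by factor with Euler's product of the sine: the quotients are
`1 + O(1 / j²)`. -/
theorem IsDirichletEnumeration.exists_product_bounds {L : ℝ} {q : ℝ → ℂ} {Y : ℝ → ℂ → Mat2}
    {μ : ℤ → ℂ} (hμ : IsDirichletEnumeration L Y μ) (hY : IsPrincipalSolution q Y) (hL : 0 < L)
    (hq : ContDiffOn ℝ 1 q (Set.Icc 0 L)) {F : ℂ → ℂ}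
    (hF : ∀ z, Tendsto (fun N : ℕ => ∏ j ∈ Finset.Icc (-(N : ℤ)) (N : ℤ),
      (μ j - z) / piConst L j) atTop (𝓝 (F z))) :
    (∀ z, Complex.sin (z * L) ≠ 0 → (∀ j, μ j ≠ z) → F z ≠ 0) ∧
    ∃ K : ℝ, 0 ≤ K ∧ ∀ z : ℂ, 4 / L ≤ ‖z‖ → ‖z‖ / 4 ≤ |z.im| →
      ‖F z‖ ≤ K * Real.exp |(z * L).im| := by
  obtain ⟨C, hC, hdec⟩ := hμ.exists_decay hY hL hq
  have hpi := Real.pi_pos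
  set p : ℤ → ℂ := fun j => ((j * Real.pi / L : ℝ) : ℂ) with hp
  set a : ℂ → ℤ → ℂ := fun z j => (μ j - p j) / (p j - z) with ha
  have hpn : ∀ j, ‖p j‖ = |(j : ℝ)| * Real.pi / L := by
    intro j
    rw [hp]
    simp only
    rw [Complex.norm_real, Real.norm_eq_abs, abs_div, abs_mul, abs_of_pos hpi, abs_of_pos hL]
  have hpz : ∀ z, Complex.sin (z * L) ≠ 0 → ∀ j, p j - z ≠ 0 := by
    intro z hz j h
    rw [sub_eq_zero] at h
    exact hz (h ▸ sin_real_multiple_pi hL.ne' j)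
  -- a lower bound of the distances to `z` gives a bound of the factors
  have habound : ∀ z : ℂ, ∀ B : ℝ, 0 ≤ B → (∀ j : ℤ, (|(j : ℝ)| + 1) ≤ B * ‖p j - z‖) →
      ∀ j, ‖a z j‖ ≤ C * B * (1 / (|(j : ℝ)| + 1) ^ 2) := by
    intro z B hB h j
    have h1 : 0 < |(j : ℝ)| + 1 := by positivity
    have hpp : 0 < ‖p j - z‖ := by
      by_contra hn
      have : ‖p j - z‖ = 0 := le_antisymm (not_lt.1 hn) (norm_nonneg _)
      have := h j
      simp_all
      linarith [abs_nonneg (j : ℝ)]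
    simp only [ha]
    rw [norm_div, div_le_iff₀ hpp]
    have h2 := hdec j
    have h3 : ‖μ j - p j‖ ≤ C / (|(j : ℝ)| + 1) := by rwa [le_div_iff₀ h1]
    refine h3.trans ?_
    have h4 : C * B * (1 / (|(j : ℝ)| + 1) ^ 2) * ‖p j - z‖ =
        C / (|(j : ℝ)| + 1) ^ 2 * (B * ‖p j - z‖) := by ring
    rw [h4]
    calc C / (|(j : ℝ)| + 1) = C / (|(j : ℝ)| + 1) ^ 2 * (|(j : ℝ)| + 1) := by field_simp
      _ ≤ _ := by gcongr; exact h j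
  -- the comparison of the partial products
  have hsplit : ∀ z, Complex.sin (z * L) ≠ 0 → ∀ N : ℕ,
      ∏ j ∈ Finset.Icc (-(N : ℤ)) (N : ℤ), (μ j - z) / piConst L j =
      (∏ j ∈ Finset.Icc (-(N : ℤ)) (N : ℤ), (p j - z) / piConst L j) *
        ∏ j ∈ Finset.Icc (-(N : ℤ)) (N : ℤ), (1 + a z j) := by
    intro z hz N
    rw [← Finset.prod_mul_distrib]
    refine Finset.prod_congr rfl fun j _ => ?_
    have h1 := hpz z hz j
    have h2 := piConst_ne_zero hL.ne' j
    simp only [ha]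
    field_simp
    ring
  refine ⟨fun z hz hμz => ?_, ?_⟩
  · -- all distances `‖p j - z‖` are positive, and they grow linearly
    obtain ⟨B, hB, hBj⟩ : ∃ B : ℝ, 0 ≤ B ∧ ∀ j : ℤ, (|(j : ℝ)| + 1) / ‖p j - z‖ ≤ B := by
      refine exists_forall_le_of_eventually_cofinite (C := 2 * L / Real.pi + 1) ?_
      have hfin : ∀ᶠ j : ℤ in cofinite, 2 * (‖z‖ * L / Real.pi) + 1 < |(j : ℝ)| := by
        set X : ℝ := 2 * (‖z‖ * L / Real.pi) + 1 with hX
        refine (Set.finite_Icc (-⌈X⌉) ⌈X⌉).eventually_cofinite_notMem.mono fun j hj => ?_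
        by_contra hle
        rw [not_lt, abs_le] at hle
        refine hj ⟨?_, ?_⟩
        · have : (-(⌈X⌉ : ℝ)) ≤ j := by linarith [Int.le_ceil X]
          exact_mod_cast this
        · have : (j : ℝ) ≤ ⌈X⌉ := by linarith [Int.le_ceil X]
          exact_mod_cast this
      filter_upwards [hfin] with j h1
      have hpp : 0 < ‖p j - z‖ := norm_pos_iff.2 (hpz z hz j)
      rw [div_le_iff₀ hpp]
      have h4 : ‖p j‖ ≤ ‖p j - z‖ + ‖z‖ := norm_le_norm_sub_add _ _
      rw [hpn] at h4
      have h5 : |(j : ℝ)| = L / Real.pi * (|(j : ℝ)| * Real.pi / L) := by field_simp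
      have h6 : L / Real.pi * (|(j : ℝ)| * Real.pi / L) ≤ L / Real.pi * (‖p j - z‖ + ‖z‖) := by
        gcongr
      have h7 : L / Real.pi * ‖z‖ = ‖z‖ * L / Real.pi := by ring
      have h8 : L / Real.pi * (‖p j - z‖ + ‖z‖) = L / Real.pi * ‖p j - z‖ + ‖z‖ * L / Real.pi :=
          by ring
      have h9 : |(j : ℝ)| + 1 ≤ 2 * (L / Real.pi * ‖p j - z‖) := by linarith
      have h10 : (2 * L / Real.pi + 1) * ‖p j - z‖ =
          2 * (L / Real.pi * ‖p j - z‖) + ‖p j - z‖ := by ring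
      linarith
    have hs : Summable fun j => ‖a z j‖ := by
      refine Summable.of_nonneg_of_le (fun _ => norm_nonneg _)
        (habound z B hB fun j => ?_) (summable_inv_abs_add_one_sq.mul_left (C * B))
      have hpp : 0 < ‖p j - z‖ := norm_pos_iff.2 (hpz z hz j)
      rw [← div_le_iff₀ hpp]
      exact hBj j
    have hprod := (multipliable_one_add_of_summable hs).hasProd.comp Finset.tendsto_Icc_neg
    have hlim := (tendsto_sine_product hL z).mul hprod
    have hFz : F z = -Complex.sin (z * L) * ∏' j, (1 + a z j) := by
      refine tendsto_nhds_unique (hF z) (hlim.congr fun N => ?_)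
      rw [hsplit z hz N]
      rfl
    rw [hFz]
    refine mul_ne_zero (neg_ne_zero.2 hz) (tprod_one_add_ne_zero_of_summable (fun j => ?_) hs)
    simp only [ha]
    rw [one_add_div (hpz z hz j)]
    refine div_ne_zero ?_ (hpz z hz j)
    rw [sub_add_sub_cancel']
    exact sub_ne_zero.2 (hμz j)
  · set B : ℝ := 5 * L / Real.pi + L with hB
    have hB0 : 0 ≤ B := by positivity
    set S : ℝ := ∑' j : ℤ, C * B * (1 / (|(j : ℝ)| + 1) ^ 2) with hS
    refine ⟨Real.exp S, (Real.exp_pos _).le, fun z hzR hz => ?_⟩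
    have hdz : ∀ j, ‖z‖ / 4 ≤ ‖p j - z‖ := by
      intro j
      have h1 := Complex.abs_im_le_norm (p j - z)
      have h2 : (p j - z).im = -z.im := by simp [hp]
      rw [h2, abs_neg] at h1
      linarith
    have hd1 : ∀ j, 1 / L ≤ ‖p j - z‖ := fun j => by
      have : 4 / L = 4 * (1 / L) := by ring
      linarith [hdz j]
    have hsin : Complex.sin (z * L) ≠ 0 := by
      have h1 := exp_le_norm_sin (w := z * L)
        (IsPrincipalSolution.dist_int_pi_of_sector hL (le_trans (by gcongr; norm_num) hzR) hz)
      intro h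
      rw [h, norm_zero, mul_zero] at h1
      exact absurd h1 (not_le.2 (Real.exp_pos _))
    have hbd : ∀ j, ‖a z j‖ ≤ C * B * (1 / (|(j : ℝ)| + 1) ^ 2) := by
      refine habound z B hB0 fun j => ?_
      have h3 : ‖p j‖ ≤ 5 * ‖p j - z‖ := by
        have := norm_le_norm_sub_add (p j) z
        linarith [hdz j]
      rw [hpn] at h3
      have h4 : |(j : ℝ)| = L / Real.pi * (|(j : ℝ)| * Real.pi / L) := by field_simp
      have h5 : L / Real.pi * (|(j : ℝ)| * Real.pi / L) ≤ L / Real.pi * (5 * ‖p j - z‖) := by gcongr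
      have h6 : (1 : ℝ) ≤ L * ‖p j - z‖ := by
        have := hd1 j
        rw [div_le_iff₀ hL] at this
        linarith
      rw [hB]
      calc |(j : ℝ)| + 1 ≤ L / Real.pi * (5 * ‖p j - z‖) + L * ‖p j - z‖ := by linarith
        _ = _ := by ring
    have hsum : ∀ t : Finset ℤ, ∑ j ∈ t, ‖a z j‖ ≤ S := fun t =>
      (Finset.sum_le_sum fun j _ => hbd j).trans
        ((summable_inv_abs_add_one_sq.mul_left (C * B)).sum_le_tsum t fun j _ => by positivity)
    have hpb : ∀ t : Finset ℤ, ‖∏ j ∈ t, (1 + a z j)‖ ≤ Real.exp S := by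
      intro t
      have h1 := t.norm_prod_one_add_sub_one_le (a z)
      have h2 := norm_le_norm_sub_add (∏ j ∈ t, (1 + a z j)) 1
      rw [norm_one] at h2
      have h3 := Real.exp_le_exp.2 (hsum t)
      linarith
    have hsn := norm_sin_le_exp (z * L)
    have hlim1 := ((tendsto_sine_product hL z).norm.mul_const (Real.exp S))
    refine (le_of_tendsto_of_tendsto' (hF z).norm hlim1 fun N => ?_).trans ?_
    · rw [hsplit z hsin N, norm_mul]
      gcongr
      exact hpb _
    · rw [norm_neg, mul_comm]
      gcongr

/-! ### Boundary values, jump matrices and normalization -/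

section Matrices

lemma mul_adjugate_apply (A B : Mat2) (i j : Fin 2) :
    (A * B.adjugate) i j = A i 0 * B.adjugate 0 j + A i 1 * B.adjugate 1 j := by
  rw [Matrix.mul_apply, Fin.sum_univ_two]

lemma mul_adjugate_apply_zero (A B : Mat2) (i : Fin 2) :
    (A * B.adjugate) i 0 = A i 0 * B 1 1 + A i 1 * -B 1 0 := by
  rw [mul_adjugate_apply, Matrix.adjugate_fin_two]; rfl

lemma mul_adjugate_apply_one (A B : Mat2) (i : Fin 2) :
    (A * B.adjugate) i 1 = A i 0 * -B 0 1 + A i 1 * B 0 0 := by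
  rw [mul_adjugate_apply, Matrix.adjugate_fin_two]; rfl

lemma exists_adjugate_eq (B : Mat2) (i j : Fin 2) :
    ∃ k l : Fin 2, B.adjugate i j = B k l ∨ B.adjugate i j = -B k l := by
  rw [Matrix.adjugate_fin_two]
  fin_cases i <;> fin_cases j
  · exact ⟨1, 1, Or.inl rfl⟩
  · exact ⟨0, 1, Or.inr rfl⟩
  · exact ⟨1, 0, Or.inr rfl⟩
  · exact ⟨0, 0, Or.inl rfl⟩

lemma norm_mul_adjugate_le {A B : Mat2} {a b : ℝ} (hA : ∀ i j, ‖A i j‖ ≤ a)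
    (hB : ∀ i j, ‖B i j‖ ≤ b) (i j : Fin 2) : ‖(A * B.adjugate) i j‖ ≤ 2 * a * b := by
  have hB' : ∀ i j, ‖B.adjugate i j‖ ≤ b := by
    intro i j
    obtain ⟨k, l, h | h⟩ := exists_adjugate_eq B i j
    · rw [h]; exact hB k l
    · rw [h, norm_neg]; exact hB k l
  have ha : 0 ≤ a := (norm_nonneg _).trans (hA 0 0)
  rw [mul_adjugate_apply]
  refine (norm_add_le _ _).trans ?_
  rw [norm_mul, norm_mul]
  calc _ ≤ a * b + a * b := by
        gcongr <;> first | exact hA _ _ | exact hB' _ _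
    _ = _ := by ring

/-- A common right factor of determinant one cancels in `A adj(B)`. -/
lemma mul_adjugate_mul_of_det_eq_one {A B V : Mat2} (hV : V.det = 1) :
    (A * V) * (B * V).adjugate = A * B.adjugate := by
  rw [Matrix.adjugate_mul_distrib, Matrix.mul_assoc, ← Matrix.mul_assoc V, Matrix.mul_adjugate, hV,
    one_smul, Matrix.one_mul]

lemma HasNTLimit.mul_adjugate {Φ Φ' : ℂ → Mat2} {z τ : ℂ} {A A' : Mat2} (h : HasNTLimit Φ z τ A)
    (h' : HasNTLimit Φ' z τ A') (i j : Fin 2) :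
    HasNTLimit (fun z => (Φ z * (Φ' z).adjugate) i j) z τ ((A * A'.adjugate) i j) := by
  intro ε hε
  have e1 : ∀ k l, Tendsto (fun z => Φ z k l) _ (𝓝 (A k l)) := fun k l =>
    tendsto_pi_nhds.1 (tendsto_pi_nhds.1 (h ε hε) k) l
  have e2 : ∀ k l, Tendsto (fun z => Φ' z k l) _ (𝓝 (A' k l)) := fun k l =>
    tendsto_pi_nhds.1 (tendsto_pi_nhds.1 (h' ε hε) k) l
  match j with
  | 0 =>
    simp only [mul_adjugate_apply_zero]
    exact ((e1 i 0).mul (e2 1 1)).add ((e1 i 1).mul (e2 1 0).neg)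
  | 1 =>
    simp only [mul_adjugate_apply_one]
    exact ((e1 i 0).mul (e2 0 1).neg).add ((e1 i 1).mul (e2 0 0))

end Matrices

section Contour

variable {L : ℝ} {q : ℝ → ℂ} {Y : ℝ → ℂ → Mat2}

lemma mainFunction_eq_zero_of_mem_bandEdges {e : ℂ} (he : e ∈ bandEdges L Y) :
    mainFunction L Y e = 0 := by
  refine apply_eq_zero_of_analyticOrderAt_ne_zero ?_
  have : analyticOrderAt (mainFunction L Y) e = 1 := he
  rw [this]
  exact one_ne_zero

lemma im_deriv_discriminant_of_real (hY : IsPrincipalSolution q Y) (hL : 0 ≤ L) {z : ℂ}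
    (hz : z.im = 0) : (deriv (discriminant L Y) z).im = 0 := by
  have h1 : HasDerivAt (fun s : ℝ => discriminant L Y s) (deriv (discriminant L Y) z) z.re := by
    have : HasDerivAt (discriminant L Y) (deriv (discriminant L Y) z) ((z.re : ℝ) : ℂ) := by
      have e : ((z.re : ℝ) : ℂ) = z := Complex.ext (by simp) (by simp [hz])
      rw [e]
      exact ((hY.differentiable_discriminant hL) _).hasDerivAt
    exact this.comp_ofReal
  have h2 := Complex.imCLM.hasFDerivAt.comp_hasDerivAt _ h1
  have h3 : (⇑Complex.imCLM ∘ fun s : ℝ => discriminant L Y s) = fun _ => (0 : ℝ) := by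
    funext s
    exact hY.discriminant_im_of_real hL (Complex.ofReal_im s)
  rw [h3] at h2
  exact h2.unique (hasDerivAt_const _ (0 : ℝ))

namespace SpectralArcs

variable (Γ : SpectralArcs L Y)

lemma im_crossing {n : ℤ} (hn : n ∈ Γ.index) : (Γ.γ n 0).im = 0 := by
  have := Γ.schwarz n hn 0
  rw [neg_zero] at this
  exact Complex.conj_eq_iff_im.1 this.symm

lemma im_discriminant_of_mem_contour (hY : IsPrincipalSolution q Y) (hL : 0 ≤ L) {z : ℂ}
    (hz : z ∈ Γ.contour) : (discriminant L Y z).im = 0 := by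
  rcases hz with hz | ⟨n, hn, t, s, -, -, rfl⟩
  · exact hY.discriminant_im_of_real hL hz
  · exact Γ.im_discriminant n hn t

lemma im_deriv_discriminant_mul_tangent (hY : IsPrincipalSolution q Y) (hL : 0 ≤ L) {n : ℤ}
    (hn : n ∈ Γ.index) (t : ℝ) :
    (deriv (discriminant L Y) (Γ.γ n t) * deriv (Γ.γ n) t).im = 0 := by
  have h1 : HasDerivAt (fun t : ℝ => discriminant L Y (Γ.γ n t))
      (deriv (discriminant L Y) (Γ.γ n t) * deriv (Γ.γ n) t) t :=
    HasDerivAt.comp t ((hY.differentiable_discriminant hL) _).hasDerivAt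
      (Γ.analytic n hn t).differentiableAt.hasDerivAt
  have h2 := Complex.imCLM.hasFDerivAt.comp_hasDerivAt t h1
  have h3 : (⇑Complex.imCLM ∘ fun t : ℝ => discriminant L Y (Γ.γ n t)) = fun _ => (0 : ℝ) := by
    funext t
    exact Γ.im_discriminant n hn t
  rw [h3] at h2
  exact h2.unique (hasDerivAt_const t (0 : ℝ))

/-- The arcs meet the real axis at right angles, so that `Δ' = 0` at the crossings. -/
lemma deriv_discriminant_eq_zero_of_crossing (hY : IsPrincipalSolution q Y) (hL : 0 ≤ L) {z : ℂ}
    (hz : z ∈ Γ.crossings) : deriv (discriminant L Y) z = 0 := by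
  obtain ⟨n, hn, rfl⟩ := hz
  have him := Γ.im_crossing hn
  set d := deriv (discriminant L Y) (Γ.γ n 0) with hd
  have hdreal : d.im = 0 := im_deriv_discriminant_of_real hY hL him
  -- the tangent of the arc is imaginary
  have hγ : HasDerivAt (Γ.γ n) (deriv (Γ.γ n) 0) 0 :=
    (Γ.analytic n hn 0).differentiableAt.hasDerivAt
  have htan : (deriv (Γ.γ n) 0).re = 0 := by
    have h1 : HasDerivAt (fun t => Γ.γ n (-t)) (-deriv (Γ.γ n) 0) 0 := by
      have h0 : HasDerivAt (Γ.γ n) (deriv (Γ.γ n) 0) (-0) := by rwa [neg_zero]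
      have h00 := HasDerivAt.scomp (0 : ℝ) h0 (hasDerivAt_neg (0 : ℝ))
      rw [neg_one_smul] at h00
      exact h00
    have h2 : HasDerivAt (fun t => Γ.γ n (-t)) (starRingEnd ℂ (deriv (Γ.γ n) 0)) 0 := by
      have : (fun t => Γ.γ n (-t)) = fun t => starRingEnd ℂ (Γ.γ n t) :=
        funext fun t => Γ.schwarz n hn t
      rw [this]
      exact hγ.star
    have h3 := congrArg Complex.re (h1.unique h2)
    simp only [Complex.neg_re, Complex.conj_re] at h3
    linarith
  have h := Γ.im_deriv_discriminant_mul_tangent hY hL hn 0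
  rw [← hd, Complex.mul_im, hdreal, zero_mul, add_zero] at h
  have hne : (deriv (Γ.γ n) 0).im ≠ 0 := fun h0 =>
    Γ.regular n hn 0 (Complex.ext htan h0)
  exact Complex.ext ((mul_eq_zero.1 h).resolve_right hne) hdreal

/-- A nonreal point of the contour which is not a band edge is a point of some `arcParams`. -/
lemma exists_arcParams {z : ℂ} (hz : z ∈ Γ.contour) (him : z.im ≠ 0) (he : z ∉ bandEdges L Y) :
    ∃ n ∈ Γ.index, ∃ t ∈ Γ.arcParams n, Γ.γ n t = z := by
  have hz' := hz
  rcases hz with hz | ⟨n, hn, t, s, -, -, rfl⟩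
  · exact absurd hz him
  · exact ⟨n, hn, t, ⟨fun h => him (h ▸ Γ.im_crossing hn), hz', he⟩, rfl⟩

lemma nu_cases (w : ℂ) : Γ.nu w = 0 ∨ Γ.nu w = 1 ∨ Γ.nu w = -1 := by
  rw [nu]
  split_ifs
  · exact Or.inr (Or.inl rfl)
  · exact Or.inr (Or.inr rfl)
  · rcases SignType.sign (Real.log ‖y22 L Y w‖) with _ | _ | _ <;> simp

end SpectralArcs

end Contour

section Jump

variable {L : ℝ} {Y : ℝ → ℂ → Mat2} (Γ : SpectralArcs L Y) (μ : ℤ → ℂ) (fp fm : ℂ → ℂ)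

lemma det_jumpReal {y : ℝ} (h : fp y * fm y ≠ 0) : (jumpReal Γ μ fp fm y).det = 1 := by
  have h1 := left_ne_zero_of_mul h
  have h2 := right_ne_zero_of_mul h
  have hs : ∀ k : ℕ, ((-1 : ℂ) ^ k) ^ 2 = 1 := fun k => by
    rw [← pow_mul, mul_comm, pow_mul]; simp
  rw [jumpReal, Matrix.det_smul, Fintype.card_fin, Matrix.det_diagonal, Fin.prod_univ_two]
  simp only [Matrix.cons_val_zero, Matrix.cons_val_one]
  split_ifs <;> rw [hs] <;> field_simp

lemma det_conjExp (x : ℝ) (z : ℂ) (A : Mat2) : (conjExp x z A).det = A.det := by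
  rw [conjExp, Matrix.det_mul, Matrix.det_mul, Matrix.det_diagonal, Matrix.det_diagonal,
    Fin.prod_univ_two, Fin.prod_univ_two]
  simp only [Matrix.cons_val_zero, Matrix.cons_val_one]
  rw [← Complex.exp_add, ← Complex.exp_add]
  simp

lemma det_jumpArc {x : ℝ} {n : ℤ} {t : ℝ} (h : fp (Γ.γ n t) * fm (Γ.γ n t) ≠ 0) :
    (jumpArc Γ μ fp fm x n t).det = 1 := by
  have h1 := left_ne_zero_of_mul h
  have h2 := right_ne_zero_of_mul h
  have hs : ∀ k : ℕ, ((-1 : ℂ) ^ k) ^ 2 = 1 := fun k => by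
    rw [← pow_mul, mul_comm, pow_mul]; simp
  have hi : ∀ k : ℕ, ((-Complex.I) ^ k) ^ 2 = (-1 : ℂ) ^ k := fun k => by
    rw [← pow_mul, mul_comm, pow_mul]; simp
  have hi' : ∀ k : ℕ, (Complex.I ^ k) ^ 2 = (-1 : ℂ) ^ k := fun k => by
    rw [← pow_mul, mul_comm, pow_mul]; simp
  rw [jumpArc]
  split_ifs with ht hk hk
  · rw [Matrix.det_smul, Fintype.card_fin, det_conjExp, mul_pow, hs, hi, hk.neg_one_pow,
      Matrix.det_fin_two_of]
    field_simp
    ring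
  · rw [Matrix.det_smul, Fintype.card_fin, mul_pow, hs, hi, Matrix.det_one,
      (Nat.not_odd_iff_even.1 hk).neg_one_pow]
    ring
  · rw [Matrix.det_smul, Fintype.card_fin, det_conjExp, mul_pow, hs, hi', hk.neg_one_pow,
      Matrix.det_fin_two_of]
    field_simp
    ring
  · rw [Matrix.det_smul, Fintype.card_fin, mul_pow, hs, hi', Matrix.det_one,
      (Nat.not_odd_iff_even.1 hk).neg_one_pow]
    ring

/-- The three products together are the product over all Dirichlet eigenvalues. -/
lemma tendsto_product_of_symmetricProducts {μ : ℤ → ℂ} {f0 fp fm : ℂ → ℂ}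
    (hf0 : IsSymmetricProduct L μ {j | Γ.nu (μ j) = 0} (fun z => -f0 z))
    (hfp : IsSymmetricProduct L μ {j | Γ.nu (μ j) = 1} fp)
    (hfm : IsSymmetricProduct L μ {j | Γ.nu (μ j) = -1} fm) (z : ℂ) :
    Tendsto (fun N : ℕ => ∏ j ∈ Finset.Icc (-(N : ℤ)) (N : ℤ), (μ j - z) / piConst L j) atTop
      (𝓝 (-f0 z * fp z * fm z)) := by
  refine (((hf0 z).mul (hfp z)).mul (hfm z)).congr fun N => ?_
  rw [← Finset.prod_mul_distrib, ← Finset.prod_mul_distrib]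
  refine Finset.prod_congr rfl fun j _ => ?_
  simp only [Set.mem_ofPred_eq]
  rcases Γ.nu_cases (μ j) with h | h | h <;> simp [h]

lemma norm_det_matB (b : ℂ → ℂ) (z : ℂ) :
    ‖(matB fp fm b z).det‖ = ‖b z‖ ^ 2 * ‖fp z * fm z‖ := by
  rw [matB]
  split_ifs
  · rw [Matrix.det_smul, Fintype.card_fin, Matrix.det_diagonal, Fin.prod_univ_two]
    simp only [Matrix.cons_val_zero, Matrix.cons_val_one]
    rw [norm_mul, norm_pow, norm_mul, Complex.norm_I, one_mul, mul_comm (fm z)]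
  · rw [Matrix.det_smul, Fintype.card_fin, Matrix.det_diagonal, Fin.prod_univ_two]
    simp only [Matrix.cons_val_zero, Matrix.cons_val_one]
    rw [norm_mul, norm_pow]

/-- `(det B)² (Δ² - 1)` is the square of the product over all Dirichlet eigenvalues. -/
lemma IsBranch.norm_det_sq {f0 b : ℂ → ℂ} (hb : IsBranch Γ f0 b) {z : ℂ} (hz : z ∉ Γ.contour) :
    ‖(matB fp fm b z).det‖ ^ 2 * ‖mainFunction L Y z‖ = ‖-f0 z * fp z * fm z‖ ^ 2 := by
  have h := congrArg norm (hb.fourth_power z hz)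
  rw [norm_mul, norm_pow, norm_pow] at h
  rw [norm_det_matB, norm_mul, norm_mul, norm_mul, norm_neg]
  linear_combination (‖fp z‖ * ‖fm z‖) ^ 2 * h

end Jump

/-! ### The entire function `Φ adj Φ'` -/

section Nontriviality

variable {L : ℝ} {q : ℝ → ℂ} {Y : ℝ → ℂ → Mat2}

namespace IsPrincipalSolution

lemma exists_sector_bound (hY : IsPrincipalSolution q Y) (hL : 0 < L)
    (hq : ContDiffOn ℝ 1 q (Set.Icc 0 L)) :
    ∃ R : ℝ, 0 < R ∧ ∀ z : ℂ, R ≤ ‖z‖ → ‖z‖ / 4 ≤ |z.im| →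
      y12 L Y z ≠ 0 ∧ Complex.sin (z * L) ≠ 0 ∧ mainFunction L Y z ≠ 0 ∧
        Real.exp |(z * L).im| ^ 2 ≤ 512 * ‖mainFunction L Y z‖ := by
  obtain ⟨R, hR, h⟩ := hY.exists_spectral_lower_bound hL hq
  refine ⟨max R (2 / L), lt_max_of_lt_left hR, fun z hz hs => ?_⟩
  have hj := dist_int_pi_of_sector hL ((le_max_right _ _).trans hz) hs
  obtain ⟨h1, h2⟩ := h z ((le_max_left _ _).trans hz) hj
  refine ⟨norm_pos_iff.1 h1, fun h0 => ?_, fun h0 => ?_, h2⟩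
  · have h3 := exp_le_norm_sin hj
    rw [h0, norm_zero, mul_zero] at h3
    exact absurd h3 (not_le.2 (Real.exp_pos _))
  · rw [h0, norm_zero, mul_zero] at h2
    exact absurd h2 (not_le.2 (by positivity))

lemma discriminant_nonconstant (hY : IsPrincipalSolution q Y) (hL : 0 < L)
    (hq : ContDiffOn ℝ 1 q (Set.Icc 0 L)) : ∃ a b, discriminant L Y a ≠ discriminant L Y b := by
  by_contra! hcon
  obtain ⟨R, hR, h⟩ := hY.exists_sector_bound hL hq
  set c := 512 * ‖mainFunction L Y 0‖ with hc
  have hc0 : 0 ≤ c := by positivity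
  set y := max R (c / L) with hy
  have hy0 : 0 < y := lt_max_of_lt_left hR
  have hn : ‖(y : ℂ) * Complex.I‖ = y := by
    rw [norm_mul, Complex.norm_I, mul_one, Complex.norm_real, Real.norm_of_nonneg hy0.le]
  have him : ((y : ℂ) * Complex.I).im = y := by simp
  obtain ⟨-, -, -, h4⟩ := h (y * Complex.I) ((le_max_left _ _).trans hn.ge)
    (by rw [hn, him, abs_of_pos hy0]; linarith)
  have hm : mainFunction L Y (y * Complex.I) = mainFunction L Y 0 := by
    rw [mainFunction, mainFunction, hcon _ 0]
  rw [hm, Complex.im_mul_ofReal, him, abs_of_pos (by positivity), ← hc] at h4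
  have h5 : c ≤ y * L := by
    rw [← div_le_iff₀ hL]; exact le_max_right _ _
  have h6 := Real.add_one_le_exp (y * L)
  nlinarith

end IsPrincipalSolution

/-- The critical points of `Δ`, the main and Dirichlet eigenvalues, and the points `j π / L`: a
discrete set, off which the contour is smooth and the jump matrix is regular. -/
def exceptionalSet (L : ℝ) (Y : ℝ → ℂ → Mat2) : Set ℂ :=
  {z | deriv (discriminant L Y) z = 0 ∨ mainFunction L Y z = 0 ∨ y12 L Y z = 0 ∨
    Complex.sin (z * L) = 0}

lemma IsPrincipalSolution.eventually_notMem_exceptionalSet (hY : IsPrincipalSolution q Y)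
    (hL : 0 < L) (hq : ContDiffOn ℝ 1 q (Set.Icc 0 L)) (z : ℂ) :
    ∀ᶠ z' in 𝓝[≠] z, z' ∉ exceptionalSet L Y := by
  have hD := hY.differentiable_discriminant hL.le
  obtain ⟨R, hR, h⟩ := hY.exists_sector_bound hL hq
  have hn : ‖(R : ℂ) * Complex.I‖ = R := by
    rw [norm_mul, Complex.norm_I, mul_one, Complex.norm_real, Real.norm_of_nonneg hR.le]
  have him : ((R : ℂ) * Complex.I).im = R := by simp
  obtain ⟨h1, h2, h3, -⟩ := h (R * Complex.I) hn.ge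
    (by rw [hn, him, abs_of_pos hR]; linarith)
  obtain ⟨a, ha⟩ : ∃ a, deriv (discriminant L Y) a ≠ 0 := by
    by_contra! hcon
    obtain ⟨a, b, hab⟩ := hY.discriminant_nonconstant hL hq
    exact hab (is_const_of_deriv_eq_zero hD hcon a b)
  have hsin : Differentiable ℂ fun z : ℂ => Complex.sin (z * L) :=
    Complex.differentiable_sin.comp (differentiable_id.mul_const _)
  filter_upwards [eventually_ne_zero_of_entire hD.deriv ha z,
    eventually_ne_zero_of_entire (hY.differentiable_mainFunction hL.le) h3 z,
    eventually_ne_zero_of_entire (hY.differentiable_y12 hL.le) h1 z,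
    eventually_ne_zero_of_entire hsin h2 z] with w w1 w2 w3 w4
  rintro (h | h | h | h)
  exacts [w1 h, w2 h, w3 h, w4 h]

end Nontriviality

section Uniqueness

variable {L : ℝ} {q : ℝ → ℂ} {Y : ℝ → ℂ → Mat2} {Γ : SpectralArcs L Y} {μ : ℤ → ℂ}
  {f0 fp fm b : ℂ → ℂ} {δ x : ℝ} {Φ Φ' : ℂ → Mat2}

/-- Points of `{Im Δ ≠ 0}` accumulate everywhere, and they are off the contour. -/
lemma SpectralArcs.nhdsWithin_compl_contour_neBot (Γ : SpectralArcs L Y)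
    (hY : IsPrincipalSolution q Y) (hL : 0 < L) (hq : ContDiffOn ℝ 1 q (Set.Icc 0 L)) (z : ℂ) :
    (𝓝[Γ.contourᶜ] z).NeBot := by
  rw [← mem_closure_iff_nhdsWithin_neBot]
  refine closure_mono (fun w hw hw' => ?_)
    (dense_im_ne_zero (hY.differentiable_discriminant hL.le)
      (hY.discriminant_nonconstant hL hq) z)
  exact hw (Γ.im_discriminant_of_mem_contour hY hL.le hw')

lemma IsRHPSolution.eventually_norm_mul_adjugate_le_of_bounded
    (h : IsRHPSolution Γ μ fp fm b δ x Φ) (h' : IsRHPSolution Γ μ fp fm b δ x Φ') {z : ℂ}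
    (hz : z ∈ Γ.contour) (he : z ∉ bandEdges L Y) (hc : z ∈ Γ.crossings ∨ fp z * fm z ≠ 0)
    (i j : Fin 2) :
    ∃ C : ℝ, ∀ᶠ z' in 𝓝[Γ.contourᶜ] z, ‖(Φ z' * (Φ' z').adjugate) i j‖ ≤ C := by
  obtain ⟨C, hC⟩ := h.locally_bounded z hz he hc
  obtain ⟨C', hC'⟩ := h'.locally_bounded z hz he hc
  refine ⟨2 * C * C', ?_⟩
  filter_upwards [hC, hC'] with w hw hw'
  exact norm_mul_adjugate_le hw hw' i j

/-- Off the zeros of `f⁺ f⁻`, both boundary values of `Φ adj Φ'` agree because the jump matrix has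
determinant one. At such zeros only the left boundary value is available. -/
lemma IsRHPSolution.exists_boundary_values (h : IsRHPSolution Γ μ fp fm b δ x Φ)
    (h' : IsRHPSolution Γ μ fp fm b δ x Φ') (hY : IsPrincipalSolution q Y) (hL : 0 ≤ L) {z : ℂ}
    (hz : z ∈ Γ.contour) (he : z ∉ bandEdges L Y) (hc : z ∉ Γ.crossings) (i j : Fin 2) :
    ∃ τ A, τ ≠ 0 ∧ (deriv (discriminant L Y) z * τ).im = 0 ∧
      HasNTLimit (fun z => (Φ z * (Φ' z).adjugate) i j) z τ A ∧
      (fp z * fm z ≠ 0 → HasNTLimit (fun z => (Φ z * (Φ' z).adjugate) i j) z (-τ) A) := by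
  by_cases him : z.im = 0
  · obtain ⟨y, rfl⟩ : ∃ y : ℝ, (y : ℂ) = z := ⟨z.re, Complex.ext (by simp) (by simp [him])⟩
    obtain ⟨Φp, Φm, -, -, h1, h2⟩ := h.real_boundary
    obtain ⟨Φp', Φm', -, -, h1', h2'⟩ := h'.real_boundary
    refine ⟨1, (Φp y * (Φp' y).adjugate) i j, one_ne_zero, ?_,
      (h1 y hc).mul_adjugate (h1' y hc) i j, fun hf => ?_⟩
    · rw [mul_one]
      exact im_deriv_discriminant_of_real hY hL him
    · obtain ⟨h3, h4⟩ := h2 y hc hf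
      obtain ⟨h3', h4'⟩ := h2' y hc hf
      rw [h4, h4', mul_adjugate_mul_of_det_eq_one (det_jumpReal Γ μ fp fm hf)]
      exact h3.mul_adjugate h3' i j
  · obtain ⟨n, hn, t, ht, rfl⟩ := Γ.exists_arcParams hz him he
    obtain ⟨Φp, Φm, -, -, h1, h2⟩ := h.arc_boundary n hn
    obtain ⟨Φp', Φm', -, -, h1', h2'⟩ := h'.arc_boundary n hn
    refine ⟨deriv (Γ.γ n) t, (Φp t * (Φp' t).adjugate) i j, Γ.regular n hn t,
      Γ.im_deriv_discriminant_mul_tangent hY hL hn t,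
      (h1 t ht).mul_adjugate (h1' t ht) i j, fun hf => ?_⟩
    obtain ⟨h3, h4⟩ := h2 t ht hf
    obtain ⟨h3', h4'⟩ := h2' t ht hf
    rw [h4, h4', mul_adjugate_mul_of_det_eq_one (det_jumpArc Γ μ fp fm hf)]
    exact h3.mul_adjugate h3' i j

/-- At a band edge the product of two quartic root singularities is weaker than a pole. -/
lemma IsRHPSolution.tendsto_mul_zero_of_bandEdge (h : IsRHPSolution Γ μ fp fm b δ x Φ)
    (h' : IsRHPSolution Γ μ fp fm b δ x Φ') {e : ℂ} (he : e ∈ bandEdges L Y) (i j : Fin 2) :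
    Tendsto (fun z => (z - e) * (Φ z * (Φ' z).adjugate) i j) (𝓝[Γ.contourᶜ] e) (𝓝 0) := by
  obtain ⟨C, hC⟩ := h.quartic_root e he
  obtain ⟨C', hC'⟩ := h'.quartic_root e he
  have hlim : Tendsto (fun z : ℂ => 2 * C * C' * ‖z - e‖ ^ (1 / 2 : ℝ)) (𝓝[Γ.contourᶜ] e)
      (𝓝 0) := by
    have : Continuous fun z : ℂ => 2 * C * C' * ‖z - e‖ ^ (1 / 2 : ℝ) :=
      continuous_const.mul ((continuous_id.sub continuous_const).norm.rpow_const
        fun _ => Or.inr (by norm_num))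
    have h0 := this.tendsto e
    rw [sub_self, norm_zero, Real.zero_rpow (by norm_num), mul_zero] at h0
    exact h0.mono_left nhdsWithin_le_nhds
  refine squeeze_zero_norm' ?_ hlim
  filter_upwards [hC, hC'] with z hz hz'
  rw [norm_mul]
  rcases eq_or_ne z e with rfl | hne
  · rw [sub_self, norm_zero, zero_mul, Real.zero_rpow (by norm_num), mul_zero]
  have hp : 0 < ‖z - e‖ := norm_pos_iff.2 (sub_ne_zero.2 hne)
  calc ‖z - e‖ * ‖(Φ z * (Φ' z).adjugate) i j‖
      ≤ ‖z - e‖ * (2 * (C * ‖z - e‖ ^ (-(1 / 4) : ℝ)) * (C' * ‖z - e‖ ^ (-(1 / 4) : ℝ))) := by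
        gcongr
        exact norm_mul_adjugate_le hz hz' i j
    _ =
        2 * C * C' * (‖z - e‖ ^ (1 : ℝ) * (‖z - e‖ ^ (-(1 / 4) : ℝ) * ‖z - e‖ ^ (-(1 / 4) : ℝ))) := by
        rw [Real.rpow_one]; ring
    _ = 2 * C * C' * ‖z - e‖ ^ (1 / 2 : ℝ) := by
        rw [← Real.rpow_add hp, ← Real.rpow_add hp]; norm_num

/-- The entries of `Φ adj Φ'` extend to entire functions. -/
lemma IsRHPSolution.exists_entire_extension (h : IsRHPSolution Γ μ fp fm b δ x Φ)
    (h' : IsRHPSolution Γ μ fp fm b δ x Φ') (hY : IsPrincipalSolution q Y) (hL : 0 < L)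
    (hq : ContDiffOn ℝ 1 q (Set.Icc 0 L))
    (hf : ∀ z, z ∉ exceptionalSet L Y → fp z * fm z ≠ 0) (i j : Fin 2) :
    ∃ G : ℂ → ℂ, Differentiable ℂ G ∧ ∀ z ∉ Γ.contour, (Φ z * (Φ' z).adjugate) i j = G z := by
  have hbounded : ∀ z : ℂ, (∃ C : ℝ, ∀ᶠ z' in 𝓝[Γ.contourᶜ] z,
      ‖(Φ z' * (Φ' z').adjugate) i j‖ ≤ C) →
      Tendsto (fun z' => (z' - z) * (Φ z' * (Φ' z').adjugate) i j) (𝓝[Γ.contourᶜ] z) (𝓝 0) := by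
    rintro z ⟨C, hC⟩
    have h0 : Tendsto (fun z' : ℂ => z' - z) (𝓝[Γ.contourᶜ] z) (𝓝 0) := by
      have : Continuous fun z' : ℂ => z' - z := by fun_prop
      have h0 := this.tendsto z
      rw [sub_self] at h0
      exact h0.mono_left nhdsWithin_le_nhds
    exact h0.zero_mul_isBoundedUnder_le ⟨C, hC⟩
  refine ZSPeriodic.exists_entire_extension (S := exceptionalSet L Y)
    (hY.differentiable_discriminant hL.le) (hY.discriminant_nonconstant hL hq)
    (fun z hz => Γ.im_discriminant_of_mem_contour hY hL.le hz)
    (hY.eventually_notMem_exceptionalSet hL hq) (fun z hz h0 => hz (Or.inl h0)) ?_ ?_ ?_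
  · have e1 := h.holomorphic
    have e2 := h'.holomorphic
    match j with
    | 0 =>
      simp only [mul_adjugate_apply_zero]
      exact ((e1 i 0).mul (e2 1 1)).add ((e1 i 1).mul (e2 1 0).neg)
    | 1 =>
      simp only [mul_adjugate_apply_one]
      exact ((e1 i 0).mul (e2 0 1).neg).add ((e1 i 1).mul (e2 0 0))
  · intro z hz hzS
    have he : z ∉ bandEdges L Y := fun he =>
      hzS (Or.inr (Or.inl (mainFunction_eq_zero_of_mem_bandEdges he)))
    have hc : z ∉ Γ.crossings := fun hc =>
      hzS (Or.inl (Γ.deriv_discriminant_eq_zero_of_crossing hY hL.le hc))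
    refine ⟨?_, h.eventually_norm_mul_adjugate_le_of_bounded h' hz he (Or.inr (hf z hzS)) i j⟩
    obtain ⟨τ, A, h1, h2, h3, h4⟩ := h.exists_boundary_values h' hY hL.le hz he hc i j
    exact ⟨τ, A, h1, h2, h3, h4 (hf z hzS)⟩
  · intro z hz _
    by_cases he : z ∈ bandEdges L Y
    · exact Or.inl (h.tendsto_mul_zero_of_bandEdge h' he i j)
    by_cases hc : z ∈ Γ.crossings ∨ fp z * fm z ≠ 0
    · exact Or.inl (hbounded z (h.eventually_norm_mul_adjugate_le_of_bounded h' hz he hc i j))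
    push Not at hc
    obtain ⟨hc, hf0⟩ := hc
    refine Or.inr ⟨?_, ?_⟩
    · obtain ⟨C, hC⟩ := h.simple_pole z hz he hf0
      obtain ⟨C', hC'⟩ := h'.simple_pole z hz he hf0
      refine ⟨2 * C * C', ?_⟩
      filter_upwards [hC, hC'] with w hw hw'
      refine (norm_mul_adjugate_le hw hw' i j).trans_eq ?_
      rw [sq, ← div_div]
      ring
    · obtain ⟨τ, A, h1, -, h3, -⟩ := h.exists_boundary_values h' hY hL.le hz he hc i j
      exact ⟨τ, A, h1, h3⟩

end Uniqueness

/-! ### Growth and behaviour at infinity -/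

section Uniqueness

variable {L : ℝ} {q : ℝ → ℂ} {Y : ℝ → ℂ → Mat2} {Γ : SpectralArcs L Y} {μ : ℤ → ℂ}
  {f0 fp fm b : ℂ → ℂ} {δ x : ℝ} {Φ Φ' : ℂ → Mat2}

/-- The circles `‖z‖ = (N + 1/2) π / L` keep away from the band edges, because these approach
the points `j π / L`. -/
lemma IsPrincipalSolution.exists_bandEdges_dist (hY : IsPrincipalSolution q Y) (hL : 0 < L)
    (hq : ContDiffOn ℝ 1 q (Set.Icc 0 L)) :
    ∃ N₀ : ℕ, ∀ N : ℕ, N₀ ≤ N → ∀ z : ℂ, ‖z‖ = (N + 1 / 2) * (Real.pi / L) →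
      ∀ e ∈ bandEdges L Y, 3 * (Real.pi / (8 * L)) ≤ ‖z - e‖ := by
  obtain ⟨R, hR, h⟩ := hY.exists_spectral_lower_bound hL hq
  set d := Real.pi / (8 * L) with hd
  have hdp : 0 < d := by positivity
  have hdL : Real.pi / L = 8 * d := by rw [hd]; field_simp
  obtain ⟨N₀, hN₀⟩ := exists_nat_ge ((R + 3 * d) / (8 * d))
  refine ⟨N₀, fun N hN z hz e he => ?_⟩
  have h1 : R + 3 * d ≤ N * (8 * d) := by
    rw [← div_le_iff₀ (by positivity)]
    exact hN₀.trans (by exact_mod_cast hN)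
  rw [hdL] at hz
  rcases lt_or_ge ‖e‖ R with heR | heR
  · have := norm_sub_norm_le z e
    nlinarith
  · obtain ⟨j, hj⟩ : ∃ j : ℤ, ‖e * L - (j * Real.pi : ℝ)‖ < Real.pi / 8 := by
      by_contra! hcon
      have h2 := (h e heR hcon).2
      rw [mainFunction_eq_zero_of_mem_bandEdges he, norm_zero, mul_zero] at h2
      exact absurd h2 (not_le.2 (by positivity))
    have h3 : |‖e‖ - |(j : ℝ)| * (8 * d)| < d := by
      have e1 : e * L - (j * Real.pi : ℝ) = (e - ((j * (8 * d) : ℝ) : ℂ)) * L := by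
        rw [← hdL]
        have : (L : ℂ) ≠ 0 := by exact_mod_cast hL.ne'
        push_cast
        field_simp
      rw [e1, norm_mul, Complex.norm_real, Real.norm_of_nonneg hL.le] at hj
      have e2 : ‖e - ((j * (8 * d) : ℝ) : ℂ)‖ < d := by
        have e4 : d * L = Real.pi / 8 := by rw [hd]; field_simp
        exact lt_of_mul_lt_mul_right (hj.trans_eq e4.symm) hL.le
      have e3 := abs_norm_sub_norm_le e ((j * (8 * d) : ℝ) : ℂ)
      rw [Complex.norm_real, Real.norm_eq_abs, abs_mul, abs_of_pos (by positivity : 0 < 8 * d)]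
        at e3
      exact e3.trans_lt e2
    have h4 := abs_norm_sub_norm_le z e
    rw [hz] at h4
    -- the norm of the circle is at distance at least `4 d` from every `|j| π / L`
    have hjn : ((j.natAbs : ℕ) : ℝ) = |(j : ℝ)| := by
      rw [Nat.cast_natAbs, Int.cast_abs]
    rw [← hjn] at h3
    rw [abs_lt] at h3
    rcases le_or_gt j.natAbs N with hle | hlt
    · have h5 : ((j.natAbs : ℕ) : ℝ) ≤ N := by exact_mod_cast hle
      have h6 := (le_abs_self _).trans h4
      nlinarith
    · have h5 : (N : ℝ) + 1 ≤ ((j.natAbs : ℕ) : ℝ) := by exact_mod_cast hlt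
      have h6 := (neg_le_abs _).trans h4
      nlinarith

/-- A bound off the contour carries over to the continuous extension. -/
lemma SpectralArcs.norm_le_of_eventually (Γ : SpectralArcs L Y) (hY : IsPrincipalSolution q Y)
    (hL : 0 < L) (hq : ContDiffOn ℝ 1 q (Set.Icc 0 L)) {G : ℂ → ℂ} {g : ℂ → ℝ} {z : ℂ}
    (hG : ContinuousAt G z) (hg : ContinuousAt g z)
    (h : ∀ᶠ z' in 𝓝[Γ.contourᶜ] z, ‖G z'‖ ≤ g z') : ‖G z‖ ≤ g z := by
  have := Γ.nhdsWithin_compl_contour_neBot hY hL hq z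
  exact le_of_tendsto_of_tendsto (hG.norm.mono_left nhdsWithin_le_nhds)
    (hg.mono_left nhdsWithin_le_nhds) h

lemma IsRHPSolution.exists_circle_bound (h : IsRHPSolution Γ μ fp fm b δ x Φ)
    (h' : IsRHPSolution Γ μ fp fm b δ x Φ') (hY : IsPrincipalSolution q Y) (hL : 0 < L)
    (hq : ContDiffOn ℝ 1 q (Set.Icc 0 L)) (hδL : δ ≤ Real.pi / (4 * L)) {i j : Fin 2} {G : ℂ → ℂ}
    (hG : Continuous G) (hGeq : ∀ z ∉ Γ.contour, (Φ z * (Φ' z).adjugate) i j = G z) :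
    ∃ c M : ℝ, 0 ≤ c ∧ 0 ≤ M ∧ ∃ N₀ : ℕ, ∀ N : ℕ, N₀ ≤ N →
      ∀ z : ℂ, ‖z‖ = (N + 1 / 2) * (Real.pi / L) → ‖G z‖ ≤ M * Real.exp (c * ‖z‖ ^ 2) := by
  obtain ⟨c, M, hc, hM, hΦ⟩ := h.growth
  obtain ⟨c', M', hc', hM', hΦ'⟩ := h'.growth
  obtain ⟨N₀, hN₀⟩ := hY.exists_bandEdges_dist hL hq
  refine ⟨c + c', 2 * M * M', by positivity, by positivity, N₀, fun N hN z hz => ?_⟩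
  refine Γ.norm_le_of_eventually hY hL hq
    (g := fun z => 2 * M * M' * Real.exp ((c + c') * ‖z‖ ^ 2)) hG.continuousAt
    (by fun_prop) ?_
  set d := Real.pi / (8 * L) with hd
  have hdp : 0 < d := by positivity
  have hdδ : δ ≤ 2 * d := hδL.trans_eq (by rw [hd]; field_simp; norm_num)
  filter_upwards [self_mem_nhdsWithin, mem_nhdsWithin_of_mem_nhds (Metric.ball_mem_nhds z hdp)]
    with w hw hwz
  rw [Metric.mem_ball, dist_eq_norm] at hwz
  have hδw : ∀ e ∈ bandEdges L Y, δ ≤ ‖w - e‖ := by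
    intro e he
    have h1 := hN₀ N hN z hz e he
    have h2 := norm_sub_le_norm_sub_add_norm_sub z w e
    rw [norm_sub_rev z w] at h2
    linarith
  rw [← hGeq w hw]
  refine (norm_mul_adjugate_le (hΦ w hw hδw) (hΦ' w hw hδw) i j).trans_eq ?_
  rw [add_mul, Real.exp_add]
  ring

/-- In a sector away from the real axis `det B` is bounded and does not vanish near infinity. -/
lemma IsBranch.exists_det_bound (hb : IsBranch Γ f0 b) (hμ : IsDirichletEnumeration L Y μ)
    (hY : IsPrincipalSolution q Y) (hL : 0 < L) (hq : ContDiffOn ℝ 1 q (Set.Icc 0 L))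
    (hF : ∀ z, Tendsto (fun N : ℕ => ∏ j ∈ Finset.Icc (-(N : ℤ)) (N : ℤ),
      (μ j - z) / piConst L j) atTop (𝓝 (-f0 z * fp z * fm z))) :
    ∃ D R : ℝ, 0 ≤ D ∧ 1 ≤ R ∧ ∀ z ∉ Γ.contour, R ≤ ‖z‖ → ‖z‖ / 4 ≤ |z.im| →
      ‖(matB fp fm b z).det‖ ≤ D ∧ (matB fp fm b z).det ≠ 0 := by
  obtain ⟨hne, K, hK, hbd⟩ := hμ.exists_product_bounds hY hL hq hF
  obtain ⟨R, hR, h⟩ := hY.exists_sector_bound hL hq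
  refine ⟨23 * K, max 1 (max R (4 / L)), by positivity, le_max_left _ _, fun z hz hzR hzs => ?_⟩
  have hzR' := (le_max_right _ _).trans hzR
  obtain ⟨h1, h2, h3, h4⟩ := h z ((le_max_left _ _).trans hzR') hzs
  have h5 := hbd z ((le_max_right _ _).trans hzR') hzs
  have h6 := hb.norm_det_sq Γ fp fm hz
  have hmp : 0 < ‖mainFunction L Y z‖ := norm_pos_iff.2 h3
  constructor
  · have h7 : ‖-f0 z * fp z * fm z‖ ^ 2 ≤ K ^ 2 * (512 * ‖mainFunction L Y z‖) := by
      calc _ ≤ (K * Real.exp |(z * L).im|) ^ 2 := by gcongr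
        _ = K ^ 2 * Real.exp |(z * L).im| ^ 2 := mul_pow _ _ _
        _ ≤ _ := by gcongr
    rw [← h6] at h7
    have h8 : ‖(matB fp fm b z).det‖ ^ 2 ≤ K ^ 2 * 512 := by
      rw [← mul_assoc] at h7
      exact le_of_mul_le_mul_right h7 hmp
    refine abs_le_of_sq_le_sq' (h8.trans ?_) (by positivity) |>.2
    nlinarith [sq_nonneg K]
  · intro h0
    rw [h0, norm_zero, zero_pow two_ne_zero, zero_mul] at h6
    refine hne z h2 (fun j hj => h1 (hj ▸ hμ.y12_eq_zero j)) ?_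
    exact norm_eq_zero.1 (pow_eq_zero_iff two_ne_zero |>.1 h6.symm)

lemma mul_adjugate_of_common_factor (A A' B : Mat2) :
    ((1 + A) * B) * ((1 + A') * B).adjugate = B.det • ((1 + A) * (1 + A').adjugate) := by
  rw [Matrix.adjugate_mul_distrib, Matrix.mul_assoc, ← Matrix.mul_assoc B, Matrix.mul_adjugate,
    Matrix.smul_mul, Matrix.one_mul, Matrix.mul_smul]

lemma norm_one_add_apply_le {A : Mat2} {a : ℝ} (hA : ∀ i j, ‖A i j‖ ≤ a) (i j : Fin 2) :
    ‖(1 + A) i j‖ ≤ 1 + a := by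
  rw [Matrix.add_apply]
  refine (norm_add_le _ _).trans (add_le_add ?_ (hA i j))
  rw [Matrix.one_apply]
  split_ifs <;> simp

lemma det_one_add_ne_zero {A : Mat2} (hA : ∀ i j, ‖A i j‖ ≤ 1 / 4) : (1 + A).det ≠ 0 := by
  intro h0
  rw [Matrix.det_fin_two] at h0
  simp only [Matrix.add_apply, Matrix.one_apply_eq, ne_eq, zero_ne_one, one_ne_zero,
    not_false_eq_true, Matrix.one_apply_ne, zero_add] at h0
  have h1 : (1 : ℂ) = -A 0 0 - A 1 1 - A 0 0 * A 1 1 + A 0 1 * A 1 0 := by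
    linear_combination h0
  have h2 := congrArg norm h1
  rw [norm_one] at h2
  have h3 : ‖-A 0 0 - A 1 1 - A 0 0 * A 1 1 + A 0 1 * A 1 0‖ ≤
      1 / 4 + 1 / 4 + 1 / 4 * (1 / 4) + 1 / 4 * (1 / 4) := by
    refine (norm_add_le _ _).trans (add_le_add ?_ ?_)
    · refine (norm_sub_le _ _).trans (add_le_add ?_ ?_)
      · refine (norm_sub_le _ _).trans (add_le_add ?_ (hA _ _))
        rw [norm_neg]; exact hA _ _
      · rw [norm_mul]; gcongr <;> exact hA _ _
    · rw [norm_mul]; gcongr <;> exact hA _ _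
  rw [← h2] at h3
  norm_num at h3

/-- By the normalization at infinity and the growth condition, the entire function `Φ adj Φ'`
is constant. -/
lemma IsRHPSolution.exists_mul_adjugate_eq (h : IsRHPSolution Γ μ fp fm b δ x Φ)
    (h' : IsRHPSolution Γ μ fp fm b δ x Φ') (hY : IsPrincipalSolution q Y) (hL : 0 < L)
    (hq : ContDiffOn ℝ 1 q (Set.Icc 0 L)) (hδL : δ ≤ Real.pi / (4 * L)) (hb : IsBranch Γ f0 b)
    (hμ : IsDirichletEnumeration L Y μ)
    (hF : ∀ z, Tendsto (fun N : ℕ => ∏ j ∈ Finset.Icc (-(N : ℤ)) (N : ℤ),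
      (μ j - z) / piConst L j) atTop (𝓝 (-f0 z * fp z * fm z))) :
    ∃ K : Mat2, ∀ z ∉ Γ.contour, Φ z * (Φ' z).adjugate = K := by
  have hf : ∀ z, z ∉ exceptionalSet L Y → fp z * fm z ≠ 0 := by
    intro z hz h0
    refine (hμ.exists_product_bounds hY hL hq hF).1 z (fun hs => hz (Or.inr (Or.inr (Or.inr hs))))
      (fun j hj => hz (Or.inr (Or.inr (Or.inl (hj ▸ hμ.y12_eq_zero j))))) ?_
    rw [mul_assoc, h0, mul_zero]
  have key : ∀ i j, ∃ k : ℂ, ∀ z ∉ Γ.contour, (Φ z * (Φ' z).adjugate) i j = k := by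
    intro i j
    obtain ⟨G, hG, hGeq⟩ := h.exists_entire_extension h' hY hL hq hf i j
    obtain ⟨c, M, hc, hM, N₀, hcirc⟩ := h.exists_circle_bound h' hY hL hq hδL hG.continuous hGeq
    obtain ⟨D, R, hD, hR1, hdet⟩ := hb.exists_det_bound hμ hY hL hq hF
    obtain ⟨C₁, R₁, hA₁⟩ := h.asymptotics (1 / 4) (by norm_num)
    obtain ⟨C₂, R₂, hA₂⟩ := h'.asymptotics (1 / 4) (by norm_num)
    refine ⟨G 0, fun z hz => (hGeq z hz).trans (eq_of_circles_of_sector hG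
      (R := max R (max R₁ R₂) + 1) (C := D * (2 * (1 + |C₁|) * (1 + |C₂|)))
      (by positivity : 0 < Real.pi / L) hc hM hcirc (fun w hw hws => ?_) z 0)⟩
    refine Γ.norm_le_of_eventually hY hL hq
      (g := fun _ => D * (2 * (1 + |C₁|) * (1 + |C₂|))) hG.continuous.continuousAt
      continuousAt_const ?_
    have hRm : 1 ≤ max R (max R₁ R₂) := le_max_of_le_left hR1
    have hopen : ∀ᶠ v in 𝓝 w, max R (max R₁ R₂) < ‖v‖ ∧ ‖v‖ / 4 < |v.im| := by
      refine Filter.Eventually.and ?_ ?_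
      · exact continuous_norm.continuousAt.eventually_const_lt (by linarith)
      · exact ContinuousAt.eventually_lt (by fun_prop)
          (Complex.continuous_im.abs.continuousAt) (by linarith)
    filter_upwards [self_mem_nhdsWithin, mem_nhdsWithin_of_mem_nhds hopen] with v hv hv2
    obtain ⟨hvR, hvs⟩ := hv2
    have hv1 : 1 ≤ ‖v‖ := hRm.trans hvR.le
    obtain ⟨A₁, hA₁, e₁⟩ := hA₁ v hv ((le_max_left _ _).trans ((le_max_right R _).trans hvR.le))
      (by linarith)
    obtain ⟨A₂, hA₂, e₂⟩ := hA₂ v hv ((le_max_right _ _).trans ((le_max_right R _).trans hvR.le))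
      (by linarith)
    obtain ⟨hdD, -⟩ := hdet v hv ((le_max_left _ _).trans hvR.le) hvs.le
    have hle : ∀ C : ℝ, C / ‖v‖ ≤ |C| := fun C =>
      (div_le_div_of_nonneg_right (le_abs_self C) (by positivity)).trans
        (div_le_self (abs_nonneg C) hv1)
    rw [← hGeq v hv, e₁, e₂, mul_adjugate_of_common_factor, Matrix.smul_apply, smul_eq_mul,
      norm_mul]
    refine mul_le_mul hdD (norm_mul_adjugate_le ?_ ?_ i j) (norm_nonneg _) hD
    · exact norm_one_add_apply_le fun i j => (hA₁ i j).trans (hle C₁)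
    · exact norm_one_add_apply_le fun i j => (hA₂ i j).trans (hle C₂)
  choose k hk using key
  exact ⟨Matrix.of k, fun z hz => Matrix.ext fun i j => hk i j z hz⟩

/-- There are points off the contour in every neighbourhood of infinity in a sector. -/
lemma SpectralArcs.exists_notMem_contour_sector (Γ : SpectralArcs L Y)
    (hY : IsPrincipalSolution q Y) (hL : 0 < L) (hq : ContDiffOn ℝ 1 q (Set.Icc 0 L)) (r : ℝ) :
    ∃ z ∉ Γ.contour, r ≤ ‖z‖ ∧ ‖z‖ / 4 ≤ |z.im| := by
  set s := |r| + 1 with hs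
  have hsp : 0 < s := by positivity
  have hrs : r < s := (le_abs_self r).trans_lt (lt_add_one _)
  have hn : ‖(s : ℂ) * Complex.I‖ = s := by
    rw [norm_mul, Complex.norm_I, mul_one, Complex.norm_real, Real.norm_of_nonneg hsp.le]
  have him : ((s : ℂ) * Complex.I).im = s := by simp
  have := Γ.nhdsWithin_compl_contour_neBot hY hL hq (s * Complex.I)
  have hopen : ∀ᶠ v in 𝓝 ((s : ℂ) * Complex.I), r < ‖v‖ ∧ ‖v‖ / 4 < |v.im| := by
    refine Filter.Eventually.and ?_ ?_
    · exact continuous_norm.continuousAt.eventually_const_lt (hrs.trans_eq hn.symm)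
    · exact ContinuousAt.eventually_lt (by fun_prop) (Complex.continuous_im.abs.continuousAt)
        (by rw [hn, him, abs_of_pos hsp]; linarith)
  obtain ⟨z, h1, h2⟩ := ((eventually_mem_nhdsWithin (s := Γ.contourᶜ)).and
    (hopen.filter_mono nhdsWithin_le_nhds)).exists
  exact ⟨z, h1, h2.1.le, h2.2.le⟩

end Uniqueness

/-! ### Uniqueness -/

section Uniqueness

variable {L : ℝ} {q : ℝ → ℂ} {Y : ℝ → ℂ → Mat2} {Γ : SpectralArcs L Y} {μ : ℤ → ℂ}
  {f0 fp fm b : ℂ → ℂ} {δ x : ℝ} {Φ Φ' : ℂ → Mat2}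

lemma IsRHPSolution.eq_off_contour (h : IsRHPSolution Γ μ fp fm b δ x Φ)
    (h' : IsRHPSolution Γ μ fp fm b δ x Φ') (hY : IsPrincipalSolution q Y) (hL : 0 < L)
    (hq : ContDiffOn ℝ 1 q (Set.Icc 0 L)) (hδL : δ ≤ Real.pi / (4 * L)) (hb : IsBranch Γ f0 b)
    (hμ : IsDirichletEnumeration L Y μ)
    (hF : ∀ z, Tendsto (fun N : ℕ => ∏ j ∈ Finset.Icc (-(N : ℤ)) (N : ℤ),
      (μ j - z) / piConst L j) atTop (𝓝 (-f0 z * fp z * fm z)))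
    {z : ℂ} (hz : z ∉ Γ.contour) : Φ z = Φ' z := by
  obtain ⟨K, hK⟩ := h.exists_mul_adjugate_eq h' hY hL hq hδL hb hμ hF
  obtain ⟨K', hK'⟩ := h'.exists_mul_adjugate_eq h' hY hL hq hδL hb hμ hF
  obtain ⟨D, R, hD, hR1, hdet⟩ := hb.exists_det_bound hμ hY hL hq hF
  obtain ⟨C₁, R₁, hA₁⟩ := h.asymptotics (1 / 4) (by norm_num)
  obtain ⟨C₂, R₂, hA₂⟩ := h'.asymptotics (1 / 4) (by norm_num)
  -- far out in the sector both solutions are close to `B`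
  have hfar : ∀ r : ℝ, 4 * |C₂| ≤ r → 1 ≤ r → K'.det ≠ 0 ∧
      ∀ i j, ‖(K - K') i j‖ ≤ D * (2 * (|C₁| + |C₂|) * (1 + |C₂|)) / r := by
    intro r hr4 hr1
    obtain ⟨w, hw, hwr, hws⟩ := Γ.exists_notMem_contour_sector hY hL hq
      (max r (max R (max R₁ R₂)))
    have hr : r ≤ ‖w‖ := (le_max_left _ _).trans hwr
    have hwr' := (le_max_right _ _).trans hwr
    have hwR : R ≤ ‖w‖ := (le_max_left _ _).trans hwr'
    have hwr'' := (le_max_right _ _).trans hwr'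
    obtain ⟨A₁, hA₁, e₁⟩ := hA₁ w hw ((le_max_left _ _).trans hwr'') (by linarith)
    obtain ⟨A₂, hA₂, e₂⟩ := hA₂ w hw ((le_max_right _ _).trans hwr'') (by linarith)
    obtain ⟨hdD, hd0⟩ := hdet w hw hwR hws
    have hw1 : 1 ≤ ‖w‖ := hr1.trans hr
    have hwp : 0 < ‖w‖ := by linarith
    have hle : ∀ C : ℝ, C / ‖w‖ ≤ |C| / ‖w‖ := fun C =>
      div_le_div_of_nonneg_right (le_abs_self C) hwp.le
    have hK'w := hK' w hw
    refine ⟨?_, fun i j => ?_⟩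
    · have h4 : (1 + A₂).det ≠ 0 := det_one_add_ne_zero fun i j =>
        ((hA₂ i j).trans (hle C₂)).trans (by rw [div_le_iff₀ hwp]; linarith)
      rw [← hK'w, Matrix.det_mul, Matrix.det_adjugate, Fintype.card_fin, e₂, Matrix.det_mul]
      exact mul_ne_zero (mul_ne_zero h4 hd0) (pow_ne_zero _ (mul_ne_zero h4 hd0))
    · have e3 : K - K' = (matB fp fm b w).det • ((A₁ - A₂) * (1 + A₂).adjugate) := by
        rw [← hK w hw, ← hK'w, e₁, e₂, mul_adjugate_of_common_factor,
          mul_adjugate_of_common_factor, ← smul_sub, ← sub_mul, add_sub_add_left_eq_sub]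
      rw [e3, Matrix.smul_apply, smul_eq_mul, norm_mul]
      have h5 : ∀ i j, ‖(A₁ - A₂) i j‖ ≤ (|C₁| + |C₂|) / ‖w‖ := fun i j => by
        rw [Matrix.sub_apply, add_div]
        exact (norm_sub_le _ _).trans
          (add_le_add ((hA₁ i j).trans (hle C₁)) ((hA₂ i j).trans (hle C₂)))
      have h6 : ∀ i j, ‖(1 + A₂) i j‖ ≤ 1 + |C₂| := norm_one_add_apply_le fun i j =>
        ((hA₂ i j).trans (hle C₂)).trans (div_le_self (abs_nonneg _) hw1)
      calc _ ≤ D * (2 * ((|C₁| + |C₂|) / ‖w‖) * (1 + |C₂|)) :=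
            mul_le_mul hdD (norm_mul_adjugate_le h5 h6 i j) (norm_nonneg _) hD
        _ = D * (2 * (|C₁| + |C₂|) * (1 + |C₂|)) / ‖w‖ := by ring
        _ ≤ _ := by gcongr
  have hKK : K = K' := by
    ext i j
    have hlim : Tendsto (fun r : ℝ => D * (2 * (|C₁| + |C₂|) * (1 + |C₂|)) / r) atTop (𝓝 0) :=
      tendsto_const_nhds.div_atTop tendsto_id
    have h7 : ‖(K - K') i j‖ ≤ 0 := by
      refine ge_of_tendsto hlim ?_
      filter_upwards [eventually_ge_atTop (4 * |C₂|), eventually_ge_atTop 1] with r h1 h2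
      exact (hfar r h1 h2).2 i j
    exact sub_eq_zero.1 (norm_le_zero_iff.1 h7)
  have hdetK : K'.det ≠ 0 := (hfar (max (4 * |C₂|) 1) (le_max_left _ _) (le_max_right _ _)).1
  have hdet' : (Φ' z).det ≠ 0 := by
    intro h0
    rw [← hK' z hz, Matrix.det_mul, h0, zero_mul] at hdetK
    exact hdetK rfl
  have h8 : Φ z * (Φ' z).adjugate * Φ' z = Φ' z * (Φ' z).adjugate * Φ' z := by
    rw [hK z hz, hK' z hz, hKK]
  rw [Matrix.mul_assoc, Matrix.mul_assoc, Matrix.adjugate_mul, Matrix.mul_smul, Matrix.mul_smul,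
    Matrix.mul_one, Matrix.mul_one] at h8
  exact smul_right_injective Mat2 hdet' h8

end Uniqueness

end ZSPeriodic

end

open ZSPeriodic in
theorem theorem4p2 (L : ℝ) (hL : 0 < L) (q : ℝ → ℂ)
    (hq : ContDiffOn ℝ 2 q (Set.Icc 0 L)) (hper : Function.Periodic q L)
    (Y : ℝ → ℂ → Mat2) (hY : IsPrincipalSolution q Y)
    (hmult : MultiplicityAssumptions L Y) (Γ : SpectralArcs L Y)
    (μ : ℤ → ℂ) (hμ : IsDirichletEnumeration L Y μ)
    (f0 fp fm : ℂ → ℂ)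
    (hf0 : IsSymmetricProduct L μ {j | Γ.nu (μ j) = 0} (fun z => -f0 z))
    (hfp : IsSymmetricProduct L μ {j | Γ.nu (μ j) = 1} fp)
    (hfm : IsSymmetricProduct L μ {j | Γ.nu (μ j) = -1} fm)
    (b : ℂ → ℂ) (hb : IsBranch Γ f0 b)
    (δ : ℝ) (hδ : 0 < δ) (hδL : δ ≤ Real.pi / (4 * L)) (x : ℝ)
    (Φ₁ Φ₂ : ℂ → Mat2)
    (h₁ : IsRHPSolution Γ μ fp fm b δ x Φ₁) (h₂ : IsRHPSolution Γ μ fp fm b δ x Φ₂) :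
    ∀ z : ℂ, z ∉ Γ.contour → Φ₁ z = Φ₂ z :=
  fun _ hz => h₁.eq_off_contour h₂ hY hL (hq.of_le (by norm_num)) hδL hb hμ
    (tendsto_product_of_symmetricProducts Γ hf0 hfp hfm) hz
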